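/- Let $q\in(0,1)$ and let $\mathcal A$ be the Hopf $*$-algebra of polynomial functions on $SU_q(2)$: the unital $*$-algebra generated by $\alpha,\gamma$ with $$\alpha^*\alpha+\gamma^*\gamma=1,\quad \alpha\alpha^*+q^2\gamma^*\gamma=1,\quad \gamma^*\gamma=\gamma\gamma^*,\quad \alpha\gamma=q\gamma\alpha,\quad \alpha\gamma^*=q\gamma^*\alpha,$$ and coproduct $\Delta(\alpha)=\alpha\otimes\alpha-q\gamma^*\otimes\gamma$, $\Delta(\gamma)=\gamma\otimes\alpha+\alpha^*\otimes\gamma$. Let $h$ be its Haar state. Let $k,e,f$ be the generators of $U_q(\mathfrak{su}_2)$, regarded as functionals on $\mathcal A$: on the matrix $\begin{pmatrix}\alpha&-q\gamma^*\\ \gamma&\alpha^*\end{pmatrix}$ they take the values $\begin{pmatrix}q^{1/2}&0\\0&q^{-1/2}\end{pmatrix}$, $\begin{pmatrix}0&1\\0&0\end{pmatrix}$, $\begin{pmatrix}0&0\\1&0\end{pmatrix}$ respectively, $k$ is a character with convolution inverse $k^{-1}$ (as a functional), and $\omega(ab)=\omega(a)k^{-1}(b)+k(a)\omega(b)$ for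 $\omega=e,f$. Put $\partial_\omega(a)=(\iota\otimes\omega)\Delta(a)$, $\mathcal A_n=\{a\in\mathcal A:\partial_k(a)=q^{n/2}a\}$ and $\mathcal B=\mathcal A_0$, the polynomial functions on the quantum sphere. Let $L^2(A_n,h)$ be the completion of $\mathcal A_n$ for $\langle a,b\rangle=h(a^*b)$. On $H_+\oplus H_-=L^2(A_1,h)\oplus L^2(A_{-1},h)$, where $\mathcal B$ acts by left multiplication, let $$D=\begin{pmatrix}0&\partial_e\\ \partial_f&0\end{pmatrix},\qquad \chi=\begin{pmatrix}q&0\\0&q^{-1}\end{pmatrix},$$ where $D$ denotes the closure of this operator on $\mathcal A_1\oplus\mathcal A_{-1}$; the complex powers of $|D|$ are formed by means of the eigenspace decomposition of $D$. Let $b\in\mathcal B$. Then $b$ maps the domain of $D$ into itself, the commutator $[D,b]$ extends to a bounded operator $db$ on $H_+\oplus H_-$, and there is an analytic function $\mathbb C\ni z\mapsto b(z)\in B(H_+\oplus H_-)$ with at most linear growth on vertical strips, that is, for every bounded interval $I\subset\mathbb R$ there is $\lambda>0$ such that $\|b(z)\|\le\lambda|z|$ whenever $\Re z\in I$, such that for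 every $z\in\mathbb C$ $$|D|^{-2z}\,db=db\,\chi^{2z}|D|^{-2z}+b(z)|D|^{-2z-1}=\chi^{-2z}\,db\,|D|^{-2z}+b(z)|D|^{-2z-1}$$ on the domain of $|D|^{-2z}$. This includes the assertions that $db$ maps the domain of $|D|^{-2z}$ into itself and that this domain is contained in the domain of $|D|^{-2z-1}$. -/

import Mathlib

noncomputable section

open scoped TensorProduct ComplexOrder

namespace QSphere

/-- The deformation parameter ranges over the open interval `(0, 1)`. -/
abbrev Param : Type := Set.Ioo (0 : ℝ) 1

/-- The parameter `q` as a complex number. -/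
def Param.c (q : Param) : ℂ := ((q : ℝ) : ℂ)

/-- The positive square root of `q`, as a complex number. -/
def Param.sq (q : Param) : ℂ := ((Real.sqrt (q : ℝ) : ℝ) : ℂ)

lemma Param.pos (q : Param) : 0 < (q : ℝ) := q.2.1
lemma Param.lt_one (q : Param) : (q : ℝ) < 1 := q.2.2
lemma Param.c_ne (q : Param) : q.c ≠ 0 := by
  simpa [Param.c] using q.pos.ne'
lemma Param.sq_ne (q : Param) : q.sq ≠ 0 := by
  simpa [Param.sq] using (Real.sqrt_pos.2 q.pos).ne'
lemma Param.sq_mul (q : Param) : q.sq * q.sq = q.c := by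
  simp only [Param.sq, Param.c, ← Complex.ofReal_mul, Real.mul_self_sqrt q.pos.le]

/-! ### The Hopf `*`-algebra of polynomial functions on quantum `SU(2)` -/

/-- Names of the generators `α`, `α*`, `γ`, `γ*`. -/
inductive Gen : Type
  | al | als | ga | gas

/-- The defining relations of quantum `SU(2)` for elements `a, a', c, c'` (which stand for
`α, α*, γ, γ*`) of a complex algebra, including the adjoints of the relations. -/
structure Rels (q : Param) {R : Type*} [Ring R] [Algebra ℂ R] (a a' c c' : R) : Prop where
  r1 : a' * a + c' * c = 1
  r2 : a * a' + q.c ^ 2 • (c' * c) = 1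
  r3 : c' * c = c * c'
  r4 : a * c = q.c • (c * a)
  r5 : a * c' = q.c • (c' * a)
  r6 : c' * a' = q.c • (a' * c')
  r7 : c * a' = q.c • (a' * c)

/-- The same relations, on the free algebra. -/
inductive FreeRel (q : Param) : FreeAlgebra ℂ Gen → FreeAlgebra ℂ Gen → Prop
  | r1 : FreeRel q (.ι ℂ .als * .ι ℂ .al + .ι ℂ .gas * .ι ℂ .ga) 1
  | r2 : FreeRel q (.ι ℂ .al * .ι ℂ .als + q.c ^ 2 • (.ι ℂ .gas * .ι ℂ .ga)) 1
  | r3 : FreeRel q (.ι ℂ .gas * .ι ℂ .ga) (.ι ℂ .ga * .ι ℂ .gas)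
  | r4 : FreeRel q (.ι ℂ .al * .ι ℂ .ga) (q.c • (.ι ℂ .ga * .ι ℂ .al))
  | r5 : FreeRel q (.ι ℂ .al * .ι ℂ .gas) (q.c • (.ι ℂ .gas * .ι ℂ .al))
  | r6 : FreeRel q (.ι ℂ .gas * .ι ℂ .als) (q.c • (.ι ℂ .als * .ι ℂ .gas))
  | r7 : FreeRel q (.ι ℂ .ga * .ι ℂ .als) (q.c • (.ι ℂ .als * .ι ℂ .ga))

/-- The unital complex algebra generated by `α, α*, γ, γ*` subject to the relations of quantum
`SU(2)`: the algebra of polynomial functions (finite-dimensional matrix coefficients). -/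
def Pol (q : Param) : Type := RingQuot (FreeRel q)

instance (q : Param) : Ring (Pol q) := inferInstanceAs (Ring (RingQuot (FreeRel q)))
instance (q : Param) : Algebra ℂ (Pol q) := inferInstanceAs (Algebra ℂ (RingQuot (FreeRel q)))

namespace Pol

variable {q : Param}

/-- The quotient map. -/
def mk (q : Param) : FreeAlgebra ℂ Gen →ₐ[ℂ] Pol q := RingQuot.mkAlgHom ℂ (FreeRel q)

/-- The generators. -/
def gen (q : Param) (g : Gen) : Pol q := mk q (.ι ℂ g)

lemma mk_rel {x y : FreeAlgebra ℂ Gen} (h : FreeRel q x y) : mk q x = mk q y :=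
  RingQuot.mkAlgHom_rel ℂ h

lemma rels (q : Param) : Rels q (gen q .al) (gen q .als) (gen q .ga) (gen q .gas) where
  r1 := by simpa [gen] using mk_rel (.r1 (q := q))
  r2 := by simpa [gen] using mk_rel (.r2 (q := q))
  r3 := by simpa [gen] using mk_rel (.r3 (q := q))
  r4 := by simpa [gen] using mk_rel (.r4 (q := q))
  r5 := by simpa [gen] using mk_rel (.r5 (q := q))
  r6 := by simpa [gen] using mk_rel (.r6 (q := q))
  r7 := by simpa [gen] using mk_rel (.r7 (q := q))

/-- Assignment of values to the generators. -/
def vals {R : Type*} (a a' c c' : R) : Gen → R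
  | .al => a
  | .als => a'
  | .ga => c
  | .gas => c'

/-- The universal property of `Pol q`. -/
def lift {R : Type*} [Ring R] [Algebra ℂ R] {a a' c c' : R} (h : Rels q a a' c c') :
    Pol q →ₐ[ℂ] R :=
  RingQuot.liftAlgHom ℂ ⟨FreeAlgebra.lift ℂ (vals a a' c c'), by
    intro x y hxy
    cases hxy
    · simpa [vals] using h.r1
    · simpa [vals] using h.r2
    · simpa [vals] using h.r3
    · simpa [vals] using h.r4
    · simpa [vals] using h.r5
    · simpa [vals] using h.r6
    · simpa [vals] using h.r7⟩

@[simp] lemma lift_gen {R : Type*} [Ring R] [Algebra ℂ R] {a a' c c' : R}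
    (h : Rels q a a' c c') (g : Gen) : lift h (gen q g) = vals a a' c c' g := by
  have := RingQuot.liftAlgHom_mkAlgHom_apply ℂ (s := FreeRel q)
    (FreeAlgebra.lift ℂ (vals a a' c c')) (by
    intro x y hxy
    cases hxy
    · simpa [vals] using h.r1
    · simpa [vals] using h.r2
    · simpa [vals] using h.r3
    · simpa [vals] using h.r4
    · simpa [vals] using h.r5
    · simpa [vals] using h.r6
    · simpa [vals] using h.r7) (FreeAlgebra.ι ℂ g)
  exact this.trans (FreeAlgebra.lift_ι_apply _ _)

lemma hom_ext {R : Type*} [Ring R] [Algebra ℂ R] {f g : Pol q →ₐ[ℂ] R}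
    (h : ∀ i, f (gen q i) = g (gen q i)) : f = g := by
  refine RingQuot.ringQuot_ext' ℂ f g (FreeAlgebra.hom_ext (funext fun i => ?_))
  exact h i

lemma induction {p : Pol q → Prop} (hc : ∀ r : ℂ, p (algebraMap ℂ _ r)) (hg : ∀ g, p (gen q g))
    (hm : ∀ a b, p a → p b → p (a * b)) (ha : ∀ a b, p a → p b → p (a + b)) (a : Pol q) : p a := by
  obtain ⟨x, rfl⟩ := RingQuot.mkAlgHom_surjective ℂ (FreeRel q) a
  change p (mk q x)
  induction x with
  | grade0 r => simpa using hc r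
  | grade1 x => exact hg x
  | mul a b h1 h2 => rw [map_mul]; exact hm _ _ h1 h2
  | add a b h1 h2 => rw [map_add]; exact ha _ _ h1 h2

/-! #### The involution -/

/-- The opposite algebra of `Pol q` with the conjugate complex structure: complex-linear algebra
homomorphisms into it are conjugate-linear anti-homomorphisms into `Pol q`. -/
def ConjOp (q : Param) : Type := (Pol q)ᵐᵒᵖ

instance : Ring (ConjOp q) := inferInstanceAs (Ring (Pol q)ᵐᵒᵖ)
instance : Algebra ℂ (ConjOp q) :=
  ((algebraMap ℂ (Pol q)ᵐᵒᵖ).comp (starRingEnd ℂ)).toAlgebra' fun c x =>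
    Algebra.commutes (A := (Pol q)ᵐᵒᵖ) (starRingEnd ℂ c) x

/-- The identity map onto `ConjOp q`. -/
def toC (x : Pol q) : ConjOp q := MulOpposite.op x
/-- The identity map from `ConjOp q`. -/
def ofC (x : ConjOp q) : Pol q := MulOpposite.unop x

lemma toC_mul (x y : Pol q) : toC x * toC y = toC (y * x) := rfl
lemma toC_add (x y : Pol q) : toC x + toC y = toC (x + y) := rfl
lemma toC_one : (1 : ConjOp q) = toC 1 := rfl
lemma ofC_mul (x y : ConjOp q) : ofC (x * y) = ofC y * ofC x := rfl
lemma ofC_add (x y : ConjOp q) : ofC (x + y) = ofC x + ofC y := rfl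
lemma ofC_toC (x : Pol q) : ofC (toC x) = x := rfl
lemma ofC_algebraMap (r : ℂ) :
    ofC (algebraMap ℂ (ConjOp q) r) = algebraMap ℂ (Pol q) (starRingEnd ℂ r) := rfl
lemma smul_toC (r : ℂ) (x : Pol q) : r • toC x = toC (starRingEnd ℂ r • x) := by
  rw [Algebra.smul_def, Algebra.smul_def, Algebra.commutes (A := Pol q)]
  rfl

lemma conj_c (q : Param) : starRingEnd ℂ q.c = q.c := Complex.conj_ofReal _

lemma starRels (q : Param) :
    Rels q (toC (gen q .als)) (toC (gen q .al)) (toC (gen q .gas)) (toC (gen q .ga)) where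
  r1 := by simpa [toC_mul, toC_add, toC_one] using congrArg toC (rels q).r1
  r2 := by
    simpa [toC_mul, toC_add, toC_one, smul_toC, conj_c] using congrArg toC (rels q).r2
  r3 := by simpa [toC_mul] using congrArg toC (rels q).r3
  r4 := by simpa [toC_mul, smul_toC, conj_c] using congrArg toC (rels q).r6
  r5 := by simpa [toC_mul, smul_toC, conj_c] using congrArg toC (rels q).r7
  r6 := by simpa [toC_mul, smul_toC, conj_c] using congrArg toC (rels q).r4
  r7 := by simpa [toC_mul, smul_toC, conj_c] using congrArg toC (rels q).r5

/-- The involution, as a map. -/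
def starFun (x : Pol q) : Pol q := ofC (lift (starRels q) x)

lemma starFun_add (x y : Pol q) : starFun (x + y) = starFun x + starFun y := by
  simp [starFun, ofC_add]
lemma starFun_mul (x y : Pol q) : starFun (x * y) = starFun y * starFun x := by
  simp [starFun, ofC_mul]
lemma starFun_algebraMap (r : ℂ) :
    starFun (algebraMap ℂ (Pol q) r) = algebraMap ℂ (Pol q) (starRingEnd ℂ r) := by
  simp [starFun, ofC_algebraMap]
lemma starFun_gen (g : Gen) : starFun (gen q g) =
    vals (gen q .als) (gen q .al) (gen q .gas) (gen q .ga) g := by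
  cases g <;> simp [starFun, vals, ofC_toC]

/-- The `*`-structure: the conjugate-linear anti-multiplicative involution exchanging `α` with
`α*` and `γ` with `γ*`. -/
instance : StarRing (Pol q) where
  star := starFun
  star_involutive x := by
    induction x using induction with
    | hc r => simp [starFun_algebraMap]
    | hg g => cases g <;> simp [starFun_gen, vals]
    | hm a b ha hb => simp [starFun_mul, ha, hb]
    | ha a b ha hb => simp [starFun_add, ha, hb]
  star_mul := starFun_mul
  star_add := starFun_add

lemma star_gen (g : Gen) : star (gen q g) =
    vals (gen q .als) (gen q .al) (gen q .gas) (gen q .ga) g := starFun_gen g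

instance : StarModule ℂ (Pol q) where
  star_smul r x := by
    have h : star (algebraMap ℂ (Pol q) r) = algebraMap ℂ (Pol q) (star r) :=
      starFun_algebraMap r
    rw [Algebra.smul_def, star_mul, h, Algebra.smul_def, Algebra.commutes]

end Pol

open Pol

variable (q : Param)

/-! ### Coproduct and the elements `k, e, f` of the quantized enveloping algebra -/

lemma comulRels :
    Rels q
      (gen q .al ⊗ₜ[ℂ] gen q .al - q.c • (gen q .gas ⊗ₜ[ℂ] gen q .ga))
      (gen q .als ⊗ₜ[ℂ] gen q .als - q.c • (gen q .ga ⊗ₜ[ℂ] gen q .gas))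
      (gen q .ga ⊗ₜ[ℂ] gen q .al + gen q .als ⊗ₜ[ℂ] gen q .ga)
      (gen q .gas ⊗ₜ[ℂ] gen q .als + gen q .al ⊗ₜ[ℂ] gen q .gas) := by
  obtain ⟨h1, h2, h3, h4, h5, h6, h7⟩ := rels q
  have h1' := eq_sub_of_add_eq h1
  have h2' := eq_sub_of_add_eq h2
  constructor <;>
  simp only [mul_add, add_mul, mul_sub, sub_mul, Algebra.TensorProduct.tmul_mul_tmul,
    smul_mul_assoc, mul_smul_comm, h1', h2', h3, h4, h5, h6, h7, TensorProduct.tmul_sub,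
    TensorProduct.sub_tmul, TensorProduct.tmul_smul, ← TensorProduct.smul_tmul',
    Algebra.TensorProduct.one_def, smul_sub, smul_add, smul_smul] <;>
  module

/-- The coproduct: `Δ(α) = α ⊗ α - q γ* ⊗ γ`, `Δ(γ) = γ ⊗ α + α* ⊗ γ` and the adjoints of
these formulas. -/
def comul : Pol q →ₐ[ℂ] Pol q ⊗[ℂ] Pol q := lift (comulRels q)

lemma kRels : Rels q (R := ℂ) q.sq q.sq⁻¹ 0 0 := by
  constructor <;> simp [q.sq_ne]

lemma kinvRels : Rels q (R := ℂ) q.sq⁻¹ q.sq 0 0 := by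
  constructor <;> simp [q.sq_ne]

/-- The group-like element `k` as a functional on `Pol q`. -/
def kFun : Pol q →ₐ[ℂ] ℂ := lift (kRels q)

/-- The inverse `k⁻¹` as a functional on `Pol q`. -/
def kinvFun : Pol q →ₐ[ℂ] ℂ := lift (kinvRels q)

lemma eRels : Rels q (R := Matrix (Fin 2) (Fin 2) ℂ)
    !![q.sq, 0; 0, q.sq⁻¹] !![q.sq⁻¹, 0; 0, q.sq] 0 !![0, -q.c⁻¹; 0, 0] := by
  have h := q.sq_ne
  constructor <;> ext i j <;> fin_cases i <;> fin_cases j <;>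
    simp [Matrix.mul_apply, h, ← q.sq_mul]
  all_goals field_simp

lemma fRels : Rels q (R := Matrix (Fin 2) (Fin 2) ℂ)
    !![q.sq, 0; 0, q.sq⁻¹] !![q.sq⁻¹, 0; 0, q.sq] !![0, 1; 0, 0] 0 := by
  have h := q.sq_ne
  constructor <;> ext i j <;> fin_cases i <;> fin_cases j <;>
    simp [Matrix.mul_apply, h, ← q.sq_mul]

/-- The functional `e` on `Pol q`. The rule `Δ̂(e) = e ⊗ k⁻¹ + k ⊗ e` says precisely that
`a ↦ !![k a, e a; 0, k⁻¹ a]` is multiplicative, and the fundamental representation prescribes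
`e` on the matrix coefficients `!![α, -q γ*; γ, α*]` to be `!![0, 1; 0, 0]`. -/
def eFun : Pol q →ₗ[ℂ] ℂ where
  toFun a := lift (eRels q) a 0 1
  map_add' := by simp
  map_smul' := by simp

/-- The functional `f` on `Pol q`, given by `Δ̂(f) = f ⊗ k⁻¹ + k ⊗ f` and by its values
`!![0, 0; 1, 0]` on the matrix coefficients `!![α, -q γ*; γ, α*]`. -/
def fFun : Pol q →ₗ[ℂ] ℂ where
  toFun a := lift (fRels q) a 0 1
  map_add' := by simp
  map_smul' := by simp

lemma eMat (a : Pol q) : lift (eRels q) a = !![kFun q a, eFun q a; 0, kinvFun q a] := by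
  suffices h : lift (eRels q) a 0 0 = kFun q a ∧ lift (eRels q) a 1 0 = 0 ∧
      lift (eRels q) a 1 1 = kinvFun q a by
    ext i j
    fin_cases i <;> fin_cases j <;> simp [h, eFun]
  induction a using Pol.induction with
  | hc r => simp [Matrix.algebraMap_matrix_apply]
  | hg g => cases g <;> simp [kFun, kinvFun, vals]
  | hm a b ha hb => simp [Matrix.mul_apply, ha, hb]
  | ha a b ha hb => simp [ha, hb]

lemma fMat (a : Pol q) : lift (fRels q) a = !![kFun q a, fFun q a; 0, kinvFun q a] := by
  suffices h : lift (fRels q) a 0 0 = kFun q a ∧ lift (fRels q) a 1 0 = 0 ∧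
      lift (fRels q) a 1 1 = kinvFun q a by
    ext i j
    fin_cases i <;> fin_cases j <;> simp [h, fFun]
  induction a using Pol.induction with
  | hc r => simp [Matrix.algebraMap_matrix_apply]
  | hg g => cases g <;> simp [kFun, kinvFun, vals]
  | hm a b ha hb => simp [Matrix.mul_apply, ha, hb]
  | ha a b ha hb => simp [ha, hb]

lemma eFun_mul (a b : Pol q) :
    eFun q (a * b) = eFun q a * kinvFun q b + kFun q a * eFun q b := by
  have h : lift (eRels q) (a * b) 0 1 = (lift (eRels q) a * lift (eRels q) b) 0 1 := by
    rw [map_mul]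
  rw [eMat, eMat, eMat] at h
  simp [Matrix.mul_apply] at h
  rw [h]; ring

lemma fFun_mul (a b : Pol q) :
    fFun q (a * b) = fFun q a * kinvFun q b + kFun q a * fFun q b := by
  have h : lift (fRels q) (a * b) 0 1 = (lift (fRels q) a * lift (fRels q) b) 0 1 := by
    rw [map_mul]
  rw [fMat, fMat, fMat] at h
  simp [Matrix.mul_apply] at h
  rw [h]; ring

/-- The operator `∂_ω(a) = (ι ⊗ ω)Δ(a)` for a functional `ω` on `Pol q`. -/
def partialOp (ω : Pol q →ₗ[ℂ] ℂ) : Pol q →ₗ[ℂ] Pol q :=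
  (TensorProduct.rid ℂ (Pol q)).toLinearMap ∘ₗ ω.lTensor (Pol q) ∘ₗ (comul q).toLinearMap

/-- The operator `a ◁ ω = (ω ⊗ ι)Δ(a)` for a functional `ω` on `Pol q`. -/
def rightOp (ω : Pol q →ₗ[ℂ] ℂ) : Pol q →ₗ[ℂ] Pol q :=
  (TensorProduct.lid ℂ (Pol q)).toLinearMap ∘ₗ ω.rTensor (Pol q) ∘ₗ (comul q).toLinearMap

/-- The operator `∂_k`. -/
def dk : Pol q →ₗ[ℂ] Pol q := partialOp q (kFun q).toLinearMap
/-- The operator `∂_{k⁻¹}`. -/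
def dkinv : Pol q →ₗ[ℂ] Pol q := partialOp q (kinvFun q).toLinearMap
/-- The operator `∂_e`. -/
def de : Pol q →ₗ[ℂ] Pol q := partialOp q (eFun q)
/-- The operator `∂_f`. -/
def df : Pol q →ₗ[ℂ] Pol q := partialOp q (fFun q)

/-- The slice map `ι ⊗ ω`. -/
abbrev slice (ω : Pol q →ₗ[ℂ] ℂ) : Pol q ⊗[ℂ] Pol q →ₗ[ℂ] Pol q :=
  (TensorProduct.rid ℂ (Pol q)).toLinearMap ∘ₗ ω.lTensor (Pol q)

lemma slice_alg_mul (ω : Pol q →ₐ[ℂ] ℂ) (x y : Pol q ⊗[ℂ] Pol q) :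
    slice q ω.toLinearMap (x * y) = slice q ω.toLinearMap x * slice q ω.toLinearMap y := by
  induction x with
  | zero => simp
  | add x x' h h' => simp only [add_mul, map_add, h, h']
  | tmul a b =>
    induction y with
    | zero => simp
    | add y y' h h' => simp only [mul_add, map_add, h, h']
    | tmul c d => simp [smul_smul, mul_comm]

lemma slice_skew_mul {ω : Pol q →ₗ[ℂ] ℂ}
    (h : ∀ a b, ω (a * b) = ω a * kinvFun q b + kFun q a * ω b) (x y : Pol q ⊗[ℂ] Pol q) :
    slice q ω (x * y) = slice q ω x * slice q (kinvFun q).toLinearMap y +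
      slice q (kFun q).toLinearMap x * slice q ω y := by
  induction x with
  | zero => simp
  | add x x' h h' => simp only [add_mul, map_add, h, h']; abel
  | tmul a b =>
    induction y with
    | zero => simp
    | add y y' h h' => simp only [mul_add, map_add, h, h']; abel
    | tmul c d => simp [smul_smul, h, add_smul, mul_comm]

lemma dk_mul (a b : Pol q) : dk q (a * b) = dk q a * dk q b := by
  have := slice_alg_mul q (kFun q) (comul q a) (comul q b)
  rwa [← map_mul] at this

lemma dkinv_mul (a b : Pol q) : dkinv q (a * b) = dkinv q a * dkinv q b := by
  have := slice_alg_mul q (kinvFun q) (comul q a) (comul q b)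
  rwa [← map_mul] at this

lemma de_mul (a b : Pol q) : de q (a * b) = de q a * dkinv q b + dk q a * de q b := by
  have := slice_skew_mul q (eFun_mul q) (comul q a) (comul q b)
  rwa [← map_mul] at this

lemma df_mul (a b : Pol q) : df q (a * b) = df q a * dkinv q b + dk q a * df q b := by
  have := slice_skew_mul q (fFun_mul q) (comul q a) (comul q b)
  rwa [← map_mul] at this

lemma dk_gen (g : Gen) : dk q (gen q g) =
    vals (q.sq • gen q .al) (q.sq⁻¹ • gen q .als) (q.sq • gen q .ga) (q.sq⁻¹ • gen q .gas) g := by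
  cases g <;> simp [dk, partialOp, comul, vals, kFun]

lemma dkinv_gen (g : Gen) : dkinv q (gen q g) =
    vals (q.sq⁻¹ • gen q .al) (q.sq • gen q .als) (q.sq⁻¹ • gen q .ga) (q.sq • gen q .gas) g := by
  cases g <;> simp [dkinv, partialOp, comul, vals, kinvFun]

lemma de_gen (g : Gen) : de q (gen q g) =
    vals 0 (gen q .ga) 0 (-q.c⁻¹ • gen q .al) g := by
  have h := q.c_ne
  cases g <;> simp [de, partialOp, comul, vals, eFun, smul_smul, h]

lemma df_gen (g : Gen) : df q (gen q g) =
    vals (-q.c • gen q .gas) 0 (gen q .als) 0 g := by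
  cases g <;> simp [df, partialOp, comul, vals, fFun]

lemma dk_one : dk q 1 = 1 := by simp [dk, partialOp, Algebra.TensorProduct.one_def]
lemma dkinv_one : dkinv q 1 = 1 := by simp [dkinv, partialOp, Algebra.TensorProduct.one_def]
lemma de_one : de q 1 = 0 := by
  simp [de, partialOp, Algebra.TensorProduct.one_def, eFun]
lemma df_one : df q 1 = 0 := by
  simp [df, partialOp, Algebra.TensorProduct.one_def, fFun]

lemma dk_dkinv (a : Pol q) : dk q (dkinv q a) = a := by
  have h := q.sq_ne
  induction a using Pol.induction with
  | hc r => simp [Algebra.algebraMap_eq_smul_one, dk_one, dkinv_one]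
  | hg g => cases g <;> simp [dk_gen, dkinv_gen, vals, smul_smul, h]
  | hm a b ha hb => simp [dk_mul, dkinv_mul, ha, hb]
  | ha a b ha hb => simp [ha, hb]

lemma dkinv_dk (a : Pol q) : dkinv q (dk q a) = a := by
  have h := q.sq_ne
  induction a using Pol.induction with
  | hc r => simp [Algebra.algebraMap_eq_smul_one, dk_one, dkinv_one]
  | hg g => cases g <;> simp [dk_gen, dkinv_gen, vals, smul_smul, h]
  | hm a b ha hb => simp [dk_mul, dkinv_mul, ha, hb]
  | ha a b ha hb => simp [ha, hb]

lemma dk_de (a : Pol q) : dk q (de q a) = q.c • de q (dk q a) := by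
  have h := q.sq_ne
  induction a using Pol.induction with
  | hc r => simp [Algebra.algebraMap_eq_smul_one, dk_one, de_one]
  | hg g =>
    cases g <;> simp [dk_gen, de_gen, vals, smul_smul, ← q.sq_mul] <;> congr 1
    all_goals field_simp
  | hm a b ha hb =>
    simp [dk_mul, de_mul, ha, hb, dk_dkinv, dkinv_dk, smul_add]
  | ha a b ha hb => simp [ha, hb]

lemma dk_df (a : Pol q) : dk q (df q a) = q.c⁻¹ • df q (dk q a) := by
  have h := q.sq_ne
  induction a using Pol.induction with
  | hc r => simp [Algebra.algebraMap_eq_smul_one, dk_one, df_one]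
  | hg g =>
    cases g <;> simp [dk_gen, df_gen, vals, smul_smul, ← q.sq_mul] <;> congr 1
    all_goals field_simp
  | hm a b ha hb =>
    simp [dk_mul, df_mul, ha, hb, dk_dkinv, dkinv_dk, smul_add]
  | ha a b ha hb => simp [ha, hb]

/-- The spectral subspace `{a | ∂_k(a) = q^{n/2} a}`. For `n = 0` this is the algebra of
polynomial functions on the quantum sphere. -/
def homog (n : ℤ) : Submodule ℂ (Pol q) where
  carrier := {a | dk q a = q.sq ^ n • a}
  add_mem' {a b} ha hb := by simp_all
  zero_mem' := by simp
  smul_mem' c a ha := by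
    simp only [Set.mem_ofPred_eq] at ha ⊢
    rw [map_smul, ha, smul_comm]

variable {q}

lemma mem_homog {n : ℤ} {a : Pol q} : a ∈ homog q n ↔ dk q a = q.sq ^ n • a := Iff.rfl

lemma mul_mem_homog {m n : ℤ} {a b : Pol q} (ha : a ∈ homog q m) (hb : b ∈ homog q n) :
    a * b ∈ homog q (m + n) := by
  rw [mem_homog] at *
  rw [dk_mul, ha, hb, zpow_add₀ q.sq_ne, smul_mul_smul_comm]

lemma de_mem {n : ℤ} {a : Pol q} (ha : a ∈ homog q n) : de q a ∈ homog q (n + 2) := by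
  rw [mem_homog] at *
  rw [dk_de, ha, map_smul, smul_smul, zpow_add₀ q.sq_ne, ← q.sq_mul, zpow_two, mul_comm]

lemma df_mem {n : ℤ} {a : Pol q} (ha : a ∈ homog q n) : df q a ∈ homog q (n - 2) := by
  rw [mem_homog] at *
  rw [dk_df, ha, map_smul, smul_smul, zpow_sub₀ q.sq_ne, ← q.sq_mul, zpow_two, div_eq_inv_mul]


/-! ### The Haar state -/

/-- The Haar state: the normalized positive functional that is invariant on both sides,
`(ι ⊗ h)Δ(a) = h(a)1 = (h ⊗ ι)Δ(a)`. -/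
structure IsHaarState (q : Param) (h : Pol q →ₗ[ℂ] ℂ) : Prop where
  map_one : h 1 = 1
  nonneg : ∀ a, 0 ≤ h (star a * a)
  left_inv : ∀ a, partialOp q h a = h a • 1
  right_inv : ∀ a, rightOp q h a = h a • 1

namespace HaarExists

/-! #### Monomials -/

/-- Monomials `αⁱ γʲ γ*ᵏ`. -/
def mon (q : Param) (i j k : ℕ) : Pol q := gen q .al ^ i * (gen q .ga ^ j * gen q .gas ^ k)
/-- Monomials `α*ⁱ γʲ γ*ᵏ`. -/
def mon' (q : Param) (i j k : ℕ) : Pol q := gen q .als ^ i * (gen q .ga ^ j * gen q .gas ^ k)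

/-- Scalar commutation passes to powers. -/
lemma comm_pow {R : Type*} [Ring R] [Algebra ℂ R] {x y : R} {r : ℂ} (h : x * y = r • (y * x))
    (n : ℕ) : x * y ^ n = r ^ n • (y ^ n * x) := by
  induction n with
  | zero => simp
  | succ n ih =>
    rw [pow_succ, ← mul_assoc, ih, smul_mul_assoc, mul_assoc, h, mul_smul_comm, smul_smul,
      mul_assoc, pow_succ]

lemma pow_comm' {R : Type*} [Ring R] [Algebra ℂ R] {x y : R} {r : ℂ} (h : x * y = r • (y * x))
    (n : ℕ) : x ^ n * y = r ^ n • (y * x ^ n) := by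
  induction n with
  | zero => simp
  | succ n ih =>
    rw [pow_succ, mul_assoc, h, mul_smul_comm, ← mul_assoc, ih, smul_mul_assoc, smul_smul,
      mul_assoc, ← pow_succ']

lemma ga_al : gen q .ga * gen q .al = q.c⁻¹ • (gen q .al * gen q .ga) := by
  rw [(rels q).r4, inv_smul_smul₀ q.c_ne]
lemma gas_al : gen q .gas * gen q .al = q.c⁻¹ • (gen q .al * gen q .gas) := by
  rw [(rels q).r5, inv_smul_smul₀ q.c_ne]
lemma als_al : gen q .als * gen q .al = 1 - gen q .ga * gen q .gas := by
  rw [← (rels q).r3]; exact eq_sub_of_add_eq (rels q).r1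
lemma al_als : gen q .al * gen q .als = 1 - q.c ^ 2 • (gen q .ga * gen q .gas) := by
  rw [← (rels q).r3]; exact eq_sub_of_add_eq (rels q).r2
lemma gas_ga_pow (j : ℕ) : gen q .gas * gen q .ga ^ j = gen q .ga ^ j * gen q .gas :=
  (Commute.pow_right (rels q).r3 j)
lemma gas_pow_ga_pow (j k : ℕ) :
    gen q .gas ^ k * gen q .ga ^ j = gen q .ga ^ j * gen q .gas ^ k :=
  (Commute.pow_pow (rels q).r3 k j)

lemma ga_mon (i j k : ℕ) : gen q .ga * mon q i j k = q.c⁻¹ ^ i • mon q i (j + 1) k := by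
  rw [mon, ← mul_assoc, comm_pow ga_al, smul_mul_assoc, mon, pow_succ']
  simp only [mul_assoc]
lemma ga_mon' (i j k : ℕ) : gen q .ga * mon' q i j k = q.c ^ i • mon' q i (j + 1) k := by
  rw [mon', ← mul_assoc, comm_pow (rels q).r7, smul_mul_assoc, mon', pow_succ']
  simp only [mul_assoc]
lemma gas_mon (i j k : ℕ) : gen q .gas * mon q i j k = q.c⁻¹ ^ i • mon q i j (k + 1) := by
  rw [mon, ← mul_assoc, comm_pow gas_al, smul_mul_assoc, mon, pow_succ', mul_assoc,
    ← mul_assoc (gen q .gas), gas_ga_pow, mul_assoc]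
lemma gas_mon' (i j k : ℕ) : gen q .gas * mon' q i j k = q.c ^ i • mon' q i j (k + 1) := by
  rw [mon', ← mul_assoc, comm_pow (rels q).r6, smul_mul_assoc, mon', pow_succ', mul_assoc,
    ← mul_assoc (gen q .gas), gas_ga_pow, mul_assoc]
lemma al_mon (i j k : ℕ) : gen q .al * mon q i j k = mon q (i + 1) j k := by
  rw [mon, ← mul_assoc, ← pow_succ', mon]
lemma als_mon' (i j k : ℕ) : gen q .als * mon' q i j k = mon' q (i + 1) j k := by
  rw [mon', ← mul_assoc, ← pow_succ', mon']
lemma al_mon'_succ (i j k : ℕ) : gen q .al * mon' q (i + 1) j k =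
    mon' q i j k - (q.c ^ 2 * q.c ^ i * q.c ^ i) • mon' q i (j + 1) (k + 1) := by
  rw [← als_mon', ← mul_assoc, al_als, sub_mul, one_mul, smul_mul_assoc, mul_assoc, gas_mon',
    mul_smul_comm, ga_mon', smul_smul, smul_smul, mul_assoc]
lemma als_mon_succ (i j k : ℕ) : gen q .als * mon q (i + 1) j k =
    mon q i j k - (q.c⁻¹ ^ i * q.c⁻¹ ^ i) • mon q i (j + 1) (k + 1) := by
  rw [← al_mon, ← mul_assoc, als_al, sub_mul, one_mul, mul_assoc, gas_mon,
    mul_smul_comm, ga_mon, smul_smul]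
lemma mon_zero (j k : ℕ) : mon q 0 j k = mon' q 0 j k := by simp [mon, mon']

/-- The monomials span. -/
lemma mem_of_mon (S : Submodule ℂ (Pol q)) (h : ∀ i j k, mon q i j k ∈ S)
    (h' : ∀ i j k, mon' q i j k ∈ S) (a : Pol q) : a ∈ S := by
  let M : Submodule ℂ (Pol q) := Submodule.span ℂ
    ({x | ∃ i j k, x = mon q i j k} ∪ {x | ∃ i j k, x = mon' q i j k})
  have hM : ∀ i j k, mon q i j k ∈ M := fun i j k => Submodule.subset_span (.inl ⟨i, j, k, rfl⟩)
  have hM' : ∀ i j k, mon' q i j k ∈ M := fun i j k => Submodule.subset_span (.inr ⟨i, j, k, rfl⟩)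
  have hle : M ≤ S := Submodule.span_le.2 (by
    rintro x (⟨i, j, k, rfl⟩ | ⟨i, j, k, rfl⟩)
    · exact h i j k
    · exact h' i j k)
  have key : ∀ a : Pol q, ∀ x ∈ M, a * x ∈ M := by
    intro a
    induction a using Pol.induction with
    | hc r =>
      intro x hx
      rw [← Algebra.smul_def]
      exact M.smul_mem r hx
    | hm a b ha hb =>
      intro x hx
      rw [mul_assoc]
      exact ha _ (hb _ hx)
    | ha a b ha hb =>
      intro x hx
      rw [add_mul]
      exact M.add_mem (ha _ hx) (hb _ hx)
    | hg g =>
      intro x hx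
      induction hx using Submodule.span_induction with
      | zero => simp
      | add x y _ _ h1 h2 => rw [mul_add]; exact M.add_mem h1 h2
      | smul r x _ h1 => rw [mul_smul_comm]; exact M.smul_mem r h1
      | mem x hx =>
        rcases hx with ⟨i, j, k, rfl⟩ | ⟨i, j, k, rfl⟩
        · cases g
          · rw [al_mon]; exact hM _ _ _
          · cases i with
            | zero => rw [mon_zero, als_mon']; exact hM' _ _ _
            | succ i =>
              rw [als_mon_succ]; exact M.sub_mem (hM _ _ _) (M.smul_mem _ (hM _ _ _))
          · rw [ga_mon]; exact M.smul_mem _ (hM _ _ _)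
          · rw [gas_mon]; exact M.smul_mem _ (hM _ _ _)
        · cases g
          · cases i with
            | zero => rw [← mon_zero, al_mon]; exact hM _ _ _
            | succ i =>
              rw [al_mon'_succ]; exact M.sub_mem (hM' _ _ _) (M.smul_mem _ (hM' _ _ _))
          · rw [als_mon']; exact hM' _ _ _
          · rw [ga_mon']; exact M.smul_mem _ (hM' _ _ _)
          · rw [gas_mon']; exact M.smul_mem _ (hM' _ _ _)
  have h1 : (1 : Pol q) ∈ M := by simpa [mon] using hM 0 0 0
  simpa using hle (key a 1 h1)

/-! #### The representation on `ℓ²(ℕ × ℤ)`, restricted to finitely supported vectors -/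

/-- Finitely supported vectors. -/
abbrev V : Type := ℕ × ℤ →₀ ℂ

/-- Weighted shift. -/
def wshift (c : ℕ × ℤ → ℝ) (φ : ℕ × ℤ → ℕ × ℤ) : V →ₗ[ℂ] V :=
  Finsupp.linearCombination ℂ fun p => (c p : ℂ) • Finsupp.single (φ p) (1 : ℂ)

lemma wshift_single (c : ℕ × ℤ → ℝ) (φ : ℕ × ℤ → ℕ × ℤ) (p : ℕ × ℤ) (x : ℂ) :
    wshift c φ (Finsupp.single p x) = Finsupp.single (φ p) (x * c p) := by
  simp [wshift]

variable (q) in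
/-- The weights. -/
def wt (n : ℕ) : ℝ := Real.sqrt (1 - (q : ℝ) ^ (2 * n))

lemma wt_zero : wt q 0 = 0 := by simp [wt]
lemma wt_mul (n : ℕ) : (wt q n : ℂ) * wt q n = 1 - q.c ^ (2 * n) := by
  rw [← Complex.ofReal_mul, wt, Real.mul_self_sqrt]
  · simp [Param.c]
  · simpa using pow_le_one₀ q.pos.le q.lt_one.le

variable (q) in
/-- The images of the generators. -/
def piGen : Gen → V →ₗ[ℂ] V
  | .al => wshift (fun p => wt q p.1) fun p => (p.1 - 1, p.2)
  | .als => wshift (fun p => wt q (p.1 + 1)) fun p => (p.1 + 1, p.2)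
  | .ga => wshift (fun p => (q : ℝ) ^ p.1) fun p => (p.1, p.2 + 1)
  | .gas => wshift (fun p => (q : ℝ) ^ p.1) fun p => (p.1, p.2 - 1)

variable (q) in
lemma piRels : Rels q (R := Module.End ℂ V) (piGen q .al) (piGen q .als) (piGen q .ga)
    (piGen q .gas) := by
  have hc : ((q : ℝ) : ℂ) = q.c := rfl
  constructor <;> refine Finsupp.lhom_ext' fun p => LinearMap.ext_ring ?_ <;>
    obtain ⟨n, m⟩ := p <;>
    simp only [piGen, LinearMap.comp_apply, Finsupp.lsingle_apply, LinearMap.add_apply,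
      Module.End.mul_apply, LinearMap.smul_apply, wshift_single, Module.End.one_apply,
      Finsupp.smul_single, one_mul, add_sub_cancel_right, sub_add_cancel, Complex.ofReal_pow, hc,
      Nat.add_sub_cancel, smul_eq_mul]
  · cases n with
    | zero => simp [wt_zero]
    | succ n =>
      simp only [Nat.add_sub_cancel]
      rw [wt_mul, ← Finsupp.single_add]; congr 1; ring
  · rw [wt_mul, ← Finsupp.single_add]; congr 1; ring
  · cases n with
    | zero => simp [wt_zero]
    | succ n => congr 1; simp only [Nat.add_sub_cancel]; ring
  · cases n with
    | zero => simp [wt_zero]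
    | succ n => congr 1; simp only [Nat.add_sub_cancel]; ring
  · congr 1; ring
  · congr 1; ring

variable (q) in
/-- The representation. -/
def rep : Pol q →ₐ[ℂ] Module.End ℂ V := lift (piRels q)

lemma rep_gen (g : Gen) : rep q (gen q g) = piGen q g := by
  cases g <;> simp [rep, vals]

/-- The standard inner product. -/
def ip (u v : V) : ℂ := Finsupp.linearCombination ℂ (fun r => starRingEnd ℂ (u r)) v

lemma ip_add_right (u v w : V) : ip u (v + w) = ip u v + ip u w := map_add _ _ _
lemma ip_smul_right (u v : V) (c : ℂ) : ip u (c • v) = c * ip u v := map_smul _ _ _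
lemma ip_add_left (u v w : V) : ip (u + v) w = ip u w + ip v w := by
  simp [ip, Finsupp.linearCombination_apply, mul_add, Finsupp.sum_add]
lemma ip_smul_left (u v : V) (c : ℂ) : ip (c • u) v = starRingEnd ℂ c * ip u v := by
  simp only [ip, Finsupp.linearCombination_apply, Finsupp.smul_apply, smul_eq_mul, map_mul,
    Finsupp.mul_sum]
  exact Finsupp.sum_congr fun _ _ => by ring
lemma ip_zero_left (v : V) : ip 0 v = 0 := by simpa using ip_smul_left 0 v 0
lemma ip_single (p p' : ℕ × ℤ) (x y : ℂ) :
    ip (Finsupp.single p x) (Finsupp.single p' y) = if p = p' then starRingEnd ℂ x * y else 0 := by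
  classical
  rw [ip, Finsupp.linearCombination_single, Finsupp.single_apply]
  split_ifs <;> simp [mul_comm]
lemma ip_single_left (p : ℕ × ℤ) (v : V) : ip (Finsupp.single p 1) v = v p := by
  induction v using Finsupp.induction_linear with
  | zero => simp [ip]
  | add f g hf hg => simp [ip_add_right, hf, hg]
  | single p' x => classical rw [ip_single, Finsupp.single_apply]; simp [eq_comm]
lemma ip_self_nonneg (u : V) : 0 ≤ ip u u := by
  rw [ip, Finsupp.linearCombination_apply]
  refine Finset.sum_nonneg fun r _ => ?_
  simp only [smul_eq_mul, Complex.mul_conj]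
  exact_mod_cast Complex.normSq_nonneg _

lemma ip_wshift {c c' : ℕ × ℤ → ℝ} {φ φ' : ℕ × ℤ → ℕ × ℤ}
    (h : ∀ p p', (if φ p = p' then c p else 0) = if p = φ' p' then c' p' else 0) (u v : V) :
    ip (wshift c φ u) v = ip u (wshift c' φ' v) := by
  induction u using Finsupp.induction_linear with
  | zero => rw [map_zero, ip_zero_left, ip_zero_left]
  | add f g hf hg => simp [ip_add_left, hf, hg]
  | single p x =>
    induction v using Finsupp.induction_linear with
    | zero => simp [ip]
    | add f g hf hg => simp [ip_add_right, hf, hg]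
    | single p' y =>
      rw [wshift_single, wshift_single, ip_single, ip_single]
      have := congrArg (fun r : ℝ => starRingEnd ℂ x * y * (r : ℂ)) (h p p')
      simp only [apply_ite (fun r : ℝ => (r : ℂ)), Complex.ofReal_zero, mul_ite, mul_zero] at this
      simp only [map_mul, Complex.conj_ofReal]
      convert this using 2 <;> ring

lemma ip_rep (a : Pol q) : ∀ u v, ip (rep q a u) v = ip u (rep q (star a) v) := by
  induction a using Pol.induction with
  | hc r =>
    intro u v
    rw [Algebra.algebraMap_eq_smul_one, star_smul, star_one]
    simp [ip_smul_left, ip_smul_right]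
  | hm a b ha hb => intro u v; simp [ha, hb]
  | ha a b ha hb => intro u v; simp [ip_add_left, ip_add_right, ha, hb]
  | hg g =>
    cases g <;> simp only [star_gen, vals, rep_gen, piGen] <;> refine ip_wshift ?_ <;>
      rintro ⟨n, m⟩ ⟨n', m'⟩ <;> simp only [Prod.mk.injEq]
    · rcases n with _ | n
      · simp [wt_zero]
      · simp only [Nat.add_sub_cancel, add_left_inj]
        split_ifs with h <;> simp_all
    · rcases n' with _ | n'
      · simp [wt_zero]
      · simp only [Nat.add_sub_cancel, add_left_inj]
        split_ifs with h <;> simp_all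
    · have : (n = n' ∧ m + 1 = m') ↔ (n = n' ∧ m = m' - 1) := by omega
      simp only [this]
      split_ifs with h <;> simp_all
    · have : (n = n' ∧ m - 1 = m') ↔ (n = n' ∧ m = m' + 1) := by omega
      simp only [this]
      split_ifs with h <;> simp_all

/-- Diagonal matrix coefficients. -/
def diag (n : ℕ) : Pol q →ₗ[ℂ] ℂ where
  toFun a := rep q a (Finsupp.single (n, 0) 1) (n, 0)
  map_add' := by simp
  map_smul' := by simp

lemma diag_nonneg (n : ℕ) (a : Pol q) : 0 ≤ diag n (star a * a) := by
  have : diag n (star a * a) =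
      ip (rep q a (Finsupp.single (n, 0) 1)) (rep q a (Finsupp.single (n, 0) 1)) := by
    rw [ip_rep, ip_single_left]; simp [diag]
  rw [this]; exact ip_self_nonneg _

lemma rep_gas_pow (k n : ℕ) (m : ℤ) (x : ℂ) : rep q (gen q .gas ^ k) (Finsupp.single (n, m) x) =
    Finsupp.single (n, m - k) (x * q.c ^ (n * k)) := by
  induction k with
  | zero => simp
  | succ k ih =>
    rw [pow_succ', map_mul, Module.End.mul_apply, ih, rep_gen, piGen, wshift_single]
    congr 1
    · ext <;> simp; ring
    · simp [Param.c]; ring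
lemma rep_ga_pow (k n : ℕ) (m : ℤ) (x : ℂ) : rep q (gen q .ga ^ k) (Finsupp.single (n, m) x) =
    Finsupp.single (n, m + k) (x * q.c ^ (n * k)) := by
  induction k with
  | zero => simp
  | succ k ih =>
    rw [pow_succ', map_mul, Module.End.mul_apply, ih, rep_gen, piGen, wshift_single]
    congr 1
    · ext <;> simp; ring
    · simp [Param.c]; ring
lemma rep_al_pow (k n : ℕ) (m : ℤ) (x : ℂ) : ∃ y, rep q (gen q .al ^ k) (Finsupp.single (n, m) x) =
    Finsupp.single (n - k, m) y ∧ (n < k → y = 0) := by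
  induction k with
  | zero => exact ⟨x, by simp⟩
  | succ k ih =>
    obtain ⟨y, h, hy⟩ := ih
    refine ⟨y * wt q (n - k), ?_, fun hn => ?_⟩
    · rw [pow_succ', map_mul, Module.End.mul_apply, h, rep_gen, piGen, wshift_single]
      rfl
    · rw [Nat.sub_eq_zero_of_le (by omega), wt_zero]; simp
lemma rep_als_pow (k n : ℕ) (m : ℤ) (x : ℂ) :
    ∃ y, rep q (gen q .als ^ k) (Finsupp.single (n, m) x) = Finsupp.single (n + k, m) y := by
  induction k with
  | zero => exact ⟨x, by simp⟩
  | succ k ih =>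
    obtain ⟨y, h⟩ := ih
    refine ⟨y * wt q (n + k + 1), ?_⟩
    rw [pow_succ', map_mul, Module.End.mul_apply, h, rep_gen, piGen, wshift_single]
    rfl

lemma diag_mon (n i j k : ℕ) : diag n (mon q i j k) =
    if i = 0 ∧ j = k then q.c ^ (2 * n * j) else 0 := by
  simp only [diag, mon, LinearMap.coe_mk, AddHom.coe_mk, map_mul, Module.End.mul_apply]
  rw [rep_gas_pow, rep_ga_pow]
  rcases i with _ | i
  · rw [pow_zero, map_one, Module.End.one_apply, Finsupp.single_apply]
    by_cases h : j = k
    · subst h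
      simp only [zero_sub, neg_add_cancel, true_and, if_true]
      ring
    · rw [if_neg, if_neg]
      · simp [h]
      · simp only [Prod.mk.injEq, true_and]; omega
  · obtain ⟨y, h, hy⟩ := rep_al_pow (q := q) (i + 1) n (0 - (k : ℤ) + j)
      (1 * q.c ^ (n * k) * q.c ^ (n * j))
    rw [h, Finsupp.single_apply, if_neg (show ¬(i + 1 = 0 ∧ j = k) by simp)]
    split_ifs with h1
    · simp only [Prod.mk.injEq] at h1
      exact hy (by omega)
    · rfl

lemma diag_mon' (n i j k : ℕ) : diag n (mon' q i j k) =
    if i = 0 ∧ j = k then q.c ^ (2 * n * j) else 0 := by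
  rcases i with _ | i
  · rw [← mon_zero, diag_mon]
  · simp only [diag, mon', LinearMap.coe_mk, AddHom.coe_mk, map_mul, Module.End.mul_apply]
    rw [rep_gas_pow, rep_ga_pow]
    obtain ⟨y, h⟩ := rep_als_pow (q := q) (i + 1) n (0 - (k : ℤ) + j)
      (1 * q.c ^ (n * k) * q.c ^ (n * j))
    rw [h, Finsupp.single_apply, if_neg, if_neg]
    · simp
    · simp

lemma hasSum_geom (j : ℕ) : HasSum (fun n : ℕ => q.c ^ (2 * n) * q.c ^ (2 * n * j))
    (1 - q.c ^ (2 * j + 2))⁻¹ := by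
  have h : ‖q.c ^ (2 * j + 2)‖ < 1 := by
    rw [norm_pow]
    refine pow_lt_one₀ (norm_nonneg _) ?_ (by omega)
    simpa [Param.c, abs_of_pos q.pos] using q.lt_one
  have e : (fun n : ℕ => q.c ^ (2 * n) * q.c ^ (2 * n * j)) = fun n => (q.c ^ (2 * j + 2)) ^ n := by
    funext n; ring
  rw [e]
  exact hasSum_geometric_of_norm_lt_one h

lemma summ (a : Pol q) : Summable fun n : ℕ => q.c ^ (2 * n) * diag n a := by
  let S : Submodule ℂ (Pol q) :=
    { carrier := {a | Summable fun n : ℕ => q.c ^ (2 * n) * diag n a}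
      add_mem' := fun {a b} ha hb => by
        simp only [Set.mem_ofPred_eq, map_add, mul_add] at *
        exact ha.add hb
      zero_mem' := by simp
      smul_mem' := fun c a ha => by
        simp only [Set.mem_ofPred_eq, map_smul, smul_eq_mul] at *
        refine (ha.mul_left c).congr fun n => by ring }
  refine mem_of_mon S (fun i j k => ?_) (fun i j k => ?_) a
  · change Summable _
    simp only [diag_mon]
    split_ifs
    · exact (hasSum_geom j).summable
    · simp
  · change Summable _
    simp only [diag_mon']
    split_ifs
    · exact (hasSum_geom j).summable
    · simp

variable (q) in
/-- An explicit formula for the Haar state. -/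
def h0 : Pol q →ₗ[ℂ] ℂ where
  toFun a := (1 - q.c ^ 2) * ∑' n : ℕ, q.c ^ (2 * n) * diag n a
  map_add' a b := by
    simp only [map_add, mul_add]
    rw [(summ a).tsum_add (summ b), mul_add]
  map_smul' c a := by
    simp only [map_smul, smul_eq_mul, RingHom.id_apply]
    have e : (fun n : ℕ => q.c ^ (2 * n) * (c * diag n a)) =
        fun n => c * (q.c ^ (2 * n) * diag n a) := by
      funext n; ring
    rw [e, tsum_mul_left]
    ring

variable (q) in
/-- The values of the Haar state on `(γγ*)ʲ`. -/
def hv (j : ℕ) : ℂ := (1 - q.c ^ 2) * (1 - q.c ^ (2 * j + 2))⁻¹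

lemma h0_mon (i j k : ℕ) : h0 q (mon q i j k) = if i = 0 ∧ j = k then hv q j else 0 := by
  simp only [h0, LinearMap.coe_mk, AddHom.coe_mk, diag_mon]
  split_ifs
  · rw [(hasSum_geom j).tsum_eq, hv]
  · simp
lemma h0_mon' (i j k : ℕ) : h0 q (mon' q i j k) = if i = 0 ∧ j = k then hv q j else 0 := by
  simp only [h0, LinearMap.coe_mk, AddHom.coe_mk, diag_mon']
  split_ifs
  · rw [(hasSum_geom j).tsum_eq, hv]
  · simp

lemma h0_nonneg (a : Pol q) : 0 ≤ h0 q (star a * a) := by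
  have hq : (0 : ℂ) ≤ q.c := by simpa [Param.c] using q.pos.le
  have h1 : (0 : ℂ) ≤ 1 - q.c ^ 2 := by
    have : (0 : ℝ) ≤ 1 - (q : ℝ) ^ 2 := by
      nlinarith [q.pos, q.lt_one]
    have h : ((0 : ℝ) : ℂ) ≤ ((1 - (q : ℝ) ^ 2 : ℝ) : ℂ) := Complex.real_le_real.2 this
    simpa [Param.c] using h
  refine mul_nonneg h1 (tsum_nonneg fun n => mul_nonneg (pow_nonneg hq _) (diag_nonneg n a))


/-! #### Invariance -/

lemma dk_pow (a : Pol q) (n : ℕ) : dk q (a ^ n) = dk q a ^ n := by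
  induction n with
  | zero => simp [dk_one]
  | succ n ih => rw [pow_succ, dk_mul, ih, pow_succ]
lemma dkinv_pow (a : Pol q) (n : ℕ) : dkinv q (a ^ n) = dkinv q a ^ n := by
  induction n with
  | zero => simp [dkinv_one]
  | succ n ih => rw [pow_succ, dkinv_mul, ih, pow_succ]

lemma dk_mon (i j k : ℕ) :
    dk q (mon q i j k) = (q.sq ^ (i + j) * q.sq⁻¹ ^ k) • mon q i j k := by
  simp only [mon, dk_mul, dk_pow, dk_gen, vals, smul_pow, smul_mul_smul_comm, pow_add, mul_assoc]
lemma dk_mon' (i j k : ℕ) :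
    dk q (mon' q i j k) = (q.sq ^ j * q.sq⁻¹ ^ (i + k)) • mon' q i j k := by
  simp only [mon', dk_mul, dk_pow, dk_gen, vals, smul_pow, smul_mul_smul_comm, pow_add]
  congr 1; ring

lemma de_al_pow (i : ℕ) : de q (gen q .al ^ i) = 0 := by
  induction i with
  | zero => simp [de_one]
  | succ i ih => rw [pow_succ, de_mul, ih, de_gen]; simp [vals]
lemma de_ga_pow (i : ℕ) : de q (gen q .ga ^ i) = 0 := by
  induction i with
  | zero => simp [de_one]
  | succ i ih => rw [pow_succ, de_mul, ih, de_gen]; simp [vals]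

variable (q) in
/-- The square root of `q` as a real number. -/
def s : ℝ := Real.sqrt (q : ℝ)
lemma s_pos : 0 < s q := Real.sqrt_pos.2 q.pos
lemma s_lt : s q < 1 := by
  rw [s, Real.sqrt_lt' one_pos]; simpa using q.lt_one
lemma sq_eq : q.sq = (s q : ℂ) := rfl
lemma c_eq : q.c = (s q : ℂ) ^ 2 := by rw [← q.sq_mul, sq_eq, pow_two]
lemma one_sub_pos (n : ℕ) (hn : n ≠ 0) : 0 < 1 - s q ^ n := by
  have := pow_lt_one₀ s_pos.le (s_lt (q := q)) hn
  linarith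

variable (q) in
/-- The coefficient in `∂_e(γ*ᵏ⁺¹) = -r α γ*ᵏ`. -/
def gco (k : ℕ) : ℝ := (s q ^ (3 * k + 2))⁻¹ * ((1 - s q ^ (4 * k + 4)) / (1 - s q ^ 4))

lemma gco_pos (k : ℕ) : 0 < gco q k :=
  mul_pos (inv_pos.2 (pow_pos s_pos _)) (div_pos (one_sub_pos _ (by omega))
    (one_sub_pos _ (by omega)))

lemma gco_succ (k : ℕ) : gco q (k + 1) = (s q ^ 2)⁻¹ * s q ^ (k + 1) + (s q ^ 3)⁻¹ * gco q k := by
  have h := (s_pos (q := q)).ne'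
  have h4 : 1 - s q ^ 4 ≠ 0 := (one_sub_pos 4 (by omega)).ne'
  have e1 : s q ^ (3 * (k + 1) + 2) = (s q ^ k) ^ 3 * s q ^ 5 := by ring
  have e2 : s q ^ (4 * (k + 1) + 4) = (s q ^ k) ^ 4 * s q ^ 8 := by ring
  have e3 : s q ^ (3 * k + 2) = (s q ^ k) ^ 3 * s q ^ 2 := by ring
  have e4 : s q ^ (4 * k + 4) = (s q ^ k) ^ 4 * s q ^ 4 := by ring
  rw [gco, gco, e1, e2, e3, e4, pow_succ (s q) k]
  field_simp
  ring

lemma gco_zero : gco q 0 = (s q ^ 2)⁻¹ := by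
  have h4 : 1 - s q ^ 4 ≠ 0 := (one_sub_pos 4 (by omega)).ne'
  simp [gco, h4]

lemma de_gas_pow (k : ℕ) : de q (gen q .gas ^ (k + 1)) =
    (-(gco q k : ℝ) : ℂ) • (gen q .al * gen q .gas ^ k) := by
  have h : (s q : ℂ) ≠ 0 := by exact_mod_cast (s_pos (q := q)).ne'
  induction k with
  | zero => simp [de_gen, vals, gco_zero, c_eq]
  | succ k ih =>
    rw [pow_succ', de_mul, ih, de_gen, dkinv_pow, dkinv_gen, dk_gen]
    simp only [vals, smul_pow, smul_mul_smul_comm]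
    rw [← mul_assoc (gen q .gas), gas_al, smul_mul_assoc, mul_assoc, ← pow_succ', smul_smul,
      ← add_smul, gco_succ]
    congr 1
    rw [c_eq, sq_eq]
    push_cast
    field_simp
    ring

/-- The coefficient in `∂_e(α*ⁱ⁺¹) = r α*ⁱ γ`. -/
def dco (q : Param) : ℕ → ℝ
  | 0 => 1
  | i + 1 => s q ^ (3 * i + 3) + (s q)⁻¹ * dco q i

lemma dco_pos (i : ℕ) : 0 < dco q i := by
  induction i with
  | zero => simp [dco]
  | succ i ih =>
    have := s_pos (q := q)
    simp only [dco]; positivity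

lemma de_als_pow (i : ℕ) : de q (gen q .als ^ (i + 1)) =
    (dco q i : ℂ) • (gen q .als ^ i * gen q .ga) := by
  induction i with
  | zero => simp [de_gen, vals, dco]
  | succ i ih =>
    rw [pow_succ', de_mul, ih, de_gen, dkinv_pow, dkinv_gen, dk_gen]
    simp only [vals, smul_pow, smul_mul_assoc, mul_smul_comm]
    rw [comm_pow (rels q).r7, ← mul_assoc, ← pow_succ', smul_smul, smul_smul, ← add_smul, dco]
    congr 1
    rw [c_eq, sq_eq]
    push_cast
    ring

lemma de_mon_zero (i j : ℕ) : de q (mon q i j 0) = 0 := by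
  simp [mon, de_mul, de_al_pow, de_ga_pow]

lemma de_ga_gas (j k : ℕ) : de q (gen q .ga ^ j * gen q .gas ^ (k + 1)) =
    (-(s q ^ j * gco q k * (s q ^ (2 * j))⁻¹ : ℝ) : ℂ) •
      (gen q .al * (gen q .ga ^ j * gen q .gas ^ k)) := by
  have h : (s q : ℂ) ≠ 0 := by exact_mod_cast (s_pos (q := q)).ne'
  rw [de_mul, de_ga_pow, zero_mul, zero_add, dk_pow, dk_gen, de_gas_pow]
  simp only [vals, smul_pow, smul_mul_smul_comm]
  rw [← mul_assoc, pow_comm' ga_al, smul_mul_assoc, mul_assoc, smul_smul]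
  congr 1
  rw [c_eq, sq_eq]
  push_cast
  rw [inv_pow, ← pow_mul]
  ring

lemma de_mon_succ (i j k : ℕ) : ∃ r : ℂ, r ≠ 0 ∧
    de q (mon q i j (k + 1)) = r • mon q (i + 1) j k := by
  have h : (s q : ℂ) ≠ 0 := by exact_mod_cast (s_pos (q := q)).ne'
  have hg : (gco q k : ℂ) ≠ 0 := by exact_mod_cast (gco_pos (q := q) k).ne'
  refine ⟨(s q : ℂ) ^ i * (-(s q ^ j * gco q k * (s q ^ (2 * j))⁻¹ : ℝ) : ℂ), ?_, ?_⟩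
  · push_cast
    refine mul_ne_zero (pow_ne_zero _ h) (neg_ne_zero.2 (mul_ne_zero (mul_ne_zero
      (pow_ne_zero _ h) hg) (inv_ne_zero (pow_ne_zero _ h))))
  · rw [mon, de_mul, de_al_pow, zero_mul, zero_add, dk_pow, dk_gen, de_ga_gas]
    simp only [vals, smul_pow, smul_mul_smul_comm]
    rw [← mul_assoc, ← pow_succ, sq_eq, mon]

lemma de_mon'_zero (i j : ℕ) : ∃ r : ℂ, r ≠ 0 ∧
    de q (mon' q (i + 1) j 0) = r • mon' q i (j + 1) 0 := by
  have h : (s q : ℂ) ≠ 0 := by exact_mod_cast (s_pos (q := q)).ne'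
  have hg : (dco q i : ℂ) ≠ 0 := by exact_mod_cast (dco_pos (q := q) i).ne'
  refine ⟨dco q i * (s q : ℂ)⁻¹ ^ j, mul_ne_zero hg (pow_ne_zero _ (inv_ne_zero h)), ?_⟩
  rw [mon', pow_zero, mul_one, de_mul, de_ga_pow, mul_zero, add_zero, dkinv_pow, dkinv_gen,
    de_als_pow]
  simp only [vals, smul_pow, smul_mul_smul_comm]
  rw [mul_assoc, ← pow_succ', sq_eq, mon', pow_zero, mul_one]

lemma hv_rel (j : ℕ) : hv q j - hv q (j + 1) = hv q j * hv q (j + 1) * (s q : ℂ) ^ (4 * j + 4) := by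
  have h1 : (1 : ℂ) - s q ^ (4 * j + 4) ≠ 0 := by
    exact_mod_cast (one_sub_pos (q := q) (4 * j + 4) (by omega)).ne'
  have h2 : (1 : ℂ) - s q ^ (4 * j + 8) ≠ 0 := by
    exact_mod_cast (one_sub_pos (q := q) (4 * j + 8) (by omega)).ne'
  simp only [hv, c_eq, ← pow_mul]
  rw [show 2 * (2 * j + 2) = 4 * j + 4 by ring, show 2 * (2 * (j + 1) + 2) = 4 * j + 8 by ring]
  field_simp
  ring

lemma de_mon'_succ (i j k : ℕ) : ∃ P Q : ℝ, 0 < P ∧ 0 < Q ∧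
    de q (mon' q (i + 1) j (k + 1)) = (P : ℂ) • mon' q i (j + 1) (k + 1) -
      (Q : ℂ) • (mon' q i j k - mon' q i (j + 1) (k + 1)) ∧
    (i = 0 → j = k → (P : ℂ) * hv q (k + 1) = Q * (hv q k - hv q (k + 1))) := by
  have hp := s_pos (q := q)
  have h : (s q : ℂ) ≠ 0 := by exact_mod_cast hp.ne'
  refine ⟨dco q i * ((s q)⁻¹ ^ j * s q ^ (k + 1)),
    (s q)⁻¹ ^ (i + 1) * (s q ^ j * gco q k * (s q ^ (2 * j))⁻¹), ?_, ?_, ?_, ?_⟩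
  · have := dco_pos (q := q) i
    positivity
  · have := gco_pos (q := q) k
    positivity
  · rw [mon', de_mul, de_ga_gas, de_als_pow, dkinv_mul, dkinv_pow, dkinv_pow, dkinv_gen, dkinv_gen,
      dk_pow, dk_gen]
    simp only [vals, smul_pow, smul_mul_smul_comm]
    rw [sub_eq_add_neg, ← neg_smul, sq_eq]
    have e1 : gen q .als ^ i * gen q .ga * (gen q .ga ^ j * gen q .gas ^ (k + 1)) =
        mon' q i (j + 1) (k + 1) := by
      rw [mon', pow_succ' (gen q .ga)]; simp only [mul_assoc]
    have e2 : gen q .als ^ (i + 1) * (gen q .al * (gen q .ga ^ j * gen q .gas ^ k)) =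
        mon' q i j k - mon' q i (j + 1) (k + 1) := by
      rw [pow_succ, mul_assoc, ← mul_assoc (gen q .als) (gen q .al), als_al, sub_mul, one_mul,
        mul_sub, mon', mon', pow_succ' (gen q .ga), pow_succ' (gen q .gas), mul_assoc (gen q .ga),
        ← mul_assoc (gen q .gas), gas_ga_pow]
      simp only [mul_assoc]
    rw [e1, e2]
    push_cast
    congr 2
    ring
  · rintro rfl rfl
    rw [hv_rel]
    have h1 : (1 : ℂ) - s q ^ (4 * j + 4) ≠ 0 := by
      exact_mod_cast (one_sub_pos (q := q) (4 * j + 4) (by omega)).ne'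
    have h4 : (1 : ℂ) - s q ^ 4 ≠ 0 := by
      exact_mod_cast (one_sub_pos (q := q) 4 (by omega)).ne'
    have e : hv q j = (1 - (s q : ℂ) ^ 4) * (1 - (s q : ℂ) ^ (4 * j + 4))⁻¹ := by
      simp only [hv, c_eq, ← pow_mul]
      rw [show 2 * (2 * j + 2) = 4 * j + 4 by ring]
    have key : ((s q : ℂ)⁻¹ ^ j * s q ^ (j + 1)) =
        (s q : ℂ)⁻¹ * (s q ^ j * gco q j * (s q ^ (2 * j))⁻¹) * (hv q j * s q ^ (4 * j + 4)) := by
      rw [e, gco]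
      push_cast
      have e1 : (s q : ℂ) ^ (j + 1) = s q ^ j * s q := by ring
      have e2 : (s q : ℂ) ^ (2 * j) = (s q ^ j) ^ 2 := by ring
      have e3 : (s q : ℂ) ^ (3 * j + 2) = (s q ^ j) ^ 3 * s q ^ 2 := by ring
      have e4 : (s q : ℂ) ^ (4 * j + 4) = (s q ^ j) ^ 4 * s q ^ 4 := by ring
      rw [e4] at h1
      rw [e1, e2, e3, e4, inv_pow]
      have hj : (s q : ℂ) ^ j ≠ 0 := pow_ne_zero _ h
      generalize (s q : ℂ) ^ j = A at h1 hj ⊢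
      field_simp
    simp only [dco, zero_add, pow_one]
    push_cast at key ⊢
    rw [one_mul, key]
    ring

lemma h0_de (a : Pol q) : h0 q (de q a) = 0 := by
  refine mem_of_mon (LinearMap.ker (h0 q ∘ₗ de q)) (fun i j k => ?_) (fun i j k => ?_) a
  · rw [LinearMap.mem_ker, LinearMap.comp_apply]
    rcases k with _ | k
    · rw [de_mon_zero, map_zero]
    · obtain ⟨r, -, h⟩ := de_mon_succ (q := q) i j k
      rw [h, map_smul, h0_mon]; simp
  · rw [LinearMap.mem_ker, LinearMap.comp_apply]
    rcases i with _ | i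
    · rw [← mon_zero]
      rcases k with _ | k
      · rw [de_mon_zero, map_zero]
      · obtain ⟨r, -, h⟩ := de_mon_succ (q := q) 0 j k
        rw [h, map_smul, h0_mon]; simp
    rcases k with _ | k
    · obtain ⟨r, -, h⟩ := de_mon'_zero (q := q) i j
      rw [h, map_smul, h0_mon']; simp
    · obtain ⟨P, Q, -, -, h, hr⟩ := de_mon'_succ (q := q) i j k
      rw [h, map_sub, map_smul, map_smul, map_sub, h0_mon', h0_mon']
      by_cases hi : i = 0 ∧ j = k
      · obtain ⟨rfl, rfl⟩ := hi
        have := hr rfl rfl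
        simp [this]
      · rw [if_neg (by omega), if_neg hi]; simp

lemma h0_dk (a : Pol q) : h0 q (dk q a) = h0 q a := by
  have h := q.sq_ne
  suffices a ∈ LinearMap.ker (h0 q ∘ₗ dk q - h0 q) by
    simpa [LinearMap.mem_ker, sub_eq_zero] using this
  refine mem_of_mon _ (fun i j k => ?_) (fun i j k => ?_) a
  · rw [LinearMap.mem_ker, LinearMap.sub_apply, LinearMap.comp_apply, dk_mon, map_smul, h0_mon]
    split_ifs with hh
    · obtain ⟨rfl, rfl⟩ := hh
      simp [h]
    · simp
  · rw [LinearMap.mem_ker, LinearMap.sub_apply, LinearMap.comp_apply, dk_mon', map_smul, h0_mon']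
    split_ifs with hh
    · obtain ⟨rfl, rfl⟩ := hh
      simp [h]
    · simp

variable (q) in
/-- Coassociativity. -/
lemma coassoc (a : Pol q) :
    TensorProduct.assoc ℂ (Pol q) (Pol q) (Pol q) ((comul q).toLinearMap.rTensor (Pol q)
      (comul q a)) = (comul q).toLinearMap.lTensor (Pol q) (comul q a) := by
  let F : Pol q →ₐ[ℂ] Pol q ⊗[ℂ] (Pol q ⊗[ℂ] Pol q) :=
    (Algebra.TensorProduct.assoc ℂ ℂ ℂ (Pol q) (Pol q) (Pol q)).toAlgHom.comp
      ((Algebra.TensorProduct.map (comul q) (AlgHom.id ℂ _)).comp (comul q))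
  let G : Pol q →ₐ[ℂ] Pol q ⊗[ℂ] (Pol q ⊗[ℂ] Pol q) :=
    (Algebra.TensorProduct.map (AlgHom.id ℂ _) (comul q)).comp (comul q)
  have : F = G := by
    refine hom_ext fun g => ?_
    cases g <;> simp [F, G, comul, vals, TensorProduct.tmul_add, TensorProduct.add_tmul,
      TensorProduct.tmul_sub, TensorProduct.sub_tmul, ← TensorProduct.smul_tmul',
      smul_add]
    all_goals abel
  exact DFunLike.congr_fun this a

lemma partialOp_comp (h ω : Pol q →ₗ[ℂ] ℂ) (a : Pol q) :
    partialOp q h (partialOp q ω a) = partialOp q (h ∘ₗ partialOp q ω) a := by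
  let T : Pol q ⊗[ℂ] (Pol q ⊗[ℂ] Pol q) →ₗ[ℂ] Pol q :=
    slice q h ∘ₗ ((slice q ω).lTensor (Pol q))
  have e1 : ∀ x : Pol q ⊗[ℂ] Pol q, slice q h (comul q (slice q ω x)) =
      T (TensorProduct.assoc ℂ (Pol q) (Pol q) (Pol q) ((comul q).toLinearMap.rTensor (Pol q) x)) := by
    intro x
    induction x with
    | zero => simp
    | add x y hx hy => simp only [map_add, hx, hy]
    | tmul x y =>
      have : ∀ z : Pol q ⊗[ℂ] Pol q, ω y • slice q h z =
          T (TensorProduct.assoc ℂ (Pol q) (Pol q) (Pol q) (z ⊗ₜ y)) := by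
        intro z
        induction z with
        | zero => simp
        | add x y hx hy => simp only [map_add, smul_add, hx, hy, TensorProduct.add_tmul]
        | tmul u v => simp [T, smul_smul]
      simpa using this (comul q x)
  have e2 : ∀ x : Pol q ⊗[ℂ] Pol q, slice q (h ∘ₗ partialOp q ω) x =
      T ((comul q).toLinearMap.lTensor (Pol q) x) := by
    intro x
    induction x with
    | zero => simp
    | add x y hx hy => simp only [map_add, hx, hy]
    | tmul x y => simp [T, partialOp]
  have := (e1 (comul q a)).trans ((congrArg T (coassoc q a)).trans (e2 (comul q a)).symm)
  exact this

/-- Elements on which the invariance holds. -/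
def good (q : Param) : Submodule ℂ (Pol q) :=
  LinearMap.ker (partialOp q (h0 q) - (h0 q).smulRight 1)

lemma mem_good {a : Pol q} : a ∈ good q ↔ partialOp q (h0 q) a = h0 q a • 1 := by
  simp [good, LinearMap.mem_ker, sub_eq_zero]

lemma good_of_dk {a : Pol q} {r : ℂ} (h : dk q a = r • a) (hr : r ≠ 1) : a ∈ good q := by
  have h1 : partialOp q (h0 q) (dk q a) = partialOp q (h0 q) a := by
    rw [dk, partialOp_comp]
    have e : h0 q ∘ₗ partialOp q (kFun q).toLinearMap = h0 q := LinearMap.ext fun x => h0_dk x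
    rw [e]
  have h2 := h0_dk a
  rw [h, map_smul] at h1 h2
  have e1 : partialOp q (h0 q) a = 0 := by
    have : (r - 1) • partialOp q (h0 q) a = 0 := by rw [sub_smul, one_smul, h1, sub_self]
    exact (smul_eq_zero.1 this).resolve_left (sub_ne_zero.2 hr)
  have e2 : h0 q a = 0 := by
    have : (r - 1) • h0 q a = 0 := by rw [sub_smul, one_smul, h2, sub_self]
    exact (smul_eq_zero.1 this).resolve_left (sub_ne_zero.2 hr)
  rw [mem_good, e1, e2, zero_smul]

lemma good_de (a : Pol q) : de q a ∈ good q := by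
  rw [mem_good, h0_de, de, partialOp_comp]
  have : h0 q ∘ₗ partialOp q (eFun q) = 0 := LinearMap.ext fun x => h0_de x
  rw [this]
  simp [partialOp]

lemma pow_ratio_ne {a b : ℕ} (h : a ≠ b) : q.sq ^ a * q.sq⁻¹ ^ b ≠ 1 := by
  intro h1
  apply h
  rw [inv_pow, mul_inv_eq_one₀ (pow_ne_zero _ q.sq_ne), sq_eq] at h1
  have h2 : s q ^ a = s q ^ b := by exact_mod_cast h1
  exact (pow_right_strictAnti₀ s_pos s_lt).injective h2

lemma h0_one : h0 q 1 = 1 := by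
  have h : (1 : Pol q) = mon q 0 0 0 := by simp [mon]
  rw [h, h0_mon]
  have h4 : (1 : ℂ) - s q ^ 4 ≠ 0 := by
    exact_mod_cast (one_sub_pos (q := q) 4 (by omega)).ne'
  simp only [and_self, if_true, hv, mul_zero, zero_add, c_eq, ← pow_mul]
  exact mul_inv_cancel₀ h4

lemma good_one : (1 : Pol q) ∈ good q := by
  rw [mem_good]; simp [partialOp, Algebra.TensorProduct.one_def]

lemma good_mon' (i k : ℕ) : mon' q i (i + k) k ∈ good q := by
  induction k with
  | zero =>
    rcases i with _ | i
    · simpa [mon'] using good_one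
    · obtain ⟨r, hr, h⟩ := de_mon'_zero (q := q) (i + 1) i
      have := (good q).smul_mem r⁻¹ (h ▸ good_de (mon' q (i + 1 + 1) i 0))
      rwa [inv_smul_smul₀ hr] at this
  | succ k ih =>
    obtain ⟨P, Q, hP, hQ, h, -⟩ := de_mon'_succ (q := q) i (i + k) k
    have h1 := (good q).add_mem (good_de (mon' q (i + 1) (i + k) (k + 1)))
      ((good q).smul_mem (Q : ℂ) ih)
    have e : de q (mon' q (i + 1) (i + k) (k + 1)) + (Q : ℂ) • mon' q i (i + k) k =
        ((P + Q : ℝ) : ℂ) • mon' q i (i + (k + 1)) (k + 1) := by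
      rw [h, ← add_assoc i k 1]; push_cast; module
    have hne : ((P + Q : ℝ) : ℂ) ≠ 0 := by exact_mod_cast (add_pos hP hQ).ne'
    rw [e] at h1
    have := (good q).smul_mem ((P + Q : ℝ) : ℂ)⁻¹ h1
    rwa [inv_smul_smul₀ hne] at this

lemma h0_left (a : Pol q) : partialOp q (h0 q) a = h0 q a • 1 := by
  rw [← mem_good]
  refine mem_of_mon _ (fun i j k => ?_) (fun i j k => ?_) a
  · by_cases h : i + j = k
    · subst h
      rcases i with _ | i
      · rw [mon_zero]
        simpa using good_mon' (q := q) 0 j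
      · obtain ⟨r, hr, h⟩ := de_mon_succ (q := q) i j (i + 1 + j)
        have := (good q).smul_mem r⁻¹ (h ▸ good_de (mon q i j (i + 1 + j + 1)))
        rwa [inv_smul_smul₀ hr] at this
    · exact good_of_dk (dk_mon i j k) (pow_ratio_ne h)
  · by_cases h : j = i + k
    · subst h
      exact good_mon' i k
    · exact good_of_dk (dk_mon' i j k) (pow_ratio_ne h)

/-! #### The transposition -/

lemma tauRels (q : Param) :
    Rels q (gen q .al) (gen q .als) (-q.c • gen q .gas) (-q.c⁻¹ • gen q .ga) := by
  have hc := q.c_ne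
  obtain ⟨h1, h2, h3, h4, h5, h6, h7⟩ := rels q
  constructor <;> simp only [smul_mul_assoc, mul_smul_comm, smul_smul, neg_mul_neg,
    mul_inv_cancel₀ hc, inv_mul_cancel₀ hc, one_smul, ← h3, h1, h2, h4, h5, h6, h7]
  all_goals first | rfl | (congr 1; ring)

/-- The algebra automorphism given by the transposition of the fundamental matrix. -/
def tau (q : Param) : Pol q →ₐ[ℂ] Pol q := lift (tauRels q)

lemma tau_tau (a : Pol q) : tau q (tau q a) = a := by
  have hc := q.c_ne
  have : (tau q).comp (tau q) = AlgHom.id ℂ _ := by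
    refine hom_ext fun g => ?_
    cases g <;> simp [tau, vals, smul_smul, hc]
  exact DFunLike.congr_fun this a

lemma comul_tau (a : Pol q) : comul q (tau q a) =
    TensorProduct.map (tau q).toLinearMap (tau q).toLinearMap
      (TensorProduct.comm ℂ (Pol q) (Pol q) (comul q a)) := by
  have hc := q.c_ne
  let G : Pol q →ₐ[ℂ] Pol q ⊗[ℂ] Pol q :=
    ((Algebra.TensorProduct.map (tau q) (tau q)).comp
      (Algebra.TensorProduct.comm ℂ (Pol q) (Pol q)).toAlgHom).comp (comul q)
  have : (comul q).comp (tau q) = G := by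
    refine hom_ext fun g => ?_
    cases g <;> simp [G, comul, tau, vals, TensorProduct.tmul_smul, ← TensorProduct.smul_tmul',
      smul_smul, hc, TensorProduct.tmul_neg, TensorProduct.neg_tmul, smul_add]
  exact DFunLike.congr_fun this a

lemma h0_tau (a : Pol q) : h0 q (tau q a) = h0 q a := by
  have hc := q.c_ne
  suffices a ∈ LinearMap.ker (h0 q ∘ₗ (tau q).toLinearMap - h0 q) by
    simpa [LinearMap.mem_ker, sub_eq_zero] using this
  have e : ∀ i j k, tau q (mon q i j k) = ((-q.c) ^ j * (-q.c⁻¹) ^ k) • mon q i k j := by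
    intro i j k
    simp only [mon, map_mul, map_pow, tau, lift_gen, vals, smul_pow, smul_mul_assoc,
      mul_smul_comm, gas_pow_ga_pow, smul_smul]
    rw [mul_comm]
  have e' : ∀ i j k, tau q (mon' q i j k) = ((-q.c) ^ j * (-q.c⁻¹) ^ k) • mon' q i k j := by
    intro i j k
    simp only [mon', map_mul, map_pow, tau, lift_gen, vals, smul_pow, smul_mul_assoc,
      mul_smul_comm, gas_pow_ga_pow, smul_smul]
    rw [mul_comm]
  refine mem_of_mon _ (fun i j k => ?_) (fun i j k => ?_) a
  · rw [LinearMap.mem_ker, LinearMap.sub_apply, LinearMap.comp_apply, AlgHom.toLinearMap_apply, e,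
      map_smul, h0_mon, h0_mon]
    by_cases h : i = 0 ∧ j = k
    · obtain ⟨rfl, rfl⟩ := h
      simp [← mul_pow, hc]
    · rw [if_neg h, if_neg (by omega)]; simp
  · rw [LinearMap.mem_ker, LinearMap.sub_apply, LinearMap.comp_apply, AlgHom.toLinearMap_apply, e',
      map_smul, h0_mon', h0_mon']
    by_cases h : i = 0 ∧ j = k
    · obtain ⟨rfl, rfl⟩ := h
      simp [← mul_pow, hc]
    · rw [if_neg h, if_neg (by omega)]; simp

lemma rightOp_tau (a : Pol q) : rightOp q (h0 q) (tau q a) = tau q (partialOp q (h0 q) a) := by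
  have : ∀ x : Pol q ⊗[ℂ] Pol q,
      TensorProduct.lid ℂ (Pol q) ((h0 q).rTensor (Pol q)
        (TensorProduct.map (tau q).toLinearMap (tau q).toLinearMap
          (TensorProduct.comm ℂ (Pol q) (Pol q) x))) = tau q (slice q (h0 q) x) := by
    intro x
    induction x with
    | zero => simp
    | add x y hx hy => simp only [map_add, hx, hy]
    | tmul x y => simp [h0_tau]
  have h2 := this (comul q a)
  rw [← comul_tau] at h2
  exact h2

lemma h0_right (a : Pol q) : rightOp q (h0 q) a = h0 q a • 1 := by
  rw [← tau_tau a, rightOp_tau, h0_left, map_smul, map_one, h0_tau (tau q a)]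

end HaarExists

theorem exists_isHaarState (q : Param) : ∃ h, IsHaarState q h :=
  ⟨HaarExists.h0 q, HaarExists.h0_one, HaarExists.h0_nonneg, HaarExists.h0_left,
    HaarExists.h0_right⟩

/-- The Haar state is determined by its invariance. -/
theorem IsHaarState.unique {h h' : Pol q →ₗ[ℂ] ℂ} (H : IsHaarState q h) (H' : IsHaarState q h') :
    h = h' := by
  refine LinearMap.ext fun a => ?_
  have e : ∀ x : Pol q ⊗[ℂ] Pol q, h' (slice q h x) =
      h (TensorProduct.lid ℂ (Pol q) (h'.rTensor (Pol q) x)) := by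
    intro x
    induction x with
    | zero => simp
    | add x y hx hy => simp only [map_add, hx, hy]
    | tmul x y => simp [mul_comm]
  have h1 : h' (partialOp q h a) = h (rightOp q h' a) := e (comul q a)
  rw [H.left_inv, H'.right_inv, map_smul, map_smul, H.map_one, H'.map_one] at h1
  simpa using h1


variable (q) in
/-- The Haar state of quantum `SU(2)`. -/
def haar : Pol q →ₗ[ℂ] ℂ := (exists_isHaarState q).choose

lemma haar_spec : IsHaarState q (haar q) := (exists_isHaarState q).choose_spec

lemma haar_star_aux {a : Pol q} (h : 0 ≤ haar q a) : starRingEnd ℂ (haar q a) = haar q a :=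
  Complex.conj_eq_iff_im.2 (Complex.nonneg_iff.1 h).2.symm

lemma haar_star (a : Pol q) : haar q (star a) = starRingEnd ℂ (haar q a) := by
  have e := haar_star_aux (haar_spec.nonneg a)
  have e1 := haar_star_aux (haar_spec.nonneg (a + 1))
  have e2 := haar_star_aux (haar_spec.nonneg (a + Complex.I • 1))
  have f1 : star (a + 1) * (a + 1) = star a * a + (star a + a) + 1 := by
    simp only [star_add, star_one, add_mul, mul_add, one_mul, mul_one]; abel
  have f2 : star (a + Complex.I • 1) * (a + Complex.I • 1) =
      star a * a + Complex.I • (star a - a) + 1 := by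
    have h0 : star (Complex.I • 1 : Pol q) = -(Complex.I • 1) := by simp
    have h1 : star a * (Complex.I • 1 : Pol q) = Complex.I • star a := by simp
    have h2 : (Complex.I • 1 : Pol q) * a = Complex.I • a := by simp
    have h3 : (Complex.I • 1 : Pol q) * Complex.I • 1 = -1 := by
      rw [smul_mul_smul_comm, Complex.I_mul_I, mul_one, neg_smul, one_smul]
    rw [star_add, h0, add_mul, mul_add, mul_add, neg_mul, neg_mul, h1, h2, h3, smul_sub]
    abel
  rw [f1] at e1
  rw [f2] at e2
  simp only [map_add, map_sub, map_smul, smul_eq_mul, map_mul, Complex.conj_I, e,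
    haar_spec.map_one, map_one] at e1 e2
  have g1 : starRingEnd ℂ (haar q (star a)) + starRingEnd ℂ (haar q a) =
      haar q (star a) + haar q a := by linear_combination e1
  have g2 : starRingEnd ℂ (haar q (star a)) - starRingEnd ℂ (haar q a) =
      -(haar q (star a) - haar q a) := by
    have hI : Complex.I * Complex.I = -1 := Complex.I_mul_I
    linear_combination Complex.I * e2 + (starRingEnd ℂ (haar q (star a)) -
      starRingEnd ℂ (haar q a) + haar q (star a) - haar q a) * hI
  linear_combination (-1 / 2 : ℂ) * g1 + (1 / 2 : ℂ) * g2

/-! ### The Hilbert spaces `L²(A_n, h)` -/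

variable (q) in
/-- The space `{a | ∂_k(a) = q^{n/2} a}`, to be equipped with the (semi-)norm of the
GNS-representation of the Haar state. -/
def Sec (n : ℤ) : Type := homog q n

instance (n : ℤ) : AddCommGroup (Sec q n) := inferInstanceAs (AddCommGroup (homog q n))
instance (n : ℤ) : Module ℂ (Sec q n) := inferInstanceAs (Module ℂ (homog q n))

/-- The inclusion into the polynomial functions. -/
def Sec.val {n : ℤ} : Sec q n →ₗ[ℂ] Pol q := (homog q n).subtype

/-- The inner product `⟨a, b⟩ = h(a* b)`. -/
abbrev secCore (q : Param) (n : ℤ) : PreInnerProductSpace.Core ℂ (Sec q n) where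
  inner a b := haar q (star a.val * b.val)
  conj_inner_symm a b := by rw [← haar_star, star_mul, star_star]
  re_inner_nonneg a := (Complex.nonneg_iff.1 (haar_spec.nonneg a.val)).1
  add_left a b c := by simp [add_mul]
  smul_left a b r := by simp

instance (n : ℤ) : SeminormedAddCommGroup (Sec q n) :=
  InnerProductSpace.Core.toSeminormedAddCommGroup (c := secCore q n)
instance (n : ℤ) : InnerProductSpace ℂ (Sec q n) :=
  InnerProductSpace.ofCore (secCore q n)

lemma Sec.inner_def {n : ℤ} (a b : Sec q n) : inner ℂ a b = haar q (star a.val * b.val) := rfl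

variable (q) in
/-- The Hilbert space `L²(A_n, h)`: the completion of `{a | ∂_k(a) = q^{n/2} a}` for the inner
product `h(a* b)`. As polynomial elements are dense in the corresponding space `A_n` of continuous
sections, this is also the closure of `A_n` in the GNS-space of the Haar state. -/
abbrev L2 (n : ℤ) : Type := UniformSpace.Completion (Sec q n)

/-! ### Left multiplication -/

lemma haar_sq_eq (a : Pol q) : haar q (star a * a) = ((haar q (star a * a)).re : ℂ) :=
  (Complex.conj_eq_iff_re.1 (haar_star_aux (haar_spec.nonneg a))).symm

lemma haar_sq_nonneg (a : Pol q) : 0 ≤ (haar q (star a * a)).re :=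
  (Complex.nonneg_iff.1 (haar_spec.nonneg a)).1

/-- Left multiplications are bounded for the norm of the GNS-representation. -/
lemma exists_bound (b : Pol q) : ∃ C : ℝ, 0 ≤ C ∧ ∀ x : Pol q,
    (haar q (star (b * x) * (b * x))).re ≤ C * (haar q (star x * x)).re := by
  have aux : ∀ x u : Pol q, (haar q (star (x + u) * (x + u))).re ≤
      2 * (haar q (star x * x)).re + 2 * (haar q (star u * u)).re := by
    intro x u
    have h := haar_sq_nonneg (x - u)
    have e : star (x + u) * (x + u) =
        (2 : ℂ) • (star x * x) + (2 : ℂ) • (star u * u) - star (x - u) * (x - u) := by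
      simp only [star_add, star_sub, add_mul, mul_add, sub_mul, mul_sub, two_smul]; abel
    rw [e, map_sub, map_add, map_smul, map_smul]
    simp only [smul_eq_mul, Complex.sub_re, Complex.add_re, Complex.mul_re, Complex.re_ofNat,
      Complex.im_ofNat, zero_mul, sub_zero]
    linarith
  have hga : ∀ x : Pol q, (haar q (star (gen q .al * x) * (gen q .al * x))).re +
      (haar q (star (gen q .ga * x) * (gen q .ga * x))).re = (haar q (star x * x)).re := by
    intro x
    rw [← Complex.add_re, ← map_add]
    congr 2
    rw [star_mul, star_mul, star_gen, star_gen]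
    simp only [vals]
    calc _ = star x * ((gen q .als * gen q .al + gen q .gas * gen q .ga) * x) := by noncomm_ring
      _ = _ := by rw [(rels q).r1, one_mul]
  have hgas : ∀ x : Pol q, haar q (star (gen q .gas * x) * (gen q .gas * x)) =
      haar q (star (gen q .ga * x) * (gen q .ga * x)) := by
    intro x
    congr 1
    rw [star_mul, star_mul, star_gen, star_gen]
    simp only [vals]
    calc _ = star x * ((gen q .ga * gen q .gas) * x) := by noncomm_ring
      _ = star x * ((gen q .gas * gen q .ga) * x) := by rw [(rels q).r3]
      _ = _ := by noncomm_ring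
  have hals : ∀ x : Pol q, (haar q (star (gen q .als * x) * (gen q .als * x))).re +
      (q : ℝ) ^ 2 * (haar q (star (gen q .ga * x) * (gen q .ga * x))).re =
        (haar q (star x * x)).re := by
    intro x
    have e : star (gen q .als * x) * (gen q .als * x) +
        q.c ^ 2 • (star (gen q .ga * x) * (gen q .ga * x)) = star x * x := by
      rw [star_mul, star_mul, star_gen, star_gen]
      simp only [vals]
      calc _ = star x * ((gen q .al * gen q .als + q.c ^ 2 • (gen q .gas * gen q .ga)) * x) := by
            rw [add_mul, mul_add, smul_mul_assoc, mul_smul_comm]; simp only [mul_assoc]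
        _ = _ := by rw [(rels q).r2, one_mul]
    have h := congrArg (fun y => (haar q y).re) e
    simp only [map_add, map_smul, Complex.add_re, smul_eq_mul] at h
    rw [haar_sq_eq (gen q .ga * x)] at h
    rw [← h]
    congr 1
    rw [Param.c, ← Complex.ofReal_pow, ← Complex.ofReal_mul, Complex.ofReal_re]
  induction b using Pol.induction with
  | hc r =>
    refine ⟨‖r‖ ^ 2, by positivity, fun x => ?_⟩
    rw [← Algebra.smul_def, star_smul, smul_mul_smul_comm, map_smul, smul_eq_mul,
      Complex.star_def, ← Complex.normSq_eq_conj_mul_self, Complex.re_ofReal_mul,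
      Complex.normSq_eq_norm_sq]
  | hg g =>
    refine ⟨1, zero_le_one, fun x => ?_⟩
    have h1 := haar_sq_nonneg (gen q .al * x)
    have h2 := haar_sq_nonneg (gen q .ga * x)
    have h3 := haar_sq_nonneg (gen q .als * x)
    have h4 : 0 ≤ (q : ℝ) ^ 2 * (haar q (star (gen q .ga * x) * (gen q .ga * x))).re :=
      mul_nonneg (sq_nonneg _) h2
    have := hga x
    have := hals x
    cases g
    · linarith
    · linarith
    · linarith
    · rw [hgas]; linarith
  | hm a b ha hb =>
    obtain ⟨C, hC, h⟩ := ha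
    obtain ⟨C', hC', h'⟩ := hb
    refine ⟨C * C', mul_nonneg hC hC', fun x => ?_⟩
    rw [mul_assoc a b x, mul_assoc C]
    exact (h _).trans (mul_le_mul_of_nonneg_left (h' x) hC)
  | ha a b ha hb =>
    obtain ⟨C, hC, h⟩ := ha
    obtain ⟨C', hC', h'⟩ := hb
    refine ⟨2 * C + 2 * C', by positivity, fun x => ?_⟩
    rw [add_mul]
    have := aux (a * x) (b * x)
    have := h x
    have := h' x
    linarith

/-- Left multiplication by an element of the algebra of the quantum sphere, on `Sec q n`. -/
def leftMulLin (b : homog q 0) (n : ℤ) : Sec q n →ₗ[ℂ] Sec q n :=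
  (LinearMap.mulLeft ℂ (b : Pol q)).restrict (p := homog q n) (q := homog q n) fun x hx => by
    have := mul_mem_homog b.2 hx
    rwa [zero_add] at this

lemma Sec.norm_sq {n : ℤ} (x : Sec q n) : ‖x‖ ^ 2 = (haar q (star x.val * x.val)).re := by
  rw [← Sec.inner_def, ← inner_self_eq_norm_sq (𝕜 := ℂ)]
  rfl

lemma leftMul_bound (b : homog q 0) (n : ℤ) : ∃ C : ℝ, ∀ x, ‖leftMulLin b n x‖ ≤ C * ‖x‖ := by
  obtain ⟨C, hC, h⟩ := exists_bound (b : Pol q)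
  refine ⟨Real.sqrt C, fun x => ?_⟩
  refine le_of_sq_le_sq ?_ (by positivity)
  rw [mul_pow, Real.sq_sqrt hC, Sec.norm_sq, Sec.norm_sq]
  exact h x.val

/-- Left multiplication by `b` as a bounded operator on `L²(A_n, h)`. -/
def leftMul (b : homog q 0) (n : ℤ) : L2 q n →L[ℂ] L2 q n :=
  ContinuousLinearMap.completion
    ((leftMulLin b n).mkContinuousOfExistsBound (leftMul_bound b n))

/-! ### Spinors and the Dirac operator -/

variable (q) in
/-- The Hilbert space of spinors `L²(A_1, h) ⊕ L²(A_{-1}, h)`. -/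
abbrev Spinor : Type := WithLp 2 (L2 q 1 × L2 q (-1))

/-- The diagonal operator with entries `S` and `T`. -/
def diagOp (S : L2 q 1 →L[ℂ] L2 q 1) (T : L2 q (-1) →L[ℂ] L2 q (-1)) : Spinor q →L[ℂ] Spinor q :=
  (WithLp.prodContinuousLinearEquiv 2 ℂ (L2 q 1) (L2 q (-1))).symm.toContinuousLinearMap ∘L
    S.prodMap T ∘L
    (WithLp.prodContinuousLinearEquiv 2 ℂ (L2 q 1) (L2 q (-1))).toContinuousLinearMap

/-- The action of the algebra of the quantum sphere on spinors. -/
def act (b : homog q 0) : Spinor q →L[ℂ] Spinor q := diagOp (leftMul b 1) (leftMul b (-1))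

variable (q) in
/-- The complex power `χ^w` of the operator `χ = diag(q, q⁻¹)`. -/
def chiPow (w : ℂ) : Spinor q →L[ℂ] Spinor q :=
  diagOp (q.c ^ w • ContinuousLinearMap.id ℂ _) (q.c⁻¹ ^ w • ContinuousLinearMap.id ℂ _)

variable (q) in
/-- `∂_e` from degree `-1` to degree `1`. -/
def deSec : Sec q (-1) →ₗ[ℂ] Sec q 1 :=
  (de q).restrict (p := homog q (-1)) (q := homog q 1) fun x hx => by
    simpa using de_mem hx

variable (q) in
/-- `∂_f` from degree `1` to degree `-1`. -/
def dfSec : Sec q 1 →ₗ[ℂ] Sec q (-1) :=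
  (df q).restrict (p := homog q 1) (q := homog q (-1)) fun x hx => by
    simpa using df_mem hx

/-- The smooth spinor with components `a` and `c`. -/
def smoothSpinor : Sec q 1 × Sec q (-1) →ₗ[ℂ] Spinor q where
  toFun x := WithLp.toLp 2 ((x.1 : L2 q 1), (x.2 : L2 q (-1)))
  map_add' x y := by
    rw [← WithLp.toLp_add]; simp [UniformSpace.Completion.coe_add]
  map_smul' r x := by
    rw [RingHom.id_apply, ← WithLp.toLp_smul]; simp [UniformSpace.Completion.coe_smul]

variable (q) in
/-- The matrix `[[0, ∂_e], [∂_f, 0]]` on polynomial spinors. -/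
def diracAlg : Sec q 1 × Sec q (-1) →ₗ[ℂ] Sec q 1 × Sec q (-1) :=
  (deSec q ∘ₗ LinearMap.snd ℂ _ _).prod (dfSec q ∘ₗ LinearMap.fst ℂ _ _)

variable (q) in
/-- The closure of the graph
`{((a, c), (∂_e c, ∂_f a)) | a ∈ Sec q 1, c ∈ Sec q (-1)}` of the operator `[[0, ∂_e], [∂_f, 0]]` on polynomial spinors. -/
def diracGraph : Submodule ℂ (Spinor q × Spinor q) :=
  (LinearMap.range (smoothSpinor.prod (smoothSpinor ∘ₗ diracAlg q))).topologicalClosure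

variable (q) in
/-- The Dirac operator `D = [[0, ∂_e], [∂_f, 0]]`, as a closed unbounded operator on spinors. -/
def dirac : Spinor q →ₗ.[ℂ] Spinor q := (diracGraph q).toLinearPMap

/-! #### The Dirac operator is well defined -/

lemma haar_df (a : Pol q) : haar q (df q a) = 0 := by
  have e : ∀ x : Pol q ⊗[ℂ] Pol q, haar q (slice q (fFun q) x) =
      fFun q (TensorProduct.lid ℂ (Pol q) ((haar q).rTensor (Pol q) x)) := by
    intro x
    induction x with
    | zero => simp
    | add x y hx hy => simp only [map_add, hx, hy]
    | tmul x y => simp [mul_comm]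
  have h : haar q (df q a) = fFun q (rightOp q (haar q) a) := e (comul q a)
  rw [h, haar_spec.right_inv, map_smul]
  simp [fFun]

lemma conj_sq : starRingEnd ℂ q.sq = q.sq := Complex.conj_ofReal _

lemma star_dk (a : Pol q) : star (dk q a) = dkinv q (star a) := by
  induction a using Pol.induction with
  | hc r => simp [Algebra.algebraMap_eq_smul_one, dk_one, dkinv_one]
  | hg g => cases g <;> simp [dk_gen, star_gen, dkinv_gen, vals, conj_sq]
  | hm a b ha hb => simp [dk_mul, dkinv_mul, ha, hb]
  | ha a b ha hb => simp [ha, hb]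

lemma star_dkinv (a : Pol q) : star (dkinv q a) = dk q (star a) := by
  induction a using Pol.induction with
  | hc r => simp [Algebra.algebraMap_eq_smul_one, dk_one, dkinv_one]
  | hg g => cases g <;> simp [dk_gen, star_gen, dkinv_gen, vals, conj_sq]
  | hm a b ha hb => simp [dk_mul, dkinv_mul, ha, hb]
  | ha a b ha hb => simp [ha, hb]

lemma star_de (a : Pol q) : star (de q a) = -q.c⁻¹ • df q (star a) := by
  have hc := q.c_ne
  induction a using Pol.induction with
  | hc r => simp [Algebra.algebraMap_eq_smul_one, de_one, df_one]
  | hg g => cases g <;> simp [de_gen, df_gen, star_gen, vals, smul_smul, hc, conj_c]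
  | hm a b ha hb =>
    rw [de_mul, star_add, star_mul, star_mul, ha, hb, star_dk, star_dkinv, star_mul, df_mul,
      smul_add, mul_smul_comm, smul_mul_assoc, add_comm]
  | ha a b ha hb => simp only [map_add, star_add, ha, hb, smul_add]

lemma inner_deSec (c : Sec q (-1)) (a : Sec q 1) :
    inner ℂ (deSec q c) a = inner ℂ c (dfSec q a) := by
  have hs := q.sq_ne
  have hc : dkinv q c.val = q.sq • c.val := by
    have h : dk q c.val = q.sq ^ (-1 : ℤ) • c.val := c.2
    have h2 := congrArg (dkinv q) h
    rw [dkinv_dk, map_smul, zpow_neg_one] at h2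
    rw [h2, smul_smul, mul_inv_cancel₀ hs, one_smul, ← h2]
  have ha : dkinv q a.val = q.sq⁻¹ • a.val := by
    have h : dk q a.val = q.sq ^ (1 : ℤ) • a.val := a.2
    have h2 := congrArg (dkinv q) h
    rw [dkinv_dk, map_smul, zpow_one] at h2
    rw [h2, smul_smul, inv_mul_cancel₀ hs, one_smul, ← h2]
  have hk : dk q (star c.val) = q.sq • star c.val := by
    rw [← star_dkinv, hc, star_smul, Complex.star_def, conj_sq]
  have h := haar_df (star c.val * a.val)
  rw [df_mul, ha, hk, mul_smul_comm, smul_mul_assoc, map_add, map_smul, map_smul, smul_eq_mul,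
    smul_eq_mul] at h
  rw [Sec.inner_def, Sec.inner_def]
  change haar q (star (de q c.val) * a.val) = haar q (star c.val * df q a.val)
  rw [star_de, smul_mul_assoc, map_smul, smul_eq_mul, ← q.sq_mul]
  field_simp at h ⊢
  linear_combination -h

lemma inner_dfSec (a : Sec q 1) (c : Sec q (-1)) :
    inner ℂ (dfSec q a) c = inner ℂ a (deSec q c) := by
  rw [← inner_conj_symm, ← inner_deSec, inner_conj_symm]

lemma denseRange_smoothSpinor : DenseRange (smoothSpinor (q := q)) := by
  have h1 : DenseRange (Prod.map ((↑) : Sec q 1 → L2 q 1) ((↑) : Sec q (-1) → L2 q (-1))) :=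
    (UniformSpace.Completion.denseRange_coe).prodMap UniformSpace.Completion.denseRange_coe
  exact ((WithLp.prodContinuousLinearEquiv 2 ℂ (L2 q 1) (L2 q (-1))).symm.surjective.denseRange).comp
    h1 (WithLp.prodContinuousLinearEquiv 2 ℂ (L2 q 1) (L2 q (-1))).symm.continuous

lemma diracGraph_symm (x : Sec q 1 × Sec q (-1)) {p : Spinor q × Spinor q} (hp : p ∈ diracGraph q) :
    inner ℂ p.2 (smoothSpinor x) = inner ℂ p.1 (smoothSpinor (diracAlg q x)) := by
  have hcl : IsClosed {p : Spinor q × Spinor q |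
      inner ℂ p.2 (smoothSpinor x) = inner ℂ p.1 (smoothSpinor (diracAlg q x))} :=
    isClosed_eq (by fun_prop) (by fun_prop)
  refine closure_minimal ?_ hcl hp
  rintro _ ⟨y, rfl⟩
  simp [smoothSpinor, diracAlg, WithLp.prod_inner_apply, UniformSpace.Completion.inner_coe,
    inner_deSec, inner_dfSec, add_comm]

lemma diracGraph_single {p : Spinor q × Spinor q} (hp : p ∈ diracGraph q) (h : p.1 = 0) :
    p.2 = 0 := by
  refine denseRange_smoothSpinor.induction_on (p := fun v => inner ℂ p.2 v = 0) p.2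
    (isClosed_eq (by fun_prop) continuous_const) (fun x => ?_) |> inner_self_eq_zero.1
  rw [diracGraph_symm x hp, h, inner_zero_left]

/-- The graph of `D` is the closed graph by which it was defined. -/
theorem graph_dirac : (dirac q).graph = diracGraph q :=
  Submodule.toLinearPMap_graph_eq _ fun _ hp h => diracGraph_single hp h

/-! ### Complex powers -/

/-- The eigenspace of an unbounded operator for a real eigenvalue. -/
def eigenspace {E : Type*} [AddCommGroup E] [Module ℂ E] (T : E →ₗ.[ℂ] E) (μ : ℝ) :
    Submodule ℂ E :=
  T.graph.comap (LinearMap.id.prod ((μ : ℂ) • LinearMap.id))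

/-- The complex power `|T|^w` of a self-adjoint operator `T` with trivial kernel whose eigenvectors
span a dense subspace (such as a self-adjoint operator with compact resolvent): if `P μ` is the
orthogonal projection onto the eigenspace for the eigenvalue `μ`, then
`|T|^w ξ = ∑_μ |μ|^w P_μ ξ`, and the domain consists of all `ξ` for which this orthogonal series
converges, that is, `∑_μ |μ|^{2 Re w} ‖P_μ ξ‖² < ∞`. -/
def absPow {E : Type*} [NormedAddCommGroup E] [InnerProductSpace ℂ E] [CompleteSpace E]
    (T : E →ₗ.[ℂ] E) (w : ℂ) : E →ₗ.[ℂ] E where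
  domain :=
    { carrier := {x | Summable fun μ : ℝ => ((|μ| : ℝ) : ℂ) ^ w •
        (eigenspace T μ).topologicalClosure.starProjection x}
      add_mem' := fun {x y} hx hy => by
        simp only [Set.mem_ofPred_eq, map_add, smul_add] at *
        exact hx.add hy
      zero_mem' := by simp
      smul_mem' := fun c x hx => by
        simp only [Set.mem_ofPred_eq, map_smul] at *
        simpa only [smul_comm _ c] using hx.const_smul c }
  toFun :=
    { toFun := fun x => ∑' μ : ℝ, ((|μ| : ℝ) : ℂ) ^ w •
        (eigenspace T μ).topologicalClosure.starProjection (x : E)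
      map_add' := fun x y => by
        simp only [Submodule.coe_add, map_add, smul_add]
        exact Summable.tsum_add x.2 y.2
      map_smul' := fun c x => by
        simp only [Submodule.coe_smul, map_smul, RingHom.id_apply]
        rw [← Summable.tsum_const_smul c x.2]
        exact tsum_congr fun μ => smul_comm _ _ _ }

end QSphere

end

noncomputable section

open scoped TensorProduct ComplexOrder
open Filter Topology

namespace QSphere

open Pol HaarExists

variable {q : Param}

/-! ### Commutation relations and lowest weight vectors -/

/-! The operator |D| is diagonalised algebraically, and every block of [D,b] is then conjugated by
|D|^{-2z} explicitly.

Spectrum. The vectors α*^i γ*^k (`mon' q i 0 k`) are killed by ∂_f and have weight -N, N = i+k. The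
commutation relation of ∂_e and ∂_f gives ∂_f ∂_e^{t+1} = [t+1][N-t] ∂_e^t on them
(`df_de_pow_low`). For N = 2n-1 and weight ±1 the eigenvalue is [n]², so D² acts as [n]². The
descendants span, since left multiplication by a generator raises N by at most one
(`gen_mul_mem_degLE`), and different n are orthogonal because ∂_e and ∂_f are mutually adjoint.
Hence the spinors decompose into spaces H_n on which |D| is [n] = `lam q n` (`isAbsDecomp_dirac`),
and complex powers can be computed there (`IsAbsDecomp.absPow_iff`).

Commutator. The Leibniz rule gives [D,b] = T₁ + T₂, where T₁ (upper right) multiplies by q^{1/2}∂_e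
b and T₂ (lower left) by q^{-1/2}∂_f b. Both move n by a bounded amount. The main estimate
`exists_inner_mulSec_le` says that T₁ is, up to O([n]^{-1}), the shift n → n-1. Indeed ∂_e∂_f(ωc) =
q² ω ∂_e∂_f c plus terms of first order in c, so the block from H_n to H_m is multiplied by [m]² -
q²[n]² to give something O([n]); unless m = n-1 that factor is at least a multiple of [n]²
(`lam_gap`). Taking adjoints, T₂ is the shift n → n+1 up to the same order.

The family. The block of |D|^{-2z} T₁ |D|^{2z} from H_n to H_m is ([m]/[n])^{-2z} times that of T₁,
and [m]/[n] = q^{n-m} up to a factor 1 + O(q^{2n}) for bounded m-n. For m = n-1 the limit is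
q^{-2z}, exactly the scalar by which χ^{2z} on the right, or χ^{-2z} on the left, acts on T₁. So
b(z) = (|D|^{-2z} db |D|^{2z} - db χ^{2z})|D| is, for each shift, the sum of two parts: errors of
relative size q^{2n}, which beat the growth [n] ~ q^{-n} and form a norm convergent analytic series;
and, for the wrong shifts, a scalar function of z times a fixed operator, bounded by the main
estimate. Linear growth comes from the mean value inequality for exponentials
(`IsOrthoDecomp.exists_shift_family`, `IsOrthoDecomp.exists_twist`). The identity is verified block
by block in `IsAbsDecomp.absPow_comp`. -/

variable (q) in
/-- The `q`-integer `[n]`, as a complex number. -/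
def qInt (n : ℤ) : ℂ := (q.c ^ n - q.c ^ (-n)) / (q.c - q.c⁻¹)

lemma c_sub_inv_ne : q.c - q.c⁻¹ ≠ 0 := by
  have h : (q : ℝ) - (q : ℝ)⁻¹ ≠ 0 := by
    have := (one_lt_inv₀ q.pos).2 q.lt_one
    have := q.lt_one
    linarith
  have h2 : (((q : ℝ) - (q : ℝ)⁻¹ : ℝ) : ℂ) ≠ 0 := by exact_mod_cast h
  simpa [Param.c] using h2

lemma sq_zpow_mul_self (n : ℤ) : q.sq ^ n * q.sq ^ n = q.c ^ n := by
  rw [← mul_zpow, q.sq_mul]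

lemma dkinv_of_mem {n : ℤ} {a : Pol q} (ha : a ∈ homog q n) : dkinv q a = q.sq ^ (-n) • a := by
  have h2 := congrArg (dkinv q) (mem_homog.1 ha)
  rw [dkinv_dk, map_smul] at h2
  rw [h2, smul_smul, ← zpow_add₀ q.sq_ne, neg_add_cancel, zpow_zero, one_smul, ← h2]

lemma dkinv_de (a : Pol q) : dkinv q (de q a) = q.c⁻¹ • de q (dkinv q a) := by
  have h := congrArg (dkinv q) (dk_de q (dkinv q a))
  rw [dk_dkinv, dkinv_dk, map_smul] at h
  rw [h, inv_smul_smul₀ q.c_ne]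

lemma dkinv_df (a : Pol q) : dkinv q (df q a) = q.c • df q (dkinv q a) := by
  have h := congrArg (dkinv q) (dk_df q (dkinv q a))
  rw [dk_dkinv, dkinv_dk, map_smul] at h
  rw [h, smul_inv_smul₀ q.c_ne]

/-- Both sides obey the same Leibniz rule, twisted by ∂_k^{-2} on the right factor and ∂_k² on the
left one, so the relation need only be checked on generators. -/
lemma df_de_sub (a : Pol q) : (q.c - q.c⁻¹) • (df q (de q a) - de q (df q a)) =
    dkinv q (dkinv q a) - dk q (dk q a) := by
  have hs := q.sq_ne
  have hc := q.c_ne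
  induction a using Pol.induction with
  | hc r =>
    simp [Algebra.algebraMap_eq_smul_one, de_one, df_one, dk_one, dkinv_one]
  | hg g =>
    cases g <;> simp only [de_gen, df_gen, dk_gen, dkinv_gen, vals, map_smul, map_zero,
      ← q.sq_mul] <;> match_scalars <;> field_simp <;> ring
  | hm a b ha hb =>
    -- The mixed terms cancel: moving ∂_k past ∂_e in one factor and ∂_k^{-1} past ∂_f in the other
    -- produces the same power of q.
    have e : df q (de q (a * b)) - de q (df q (a * b)) =
        (df q (de q a) - de q (df q a)) * dkinv q (dkinv q b) +
          dk q (dk q a) * (df q (de q b) - de q (df q b)) := by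
      simp only [de_mul, df_mul, map_add, dk_de, dk_df, dkinv_de, dkinv_df, smul_mul_assoc,
        mul_smul_comm, sub_mul, mul_sub]
      match_scalars <;> field_simp
      all_goals ring
    rw [e, smul_add, ← smul_mul_assoc, ha, ← mul_smul_comm, hb]
    simp only [dkinv_mul, dk_mul, sub_mul, mul_sub]
    abel
  | ha a b ha hb =>
    simp only [map_add]
    rw [add_sub_add_comm, smul_add, ha, hb]
    abel

lemma df_de_of_mem {n : ℤ} {a : Pol q} (ha : a ∈ homog q n) :
    df q (de q a) = de q (df q a) - qInt q n • a := by
  have h := df_de_sub a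
  rw [dkinv_of_mem ha, mem_homog.1 ha, map_smul, map_smul, dkinv_of_mem ha, mem_homog.1 ha,
    smul_smul, smul_smul, sq_zpow_mul_self, sq_zpow_mul_self, ← sub_smul] at h
  have h2 := congrArg (fun x => (q.c - q.c⁻¹)⁻¹ • x) h
  simp only [inv_smul_smul₀ c_sub_inv_ne, smul_smul] at h2
  rw [sub_eq_iff_eq_add] at h2
  rw [h2, qInt, div_eq_inv_mul]
  module

lemma qInt_zero : qInt q 0 = 0 := by simp [qInt]

lemma df_als_pow (i : ℕ) : df q (gen q .als ^ i) = 0 := by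
  induction i with
  | zero => simp [df_one]
  | succ i ih => rw [pow_succ, df_mul, ih, df_gen]; simp [vals]

lemma df_gas_pow (i : ℕ) : df q (gen q .gas ^ i) = 0 := by
  induction i with
  | zero => simp [df_one]
  | succ i ih => rw [pow_succ, df_mul, ih, df_gen]; simp [vals]

lemma df_low (i k : ℕ) : df q (mon' q i 0 k) = 0 := by
  simp [mon', df_mul, df_als_pow, df_gas_pow]

lemma low_mem (i k : ℕ) : mon' q i 0 k ∈ homog q (-((i + k : ℕ) : ℤ)) := by
  rw [mem_homog, dk_mon', zpow_neg, zpow_natCast]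
  simp

lemma de_pow_low_mem (t i k : ℕ) :
    (de q ^ t) (mon' q i 0 k) ∈ homog q (-((i + k : ℕ) : ℤ) + 2 * t) := by
  induction t with
  | zero => simpa using low_mem i k
  | succ t ih =>
    rw [pow_succ', Module.End.mul_apply]
    convert de_mem ih using 1
    push_cast
    ring_nf

/-- The recursion for the eigenvalues of ∂_f∂_e along the chain of a lowest weight vector of weight
-N: each step subtracts the q-integer of the current weight -N+2t. -/
lemma qInt_rec (t N : ℤ) : qInt q (t + 1) * qInt q (N - t) =
    qInt q t * qInt q (N - t + 1) - qInt q (-N + 2 * t) := by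
  have hc := q.c_ne
  have h := c_sub_inv_ne (q := q)
  have e1 : q.c ^ (2 * t) = q.c ^ t * q.c ^ t := by rw [two_mul, zpow_add₀ hc]
  simp only [qInt, neg_add, neg_sub, neg_neg, zpow_add₀ hc, zpow_sub₀ hc, zpow_one, zpow_neg, e1]
  have h1 := zpow_ne_zero t hc
  have h2 := zpow_ne_zero N hc
  have h3 : q.c ^ 2 - 1 ≠ 0 := by
    intro h0; apply h; field_simp; rw [h0, mul_zero]
  field_simp
  ring

lemma df_de_pow_low (t i k : ℕ) : df q ((de q ^ (t + 1)) (mon' q i 0 k)) =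
    (qInt q (t + 1) * qInt q ((i + k : ℕ) - t)) • (de q ^ t) (mon' q i 0 k) := by
  induction t with
  | zero =>
    have h := df_de_of_mem (low_mem (q := q) i k)
    rw [df_low, map_zero, zero_sub, ← neg_smul] at h
    have e := qInt_rec (q := q) 0 ((i + k : ℕ) : ℤ)
    rw [qInt_zero, zero_mul, zero_sub, mul_zero, add_zero] at e
    rw [zero_add, pow_one, pow_zero, Module.End.one_apply, Nat.cast_zero, h, e]
  | succ t ih =>
    rw [pow_succ', Module.End.mul_apply, df_de_of_mem (de_pow_low_mem _ _ _), ih, map_smul,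
      ← Module.End.mul_apply, ← pow_succ', ← sub_smul]
    have e := qInt_rec (q := q) (t + 1 : ℕ) ((i + k : ℕ) : ℤ)
    rw [e]
    congr 3
    push_cast; ring_nf

/-! ### The degree filtration -/

variable (q) in
/-- The span of the `e`-descendants of the lowest weight vectors of degree at most `N`. -/
def degLE (N : ℕ) : Submodule ℂ (Pol q) :=
  Submodule.span ℂ {x | ∃ t i k : ℕ, i + k ≤ N ∧ x = (de q ^ t) (mon' q i 0 k)}

lemma de_pow_low_mem_degLE {N i k : ℕ} (h : i + k ≤ N) (t : ℕ) :
    (de q ^ t) (mon' q i 0 k) ∈ degLE q N :=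
  Submodule.subset_span ⟨t, i, k, h, rfl⟩

lemma low_mem_degLE {N i k : ℕ} (h : i + k ≤ N) : mon' q i 0 k ∈ degLE q N :=
  de_pow_low_mem_degLE h 0

lemma degLE_mono {M N : ℕ} (h : M ≤ N) : degLE q M ≤ degLE q N :=
  Submodule.span_mono fun _ ⟨t, i, k, hik, hx⟩ => ⟨t, i, k, hik.trans h, hx⟩

lemma de_mem_degLE {N : ℕ} {x : Pol q} (hx : x ∈ degLE q N) : de q x ∈ degLE q N := by
  induction hx using Submodule.span_induction with
  | zero => simp
  | add x y _ _ h1 h2 => rw [map_add]; exact add_mem h1 h2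
  | smul r x _ h1 => rw [map_smul]; exact Submodule.smul_mem _ r h1
  | mem x hx =>
    obtain ⟨t, i, k, h, rfl⟩ := hx
    rw [← Module.End.mul_apply, ← pow_succ']
    exact de_pow_low_mem_degLE h _

/-- Up to a lowest weight vector of smaller degree and a nonzero scalar, α*^i γ γ*^k is ∂_e(α*^{i+1}
γ*^k). For k > 0 the scalar is P + Q, nonzero because P and Q are positive. -/
lemma mon'_one_mem_degLE {N i k : ℕ} (h : i + k + 1 ≤ N) : mon' q i 1 k ∈ degLE q N := by
  rcases k with _ | k
  · obtain ⟨r, hr, e⟩ := de_mon'_zero (q := q) i 0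
    have h1 := (degLE q N).smul_mem r⁻¹
      (de_mem_degLE (low_mem_degLE (q := q) (i := i + 1) (k := 0) (by omega)))
    rwa [e, inv_smul_smul₀ hr, zero_add] at h1
  · obtain ⟨P, Q, hP, hQ, e, -⟩ := de_mon'_succ (q := q) i 0 k
    have hne : ((P + Q : ℝ) : ℂ) ≠ 0 := by exact_mod_cast (add_pos hP hQ).ne'
    have h1 := (degLE q N).smul_mem ((P + Q : ℝ) : ℂ)⁻¹ ((degLE q N).add_mem
      (de_mem_degLE (low_mem_degLE (q := q) (i := i + 1) (k := k + 1) (by omega)))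
      ((degLE q N).smul_mem (Q : ℂ) (low_mem_degLE (q := q) (i := i) (k := k) (by omega))))
    have e2 : de q (mon' q (i + 1) 0 (k + 1)) + (Q : ℂ) • mon' q i 0 k =
        ((P + Q : ℝ) : ℂ) • mon' q i 1 (k + 1) := by
      rw [e, zero_add]; push_cast; module
    rwa [e2, inv_smul_smul₀ hne] at h1

lemma gen_mul_low_mem (g : Gen) {N i k : ℕ} (h : i + k ≤ N) :
    gen q g * mon' q i 0 k ∈ degLE q (N + 1) := by
  cases g
  · rcases i with _ | i
    · obtain ⟨r, hr, e⟩ := de_mon_succ (q := q) 0 0 k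
      have h1 := (degLE q (N + 1)).smul_mem r⁻¹
        (de_mem_degLE (low_mem_degLE (q := q) (i := 0) (k := k + 1) (by omega)))
      rw [← mon_zero, al_mon]
      rwa [← mon_zero, e, inv_smul_smul₀ hr] at h1
    · rw [al_mon'_succ]
      exact sub_mem (low_mem_degLE (by omega))
        (Submodule.smul_mem _ _ (mon'_one_mem_degLE (by omega)))
  · rw [als_mon']; exact low_mem_degLE (by omega)
  · rw [ga_mon']; exact Submodule.smul_mem _ _ (mon'_one_mem_degLE (by omega))
  · rw [gas_mon']; exact Submodule.smul_mem _ _ (low_mem_degLE (by omega))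

/-- Since g is an eigenvector of ∂_k, the Leibniz rule solves for g·∂_e x in terms of ∂_e(g x) and
(∂_e g) x. As ∂_e g is zero or a multiple of another generator, the induction must run over all
generators at once. -/
lemma gen_mul_de_pow_low_mem (t : ℕ) : ∀ (g : Gen) {N i k : ℕ}, i + k ≤ N →
    gen q g * (de q ^ t) (mon' q i 0 k) ∈ degLE q (N + 1) := by
  have hs := q.sq_ne
  induction t with
  | zero => exact fun g N i k h => gen_mul_low_mem g h
  | succ t ih =>
    intro g N i k h
    obtain ⟨c, hc, hk⟩ : ∃ c : ℂ, c ≠ 0 ∧ dk q (gen q g) = c • gen q g := by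
      cases g <;> rw [dk_gen] <;> refine ⟨_, ?_, rfl⟩ <;> simp [hs]
    have he : de q (gen q g) * (de q ^ t) (mon' q i 0 k) ∈ degLE q (N + 1) := by
      cases g <;> simp only [de_gen, vals, zero_mul, zero_mem, smul_mul_assoc]
      · exact ih .ga h
      · exact Submodule.smul_mem _ _ (ih .al h)
    have e := de_mul q (gen q g) ((de q ^ t) (mon' q i 0 k))
    rw [dkinv_of_mem (de_pow_low_mem t i k), hk, mul_smul_comm, smul_mul_assoc,
      ← Module.End.mul_apply (de q), ← pow_succ'] at e
    have h1 := (degLE q (N + 1)).smul_mem c⁻¹ (sub_mem (de_mem_degLE (ih g h))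
      (Submodule.smul_mem _ (q.sq ^ (-(-((i + k : ℕ) : ℤ) + 2 * (t : ℤ)))) he))
    rwa [e, add_sub_cancel_left, inv_smul_smul₀ hc] at h1

lemma gen_mul_mem_degLE (g : Gen) {N : ℕ} {x : Pol q} (hx : x ∈ degLE q N) :
    gen q g * x ∈ degLE q (N + 1) := by
  induction hx using Submodule.span_induction with
  | zero => simp
  | add x y _ _ h1 h2 => rw [mul_add]; exact add_mem h1 h2
  | smul r x _ h1 => rw [mul_smul_comm]; exact Submodule.smul_mem _ r h1
  | mem x hx =>
    obtain ⟨t, i, k, h, rfl⟩ := hx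
    exact gen_mul_de_pow_low_mem t g h

/-- Left multiplication by a fixed element raises the degree by a bounded amount. -/
lemma exists_mul_mem_degLE (a : Pol q) :
    ∃ J : ℕ, ∀ (N : ℕ) (x : Pol q), x ∈ degLE q N → a * x ∈ degLE q (N + J) := by
  induction a using Pol.induction with
  | hc r => exact ⟨0, fun N x hx => by rw [← Algebra.smul_def]; exact Submodule.smul_mem _ r hx⟩
  | hg g => exact ⟨1, fun N x hx => gen_mul_mem_degLE g hx⟩
  | hm a b ha hb =>
    obtain ⟨J, hJ⟩ := ha
    obtain ⟨J', hJ'⟩ := hb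
    exact ⟨J' + J, fun N x hx => by
      rw [mul_assoc, ← add_assoc]; exact hJ _ _ (hJ' _ _ hx)⟩
  | ha a b ha hb =>
    obtain ⟨J, hJ⟩ := ha
    obtain ⟨J', hJ'⟩ := hb
    exact ⟨max J J', fun N x hx => by
      rw [add_mul]
      exact add_mem (degLE_mono (by omega) (hJ _ _ hx)) (degLE_mono (by omega) (hJ' _ _ hx))⟩

lemma exists_mem_degLE (a : Pol q) : ∃ N : ℕ, a ∈ degLE q N := by
  obtain ⟨J, hJ⟩ := exists_mul_mem_degLE a
  have h1 : (1 : Pol q) ∈ degLE q 0 := by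
    simpa [mon'] using low_mem_degLE (q := q) (N := 0) (i := 0) (k := 0) le_rfl
  exact ⟨0 + J, by simpa using hJ 0 1 h1⟩

/-! ### Homogeneous components -/

/-- Write a = s + t with s in S i and t in the sum of the other S j. Then t lies both in E i and in
the sum of the other E j, hence vanishes. -/
lemma mem_of_mem_iSup_of_iSupIndep {ι R M : Type*} [Ring R] [AddCommGroup M] [Module R M]
    {E S : ι → Submodule R M} (hE : iSupIndep E) (hS : ∀ i, S i ≤ E i) {i : ι} {a : M}
    (ha : a ∈ E i) (h : a ∈ ⨆ j, S j) : a ∈ S i := by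
  rw [iSup_split_single _ i, Submodule.mem_sup] at h
  obtain ⟨s, hs, t, ht, rfl⟩ := h
  have h1 : t ∈ E i := by
    have := (E i).sub_mem ha (hS i hs)
    rwa [add_sub_cancel_left] at this
  have h2 : t ∈ ⨆ (j) (_ : j ≠ i), E j := iSup₂_mono (fun j _ => hS j) ht
  have h3 : t = 0 := (Submodule.disjoint_def.1 (hE i)) t h1 h2
  rwa [h3, add_zero]

lemma iSupIndep_homog : iSupIndep (homog q) := by
  have h := (Module.End.eigenspaces_iSupIndep (dk q)).comp (f := fun n : ℤ => q.sq ^ n) (by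
    intro m n h
    have h2 : s q ^ m = s q ^ n := by
      have h3 : ((s q ^ m : ℝ) : ℂ) = ((s q ^ n : ℝ) : ℂ) := by
        push_cast; exact h
      exact_mod_cast h3
    exact (zpow_right_strictAnti₀ s_pos s_lt).injective h2)
  convert h using 1
  funext n
  ext x
  rw [Function.comp_apply, Module.End.mem_eigenspace_iff]
  rfl

/-- Homogeneous elements are combinations of homogeneous descendants. -/
lemma mem_span_of_mem_degLE {N : ℕ} {r : ℤ} {a : Pol q} (ha : a ∈ degLE q N)
    (hr : a ∈ homog q r) : a ∈ Submodule.span ℂ {x : Pol q | ∃ t i k : ℕ, i + k ≤ N ∧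
      -((i + k : ℕ) : ℤ) + 2 * t = r ∧ x = (de q ^ t) (mon' q i 0 k)} := by
  refine mem_of_mem_iSup_of_iSupIndep (S := fun r : ℤ => Submodule.span ℂ {x : Pol q |
    ∃ t i k : ℕ, i + k ≤ N ∧ -((i + k : ℕ) : ℤ) + 2 * t = r ∧ x = (de q ^ t) (mon' q i 0 k)})
    iSupIndep_homog (fun r => Submodule.span_le.2 ?_) hr
    ((Submodule.span_le.2 ?_ : degLE q N ≤ _) ha)
  · rintro _ ⟨t, i, k, -, rfl, rfl⟩
    exact de_pow_low_mem t i k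
  · rintro _ ⟨t, i, k, h, rfl⟩
    exact Submodule.mem_iSup_of_mem (-((i + k : ℕ) : ℤ) + 2 * t)
      (Submodule.subset_span ⟨t, i, k, h, rfl, rfl⟩)

/-! ### Orthogonal decompositions of Hilbert spaces -/

section Orthogonal

variable {ι K : Type*} [NormedAddCommGroup K] [InnerProductSpace ℂ K]

/-- A mutually orthogonal family of subspaces spanning a dense subspace, the latter formulated
as: no nonzero vector is orthogonal to all of them. -/
structure IsOrthoDecomp (H : ι → Submodule ℂ K) : Prop where
  ortho : ∀ i j, i ≠ j → ∀ x ∈ H i, ∀ y ∈ H j, inner ℂ x y = 0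
  total : ∀ x, (∀ i, ∀ v ∈ H i, inner ℂ v x = 0) → x = 0

lemma inner_starProjection_of_mem {U : Submodule ℂ K} [U.HasOrthogonalProjection] {v : K}
    (hv : v ∈ U) (x : K) : inner ℂ v (U.starProjection x) = inner ℂ v x := by
  rw [← Submodule.inner_starProjection_left_eq_right, Submodule.starProjection_eq_self_iff.2 hv]

lemma starProjection_eq_zero_iff' {U : Submodule ℂ K} [U.HasOrthogonalProjection] {x : K} :
    U.starProjection x = 0 ↔ ∀ v ∈ U, inner ℂ v x = 0 := by
  rw [Submodule.starProjection_apply_eq_zero_iff, Submodule.mem_orthogonal]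

namespace IsOrthoDecomp

variable {H : ι → Submodule ℂ K} [∀ i, (H i).HasOrthogonalProjection]

lemma starProjection_of_mem_ne (hH : IsOrthoDecomp H) {i j : ι} (hij : i ≠ j) {x : K} (hx : x ∈ H j) :
    (H i).starProjection x = 0 :=
  starProjection_eq_zero_iff'.2 fun v hv => hH.ortho i j hij v hv x hx

lemma ext_proj (hH : IsOrthoDecomp H) {x y : K} (h : ∀ i, (H i).starProjection x = (H i).starProjection y) : x = y := by
  rw [← sub_eq_zero]
  refine hH.total _ fun i v hv => ?_
  rw [← inner_starProjection_of_mem hv, map_sub, h, sub_self, inner_zero_right]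

/-- Bessel's inequality: a finite sum y of projections satisfies ⟨y, x⟩ = ‖y‖² = Σ‖P_i x‖², and
Cauchy–Schwarz bounds this by ‖x‖². -/
lemma summable_sq (hH : IsOrthoDecomp H) (x : K) : Summable fun i => ‖(H i).starProjection x‖ ^ 2 := by
  refine summable_of_sum_le (c := ‖x‖ ^ 2) (fun i => sq_nonneg _) fun s => ?_
  have h1 : inner ℂ (∑ i ∈ s, (H i).starProjection x) x =
      ∑ i ∈ s, ((‖(H i).starProjection x‖ ^ 2 : ℝ) : ℂ) := by
    rw [sum_inner]
    refine Finset.sum_congr rfl fun i _ => ?_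
    rw [← inner_starProjection_of_mem (Submodule.starProjection_apply_mem _ x),
      inner_self_eq_norm_sq_to_K]
    simp
  have h2 : inner ℂ (∑ i ∈ s, (H i).starProjection x) (∑ i ∈ s, (H i).starProjection x) =
      ∑ i ∈ s, ((‖(H i).starProjection x‖ ^ 2 : ℝ) : ℂ) := by
    rw [sum_inner]
    refine Finset.sum_congr rfl fun i hi => ?_
    rw [inner_sum, Finset.sum_eq_single i, inner_self_eq_norm_sq_to_K]
    · simp
    · exact fun j _ hj => hH.ortho i j hj.symm _ (Submodule.starProjection_apply_mem _ x) _
        (Submodule.starProjection_apply_mem _ x)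
    · exact fun h => absurd hi h
  set y := ∑ i ∈ s, (H i).starProjection x
  set S := ∑ i ∈ s, ‖(H i).starProjection x‖ ^ 2 with hS
  rw [← Complex.ofReal_sum, ← hS] at h1 h2
  have h3 : ‖y‖ ^ 2 = S := by
    rw [inner_self_eq_norm_sq_to_K] at h2
    exact Complex.ofReal_injective (by push_cast; exact h2)
  have h4 : S ≤ ‖y‖ * ‖x‖ := by
    have := norm_inner_le_norm (𝕜 := ℂ) y x
    rw [h1, Complex.norm_real, Real.norm_eq_abs] at this
    exact (le_abs_self _).trans this
  nlinarith [sq_nonneg (‖x‖ - ‖y‖), norm_nonneg x, norm_nonneg y]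

end IsOrthoDecomp

variable [CompleteSpace K]

lemma summable_iff_norm_sq_of_orthogonal {f : ι → K}
    (h : ∀ i j, i ≠ j → inner ℂ (f i) (f j) = 0) :
    Summable f ↔ Summable fun i => ‖f i‖ ^ 2 := by
  have hO : OrthogonalFamily ℂ (fun i => Submodule.span ℂ {f i})
      fun i => (Submodule.span ℂ {f i}).subtypeₗᵢ := by
    refine OrthogonalFamily.of_pairwise fun i j hij => ?_
    rw [Function.onFun, Submodule.isOrtho_span]
    simpa using h i j hij
  exact hO.summable_iff_norm_sq_summable fun i => ⟨f i, Submodule.mem_span_singleton_self _⟩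

namespace IsOrthoDecomp

variable {H : ι → Submodule ℂ K} [∀ i, (H i).HasOrthogonalProjection]

/-- The orthogonal series converges by Bessel, and its sum differs from x by a vector orthogonal to
every H i. -/
lemma hasSum (hH : IsOrthoDecomp H) (x : K) : HasSum (fun i => (H i).starProjection x) x := by
  have hs : Summable fun i => (H i).starProjection x :=
    (summable_iff_norm_sq_of_orthogonal fun i j hij => hH.ortho i j hij _
      (Submodule.starProjection_apply_mem _ x) _ (Submodule.starProjection_apply_mem _ x)).2
      (hH.summable_sq x)
  have h : ∑' i, (H i).starProjection x - x = 0 := by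
    refine hH.total _ fun i v hv => ?_
    have h1 := (innerSL ℂ v).hasSum hs.hasSum
    have h2 : HasSum (fun j => innerSL ℂ v ((H j).starProjection x)) (inner ℂ v x) := by
      convert hasSum_single i (fun j hj => ?_) using 1
      · exact (inner_starProjection_of_mem hv x).symm
      · exact hH.ortho i j hj.symm v hv _ (Submodule.starProjection_apply_mem _ x)
    rw [inner_sub_right, sub_eq_zero]
    exact h1.unique h2
  rw [sub_eq_zero] at h
  simpa only [h] using hs.hasSum

/-- Strong convergence of series of operators with orthogonal sources and ranges. -/
lemma exists_strong_sum (hH : IsOrthoDecomp H) [Countable ι] {X : ι → K →L[ℂ] K} {M : ℝ}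
    (hX : ∀ i j, i ≠ j → ∀ x y, inner ℂ (X i x) (X j y) = 0)
    (hM : ∀ i x, ‖X i x‖ ≤ M * ‖(H i).starProjection x‖) :
    ∃ S : K →L[ℂ] K, ∀ i x, S ((H i).starProjection x) = X i x := by
  have hs : ∀ x, Summable fun i => X i x := fun x => by
    rw [summable_iff_norm_sq_of_orthogonal fun i j hij => hX i j hij x x]
    refine Summable.of_nonneg_of_le (fun i => sq_nonneg _) (fun i => ?_)
      ((hH.summable_sq x).mul_left (M ^ 2))
    rw [← mul_pow]
    exact pow_le_pow_left₀ (norm_nonneg _) (hM i x) 2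
  -- Only pointwise convergence is available; boundedness of the limit is Banach–Steinhaus, through
  -- `continuousLinearMapOfTendsto`.
  have ht : Tendsto (fun (s : Finset ι) x => (∑ i ∈ s, X i) x) atTop
      (𝓝 fun x => ∑' i, X i x) := by
    rw [tendsto_pi_nhds]
    intro x
    have := (hs x).hasSum
    simpa [HasSum] using this
  refine ⟨continuousLinearMapOfTendsto _ ht, fun i x => ?_⟩
  change ∑' j, X j ((H i).starProjection x) = X i x
  have hP := Submodule.starProjection_apply_mem (H i) x
  rw [tsum_eq_single i]
  -- The bound `hM` forces X i to factor through the projection onto H i.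
  · have h1 := hM i (x - (H i).starProjection x)
    rw [map_sub, map_sub, Submodule.starProjection_eq_self_iff.2 hP, sub_self, norm_zero,
      mul_zero] at h1
    exact (sub_eq_zero.1 (norm_le_zero_iff.1 h1)).symm
  · intro j hj
    have h1 := hM j ((H i).starProjection x)
    rw [hH.starProjection_of_mem_ne hj hP, norm_zero, mul_zero] at h1
    exact norm_le_zero_iff.1 h1

end IsOrthoDecomp

end Orthogonal

/-! ### Analytic families of operators shifting the components of a decomposition -/

/-- Mean value inequality in the real exponent: the derivative z·exp(zu) has norm at most ‖z‖e^{RB}.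
The factor ‖z‖ is the source of linear growth on strips, and |a - b| carries the decay. -/
lemma norm_cexp_sub_le {z : ℂ} {a b B R : ℝ} (ha : |a| ≤ B) (hb : |b| ≤ B) (hz : |z.re| ≤ R) :
    ‖Complex.exp (z * a) - Complex.exp (z * b)‖ ≤ ‖z‖ * Real.exp (R * B) * |a - b| := by
  have hd : ∀ u ∈ Set.Icc (-B) B, HasDerivWithinAt (fun u : ℝ => Complex.exp (z * u))
      (Complex.exp (z * u) * z) (Set.Icc (-B) B) u := by
    intro u _
    have h1 : HasDerivAt (fun u : ℝ => z * (u : ℂ)) z u := by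
      simpa using (Complex.ofRealCLM.hasDerivAt (x := u)).const_mul z
    exact h1.cexp.hasDerivWithinAt
  have hn : ∀ u ∈ Set.Icc (-B) B, ‖Complex.exp (z * (u : ℝ)) * z‖ ≤ ‖z‖ * Real.exp (R * B) := by
    intro u hu
    rw [norm_mul, mul_comm, Complex.norm_exp, Complex.re_mul_ofReal]
    refine mul_le_mul_of_nonneg_left (Real.exp_le_exp.2 ?_) (norm_nonneg _)
    calc z.re * u ≤ |z.re * u| := le_abs_self _
      _ = |z.re| * |u| := abs_mul _ _
      _ ≤ R * B := mul_le_mul hz (abs_le.2 hu) (abs_nonneg _) ((abs_nonneg _).trans hz)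
  have := (convex_Icc (-B) B).norm_image_sub_le_of_norm_hasDerivWithin_le hd hn
    (abs_le.1 hb) (abs_le.1 ha)
  simpa using this

section Family

variable {K : Type*} [NormedAddCommGroup K] [InnerProductSpace ℂ K]

/-- The property of having at most linear growth on vertical strips. -/
def LinearGrowth (b : ℂ → K →L[ℂ] K) : Prop :=
  ∀ x y : ℝ, ∃ C : ℝ, 0 < C ∧ ∀ z : ℂ, z.re ∈ Set.Icc x y → ‖b z‖ ≤ C * ‖z‖

lemma LinearGrowth.add {b c : ℂ → K →L[ℂ] K} (hb : LinearGrowth b) (hc : LinearGrowth c) :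
    LinearGrowth (fun z => b z + c z) := by
  intro x y
  obtain ⟨C, hC, h⟩ := hb x y
  obtain ⟨C', hC', h'⟩ := hc x y
  refine ⟨C + C', add_pos hC hC', fun z hz => ?_⟩
  rw [add_mul]
  exact (norm_add_le _ _).trans (add_le_add (h z hz) (h' z hz))

lemma LinearGrowth.sum {ι : Type*} {b : ι → ℂ → K →L[ℂ] K} (s : Finset ι)
    (hb : ∀ i ∈ s, LinearGrowth (b i)) : LinearGrowth (fun z => ∑ i ∈ s, b i z) := by
  classical
  induction s using Finset.induction_on with
  | empty => exact fun x y => ⟨1, one_pos, fun z _ => by simp⟩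
  | insert i s hi ih =>
    simp only [Finset.sum_insert hi]
    exact (hb i (Finset.mem_insert_self _ _)).add
      (ih fun j hj => hb j (Finset.mem_insert_of_mem hj))

lemma LinearGrowth.of_abs_le {b : ℂ → K →L[ℂ] K}
    (h : ∀ R : ℝ, ∃ C : ℝ, ∀ z : ℂ, |z.re| ≤ R → ‖b z‖ ≤ C * ‖z‖) : LinearGrowth b := by
  intro x y
  obtain ⟨C, hC⟩ := h (max |x| |y|)
  refine ⟨max C 1, lt_max_of_lt_right one_pos, fun z hz => (hC z ?_).trans
    (mul_le_mul_of_nonneg_right (le_max_left _ _) (norm_nonneg _))⟩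
  exact abs_le_max_abs_abs hz.1 hz.2

variable [CompleteSpace K] {H : ℕ → Submodule ℂ K} [∀ i, (H i).HasOrthogonalProjection]

/-- An analytic family given by a single shift. -/
lemma IsOrthoDecomp.exists_shift_family (hH : IsOrthoDecomp H) {Y : ℕ → K →L[ℂ] K}
    (hY : ∀ i j, i ≠ j → ∀ x y, inner ℂ (Y i x) (Y j y) = 0)
    (hYP : ∀ i j x, i ≠ j → Y i ((H j).starProjection x) = 0)
    {M : ℝ} (hM : ∀ i, ‖Y i‖ ≤ M) {lam ε : ℕ → ℝ} {a θ r C E : ℝ}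
    (hr0 : 0 ≤ r) (hr : r < 1) (hlam : ∀ n, 0 ≤ lam n)
    (hε : ∀ n, |ε n| * lam n ≤ C * r ^ n) (hE : ∀ n, |ε n| ≤ E)
    (hor : a = θ ∨ ∃ M', ∀ n x, lam n * ‖Y n x‖ ≤ M' * ‖(H n).starProjection x‖) :
    ∃ b : ℂ → K →L[ℂ] K, Differentiable ℂ b ∧ LinearGrowth b ∧ ∀ z n x,
      b z ((H n).starProjection x) = ((Complex.exp (z * (a + ε n : ℝ)) - Complex.exp (z * θ)) *
        lam n) • Y n ((H n).starProjection x) := by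
  have hM0 : 0 ≤ M := (norm_nonneg _).trans (hM 0)
  have hC0 : 0 ≤ C := by
    have := hε 0
    rw [pow_zero, mul_one] at this
    exact (mul_nonneg (abs_nonneg _) (hlam 0)).trans this
  -- Split e^{z(a+ε_n)} - e^{zθ} as (e^{z(a+ε_n)} - e^{za}) + (e^{za} - e^{zθ}). The second scalar
  -- does not depend on n, so it multiplies one fixed operator S = Σ lam_n Y_n, which exists as a
  -- strong sum; if a = θ the scalar is zero and S = 0 will do.
  obtain ⟨S, hS⟩ : ∃ S : K →L[ℂ] K, ∀ z n x, (Complex.exp (z * a) - Complex.exp (z * θ)) •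
      S ((H n).starProjection x) = ((Complex.exp (z * a) - Complex.exp (z * θ)) * lam n) •
        Y n ((H n).starProjection x) := by
    rcases hor with rfl | ⟨M', hM'⟩
    · exact ⟨0, by simp⟩
    · obtain ⟨S, hS⟩ := hH.exists_strong_sum (X := fun n => (lam n : ℂ) • Y n) (M := M')
        (fun i j hij x y => by
          rw [_root_.smul_apply, _root_.smul_apply, inner_smul_left, inner_smul_right,
            hY i j hij, mul_zero, mul_zero])
        (fun i x => by
          rw [_root_.smul_apply, norm_smul, Complex.norm_real, Real.norm_eq_abs,
            abs_of_nonneg (hlam i)]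
          exact hM' i x)
      refine ⟨S, fun z n x => ?_⟩
      have hP := Submodule.starProjection_eq_self_iff.2
        (Submodule.starProjection_apply_mem (H n) x)
      rw [← hP, hS, hP, _root_.smul_apply, smul_smul]
  -- The first part of the splitting: its terms are O(|ε_n| lam_n), hence geometrically small in
  -- operator norm.
  let F : ℕ → ℂ → K →L[ℂ] K := fun n z =>
    ((Complex.exp (z * (a + ε n : ℝ)) - Complex.exp (z * a)) * lam n) • Y n
  have hgeo : Summable fun n : ℕ => r ^ n := summable_geometric_of_lt_one hr0 hr
  have hF : ∀ (R : ℝ) (z : ℂ), |z.re| ≤ R → ∀ n,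
      ‖F n z‖ ≤ ‖z‖ * (Real.exp (R * (|a| + E)) * C * M) * r ^ n := by
    intro R z hz n
    have hE0 : 0 ≤ E := (abs_nonneg _).trans (hE 0)
    have h1 := norm_cexp_sub_le (z := z) (a := a + ε n) (b := a) (B := |a| + E) (R := R)
      ((abs_add_le _ _).trans (by gcongr; exact hE n)) (by linarith) hz
    rw [add_sub_cancel_left] at h1
    simp only [F]
    rw [norm_smul, norm_mul, Complex.norm_real, Real.norm_eq_abs, abs_of_nonneg (hlam n)]
    calc _ ≤ ‖z‖ * Real.exp (R * (|a| + E)) * |ε n| * lam n * M := by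
          have := hlam n
          gcongr
          exact hM n
      _ = ‖z‖ * Real.exp (R * (|a| + E)) * M * (|ε n| * lam n) := by ring
      _ ≤ ‖z‖ * Real.exp (R * (|a| + E)) * M * (C * r ^ n) := by
          gcongr ?_ * ?_
          exact hε n
      _ = _ := by ring
  have hFs : ∀ z, Summable fun n => F n z := fun z =>
    Summable.of_norm_bounded (hgeo.mul_left _) (hF |z.re| z le_rfl)
  have hFd : Differentiable ℂ fun z => ∑' n, F n z := by
    intro z
    -- On a ball both ‖w‖ and |Re w| are bounded, so one geometric majorant serves and the
    -- Weierstrass theorem applies.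
    have hU : IsOpen (Metric.ball (0 : ℂ) (‖z‖ + 1)) := Metric.isOpen_ball
    have hz : z ∈ Metric.ball (0 : ℂ) (‖z‖ + 1) := by simp
    refine (Complex.differentiableOn_tsum_of_summable_norm (u := fun n => (‖z‖ + 1) *
      (Real.exp ((‖z‖ + 1) * (|a| + E)) * C * M) * r ^ n) (hgeo.mul_left _) (fun n => ?_) hU
      (fun n w hw => ?_)).differentiableAt (hU.mem_nhds hz)
    · refine Differentiable.differentiableOn ?_
      simp only [F]
      fun_prop
    · have hw' : ‖w‖ < ‖z‖ + 1 := by simpa using hw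
      refine (hF (‖z‖ + 1) w ((Complex.abs_re_le_norm w).trans hw'.le) n).trans ?_
      gcongr
  refine ⟨fun z => (Complex.exp (z * a) - Complex.exp (z * θ)) • S + ∑' n, F n z, ?_, ?_, ?_⟩
  · refine Differentiable.add ?_ hFd
    fun_prop
  · refine LinearGrowth.of_abs_le fun R => ⟨Real.exp (R * max |a| |θ|) * |a - θ| * ‖S‖ +
      Real.exp (R * (|a| + E)) * C * M * ∑' n : ℕ, r ^ n, fun z hz => ?_⟩
    have h1 := norm_cexp_sub_le (z := z) (a := a) (b := θ) (B := max |a| |θ|) (R := R)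
      (le_max_left _ _) (le_max_right _ _) hz
    have h2 : ‖∑' n, F n z‖ ≤ ‖z‖ * (Real.exp (R * (|a| + E)) * C * M) * ∑' n : ℕ, r ^ n := by
      rw [← tsum_mul_left]
      exact tsum_of_norm_bounded (hgeo.mul_left _).hasSum (hF R z hz)
    calc _ ≤ ‖Complex.exp (z * a) - Complex.exp (z * θ)‖ * ‖S‖ + ‖∑' n, F n z‖ :=
          (norm_add_le _ _).trans (by rw [norm_smul])
      _ ≤ ‖z‖ * Real.exp (R * max |a| |θ|) * |a - θ| * ‖S‖ +
          ‖z‖ * (Real.exp (R * (|a| + E)) * C * M) * ∑' n : ℕ, r ^ n := by gcongr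
      _ = _ := by ring
  · intro z n x
    have h1 : (∑' k, F k z) ((H n).starProjection x) = F n z ((H n).starProjection x) := by
      have h2 := (ContinuousLinearMap.apply ℂ K ((H n).starProjection x)).hasSum (hFs z).hasSum
      refine h2.unique (hasSum_single n fun j hj => ?_)
      simp [F, hYP j n x hj]
    rw [_root_.add_apply, _root_.smul_apply, hS, h1]
    simp only [F, _root_.smul_apply]
    rw [← add_smul]
    congr 1
    push_cast
    ring

end Family

/-! ### Asymptotics of `q`-integers -/

/-- The `q`-integer `[n]`, as a real number. -/
def lam (q : Param) (n : ℕ) : ℝ := ((q : ℝ)⁻¹ ^ n - (q : ℝ) ^ n) / ((q : ℝ)⁻¹ - q)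

lemma inv_sub_pos : 0 < (q : ℝ)⁻¹ - q := by
  have := (one_lt_inv₀ q.pos).2 q.lt_one
  have := q.lt_one
  linarith

lemma pow_two_mul_lt {n : ℕ} (hn : n ≠ 0) : (q : ℝ) ^ (2 * n) < 1 :=
  pow_lt_one₀ q.pos.le q.lt_one (by omega)

lemma pow_two_mul_le {n : ℕ} (hn : n ≠ 0) : (q : ℝ) ^ (2 * n) ≤ (q : ℝ) ^ 2 :=
  pow_le_pow_of_le_one q.pos.le q.lt_one.le (by omega)

lemma lam_zero : lam q 0 = 0 := by simp [lam]

lemma lam_one : lam q 1 = 1 := by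
  rw [lam, pow_one, pow_one, div_self inv_sub_pos.ne']

lemma lam_strictMono : StrictMono (lam q) := by
  intro m n h
  refine div_lt_div_of_pos_right (sub_lt_sub ?_ ?_) inv_sub_pos
  · exact pow_lt_pow_right₀ ((one_lt_inv₀ q.pos).2 q.lt_one) h
  · exact pow_lt_pow_right_of_lt_one₀ q.pos q.lt_one h

lemma lam_nonneg (n : ℕ) : 0 ≤ lam q n := by
  rw [← lam_zero (q := q)]
  exact lam_strictMono.monotone (Nat.zero_le n)

lemma lam_pos {n : ℕ} (hn : n ≠ 0) : 0 < lam q n := by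
  rw [← lam_zero (q := q)]
  exact lam_strictMono (Nat.pos_of_ne_zero hn)

lemma one_le_lam {n : ℕ} (hn : n ≠ 0) : 1 ≤ lam q n := by
  rw [← lam_one (q := q)]
  exact lam_strictMono.monotone (Nat.one_le_iff_ne_zero.2 hn)

lemma lam_add_two_le (n : ℕ) : lam q n ≤ (q : ℝ) ^ 2 * lam q (n + 2) := by
  have hq := q.pos
  rw [lam, lam, mul_div_assoc', mul_sub]
  refine div_le_div_of_nonneg_right (sub_le_sub ?_ ?_) inv_sub_pos.le
  · rw [pow_add, inv_pow _ 2]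
    field_simp
    exact le_rfl
  · rw [← pow_add]
    exact pow_le_pow_of_le_one hq.le q.lt_one.le (by omega)

/-- Factor the difference of squares; the factor lam m + q·lam n is at least q·lam n. In the other
factor, m ≥ n gives lam m ≥ lam n, while m ≤ n-2 gives lam m ≤ q²·lam n; either way it is at least
q(1-q)·lam n in absolute value. Only m = n-1 can be resonant. -/
lemma lam_gap {m n : ℕ} (h : m + 1 ≠ n) :
    (q : ℝ) ^ 2 * (1 - q) * lam q n ^ 2 ≤ |lam q m ^ 2 - (q : ℝ) ^ 2 * lam q n ^ 2| := by
  have hq := q.pos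
  have hq1 := q.lt_one
  have hm := lam_nonneg (q := q) m
  have hn := lam_nonneg (q := q) n
  have h1 : (q : ℝ) * (1 - q) * lam q n ≤ |lam q m - q * lam q n| := by
    rcases le_or_gt n m with hmn | hmn
    · refine le_trans ?_ (le_abs_self _)
      have := lam_strictMono.monotone (α := ℕ) (f := lam q) hmn
      nlinarith [mul_nonneg (sub_nonneg.2 hq1.le) hn,
        mul_nonneg (mul_nonneg (sub_nonneg.2 hq1.le) (sub_nonneg.2 hq1.le)) hn]
    · refine le_trans ?_ (neg_le_abs _)
      obtain ⟨k, rfl⟩ := Nat.exists_eq_add_of_le (show m + 2 ≤ n by omega)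
      have h2 := lam_strictMono.monotone (α := ℕ) (f := lam q) (show m ≤ m + k by omega)
      have h3 := lam_add_two_le (q := q) (m + k)
      rw [show m + k + 2 = m + 2 + k by ring] at h3
      nlinarith
  have h2 : lam q m ^ 2 - (q : ℝ) ^ 2 * lam q n ^ 2 =
      (lam q m - q * lam q n) * (lam q m + q * lam q n) := by ring
  have h3 : 0 ≤ lam q m + q * lam q n := by positivity
  rw [h2, abs_mul, abs_of_nonneg h3]
  calc (q : ℝ) ^ 2 * (1 - q) * lam q n ^ 2 = (q * (1 - q) * lam q n) * (q * lam q n) := by ring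
    _ ≤ _ := mul_le_mul h1 (by linarith) (by positivity) (abs_nonneg _)

lemma lam_eq (n : ℕ) :
    lam q n = (q : ℝ)⁻¹ ^ n * (1 - (q : ℝ) ^ (2 * n)) / ((q : ℝ)⁻¹ - q) := by
  have h : (q : ℝ) ^ n ≠ 0 := pow_ne_zero _ q.pos.ne'
  rw [lam, two_mul, pow_add, inv_pow]
  congr 1
  field_simp

lemma log_lam {n : ℕ} (hn : n ≠ 0) : Real.log (lam q n) =
    -n * Real.log q + Real.log (1 - (q : ℝ) ^ (2 * n)) - Real.log ((q : ℝ)⁻¹ - q) := by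
  have h1 : (q : ℝ)⁻¹ ^ n ≠ 0 := pow_ne_zero _ (inv_ne_zero q.pos.ne')
  have h2 : 1 - (q : ℝ) ^ (2 * n) ≠ 0 := (sub_pos.2 (pow_two_mul_lt hn)).ne'
  rw [lam_eq, Real.log_div (mul_ne_zero h1 h2) inv_sub_pos.ne', Real.log_mul h1 h2,
    Real.log_pow, Real.log_inv]
  ring

lemma lam_le (n : ℕ) : lam q n ≤ (q : ℝ)⁻¹ ^ n / ((q : ℝ)⁻¹ - q) :=
  div_le_div_of_nonneg_right (sub_le_self _ (pow_nonneg q.pos.le n)) inv_sub_pos.le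

/-- With u = q^{2n} this is -log(1-u) ≤ u/(1-u), together with u ≤ q². It measures how far lam n is
from a pure exponential. -/
lemma abs_log_one_sub_le {n : ℕ} (hn : n ≠ 0) :
    |Real.log (1 - (q : ℝ) ^ (2 * n))| ≤ (q : ℝ) ^ (2 * n) / (1 - (q : ℝ) ^ 2) := by
  have h0 : 0 < (q : ℝ) ^ (2 * n) := pow_pos q.pos _
  have h1 := pow_two_mul_lt (q := q) hn
  have h2 := pow_two_mul_le (q := q) hn
  have h3 : (q : ℝ) ^ 2 < 1 := pow_two_mul_lt (q := q) one_ne_zero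
  rw [abs_of_nonpos (Real.log_nonpos (by linarith) (by linarith))]
  have h4 := Real.one_sub_inv_le_log_of_pos (sub_pos.2 h1)
  calc -Real.log (1 - (q : ℝ) ^ (2 * n)) ≤ (1 - (q : ℝ) ^ (2 * n))⁻¹ - 1 := by linarith
    _ = (q : ℝ) ^ (2 * n) / (1 - (q : ℝ) ^ (2 * n)) := by
      have : 1 - (q : ℝ) ^ (2 * n) ≠ 0 := (sub_pos.2 h1).ne'
      field_simp
      ring
    _ ≤ _ := div_le_div_of_nonneg_left h0.le (by linarith) (by linarith)

/-- In log lam m - log lam n the normalising constant cancels, leaving the linear term of the limit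
shift and corrections that decay like q^{2m} and q^{2n}. -/
lemma lam_cpow_ratio {m n : ℕ} (hm : m ≠ 0) (hn : n ≠ 0) (z : ℂ) :
    (lam q m : ℂ) ^ (-2 * z) * (lam q n : ℂ) ^ (2 * z) =
      Complex.exp (z * (2 * ((m : ℝ) - n) * Real.log q + 2 * (Real.log (1 - (q : ℝ) ^ (2 * n)) -
        Real.log (1 - (q : ℝ) ^ (2 * m))) : ℝ)) := by
  have h1 : (lam q m : ℂ) ≠ 0 := by exact_mod_cast (lam_pos hm).ne'
  have h2 : (lam q n : ℂ) ≠ 0 := by exact_mod_cast (lam_pos hn).ne'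
  rw [Complex.cpow_def_of_ne_zero h1, Complex.cpow_def_of_ne_zero h2, ← Complex.exp_add,
    ← Complex.ofReal_log (lam_nonneg m), ← Complex.ofReal_log (lam_nonneg n), log_lam hm,
    log_lam hn]
  congr 1
  push_cast
  ring

/-! ### Twisting an asymptotic shift by complex powers -/

section Family

variable {K : Type*} [NormedAddCommGroup K] [InnerProductSpace ℂ K] [CompleteSpace K]
  {H : ℕ → Submodule ℂ K} [∀ i, (H i).HasOrthogonalProjection]

/-- The family `(|D|^{-2z} T |D|^{2z} - q^{2zδ} T)|D|` for an operator `T` which asymptotically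
shifts the components of a decomposition by `δ`. -/
theorem IsOrthoDecomp.exists_twist (q : Param) (hH : IsOrthoDecomp H) (h0 : H 0 = ⊥)
    (T : K →L[ℂ] K) (δ : ℤ)
    {J : ℕ} (hJ : ∀ m n : ℕ, (J : ℤ) < |(m : ℤ) - n| → ∀ u ∈ H m, ∀ w ∈ H n, inner ℂ u (T w) = 0)
    {C : ℝ} (hC : ∀ m n : ℕ, (m : ℤ) ≠ n + δ → ∀ u ∈ H m, ∀ w ∈ H n,
      lam q n * ‖inner ℂ u (T w)‖ ≤ C * ‖u‖ * ‖w‖) :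
    ∃ b : ℂ → K →L[ℂ] K, Differentiable ℂ b ∧ LinearGrowth b ∧ ∀ z m n x,
      (H m).starProjection (b z ((H n).starProjection x)) =
        (((lam q m : ℂ) ^ (-2 * z) * (lam q n : ℂ) ^ (2 * z) -
          Complex.exp (z * (2 * δ * Real.log q : ℝ))) * lam q n) •
            (H m).starProjection (T ((H n).starProjection x)) := by
  have hP0 : ∀ x, (H 0).starProjection x = 0 := fun x =>
    starProjection_eq_zero_iff'.2 fun v hv => by
      rw [h0, Submodule.mem_bot] at hv
      rw [hv, inner_zero_left]
  have hPP : ∀ m x, (H m).starProjection ((H m).starProjection x) = (H m).starProjection x :=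
    fun m x => Submodule.starProjection_eq_self_iff.2 (Submodule.starProjection_apply_mem _ x)
  have hq := q.pos
  have hq1 := q.lt_one
  have hq2 : (q : ℝ) ^ 2 < 1 := pow_two_mul_lt (q := q) one_ne_zero
  -- The block of T from component n to component n + d. When n + d is negative, `toNat` gives 0,
  -- where the component is trivial, so the block vanishes as it should.
  let Y : ℤ → ℕ → K →L[ℂ] K := fun d n =>
    (H (n + d).toNat).starProjection ∘L T ∘L (H n).starProjection
  have hYz : ∀ (d : ℤ) (n : ℕ), (n + d).toNat = 0 → ∀ x, Y d n x = 0 := fun d n h x => by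
    simp only [Y, ContinuousLinearMap.comp_apply, h, hP0]
  -- One family for each shift d. Index m = 0 is excluded because truncation makes it ambiguous and
  -- the formula for the ratio of powers needs nonzero indices; it is harmless since H 0 = 0.
  have key : ∀ d : ℤ, ∃ b : ℂ → K →L[ℂ] K, Differentiable ℂ b ∧ LinearGrowth b ∧
      ∀ (z : ℂ) (m n : ℕ) (x : K), m ≠ 0 →
      (H m).starProjection (b z ((H n).starProjection x)) = if (m : ℤ) = n + d then
        (((lam q m : ℂ) ^ (-2 * z) * (lam q n : ℂ) ^ (2 * z) -
          Complex.exp (z * (2 * δ * Real.log q : ℝ))) * lam q n) •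
            (H m).starProjection (T ((H n).starProjection x)) else 0 := by
    intro d
    let ε : ℕ → ℝ := fun n => if (n + d).toNat = 0 ∨ n = 0 then 0 else
      2 * (Real.log (1 - (q : ℝ) ^ (2 * n)) - Real.log (1 - (q : ℝ) ^ (2 * (n + d).toNat)))
    -- The two logarithms in ε n are bounded by multiples of q^{2n} and of q^{2(n+d)} =
    -- q^{2n}q^{2d}; E adds the constants.
    set E : ℝ := 2 * (1 + (q : ℝ) ^ (2 * d)) / (1 - (q : ℝ) ^ 2) with hEdef
    have hE0 : 0 ≤ E := div_nonneg (by positivity) (by linarith)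
    have hε : ∀ n, |ε n| ≤ E * (q : ℝ) ^ (2 * n) := by
      intro n
      simp only [ε]
      split_ifs with h
      · rw [abs_zero]; positivity
      · rw [not_or] at h
        have e : (q : ℝ) ^ (2 * (n + d).toNat) = (q : ℝ) ^ (2 * n) * (q : ℝ) ^ (2 * d) := by
          rw [← zpow_natCast, ← zpow_natCast, ← zpow_add₀ hq.ne']
          congr 1
          push_cast
          omega
        have h1 := abs_log_one_sub_le (q := q) h.1
        have h2 := abs_log_one_sub_le (q := q) h.2
        rw [e] at h1 ⊢
        rw [abs_mul, abs_two]
        have h3 := abs_sub (Real.log (1 - (q : ℝ) ^ (2 * n)))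
          (Real.log (1 - (q : ℝ) ^ (2 * n) * (q : ℝ) ^ (2 * d)))
        calc _ ≤ 2 * ((q : ℝ) ^ (2 * n) / (1 - (q : ℝ) ^ 2) +
              (q : ℝ) ^ (2 * n) * (q : ℝ) ^ (2 * d) / (1 - (q : ℝ) ^ 2)) := by linarith
          _ = _ := by rw [hEdef]; ring
    -- The error q^{2n} outweighs the growth q^{-n} of lam n and leaves the ratio q.
    have hεlam : ∀ n, |ε n| * lam q n ≤ E / ((q : ℝ)⁻¹ - q) * (q : ℝ) ^ n := by
      intro n
      have h1 : (q : ℝ) ^ n * (q : ℝ)⁻¹ ^ n = 1 := by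
        rw [← mul_pow, mul_inv_cancel₀ hq.ne', one_pow]
      calc |ε n| * lam q n ≤ (E * (q : ℝ) ^ (2 * n)) * ((q : ℝ)⁻¹ ^ n / ((q : ℝ)⁻¹ - q)) :=
            mul_le_mul (hε n) (lam_le n) (lam_nonneg n) (by positivity)
        _ = E / ((q : ℝ)⁻¹ - q) * (q : ℝ) ^ n * ((q : ℝ) ^ n * (q : ℝ)⁻¹ ^ n) := by
          rw [two_mul, pow_add]; ring
        _ = _ := by rw [h1, mul_one]
    have hεE : ∀ n, |ε n| ≤ E := fun n => (hε n).trans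
      (mul_le_of_le_one_right hE0 (pow_le_one₀ hq.le hq1.le))
    obtain ⟨b, hb, hb', hbz⟩ := hH.exists_shift_family (Y := Y d) (M := ‖T‖) (lam := lam q)
      (ε := ε) (a := 2 * d * Real.log q) (θ := 2 * δ * Real.log q) (r := q)
      (C := E / ((q : ℝ)⁻¹ - q)) (E := E)
      (by
        intro i j hij x y
        rcases Nat.eq_zero_or_pos (i + d).toNat with hi | hi
        · rw [hYz d i hi, inner_zero_left]
        · exact hH.ortho _ _ (by omega) _ (Submodule.starProjection_apply_mem _ _) _
            (Submodule.starProjection_apply_mem _ _))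
      (by
        intro i j x hij
        simp only [Y, ContinuousLinearMap.comp_apply]
        rw [hH.starProjection_of_mem_ne hij (Submodule.starProjection_apply_mem _ _), map_zero,
          map_zero])
      (by
        intro i
        refine ContinuousLinearMap.opNorm_le_bound _ (norm_nonneg _) fun x => ?_
        exact (Submodule.norm_starProjection_apply_le _ _).trans ((T.le_opNorm _).trans
          (mul_le_mul_of_nonneg_left (Submodule.norm_starProjection_apply_le _ _)
            (norm_nonneg _))))
      hq.le hq1 lam_nonneg hεlam hεE
      (by
        -- For the distinguished shift the limit exponents agree; for all others the decay
        -- hypothesis on T is needed.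
        by_cases hd : d = δ
        · exact Or.inl (by rw [hd])
        · refine Or.inr ⟨max C 0, fun n x => ?_⟩
          rcases Nat.eq_zero_or_pos (n + d).toNat with hi | hi
          · rw [hYz d n hi, norm_zero, mul_zero]; positivity
          -- Testing the bound on matrix coefficients against the vector Y d n x itself and
          -- cancelling its norm gives the operator bound.
          · have h1 := hC (n + d).toNat n (by omega) (Y d n x)
              (Submodule.starProjection_apply_mem _ _) _
              (Submodule.starProjection_apply_mem (H n) x)
            have h2 : inner ℂ (Y d n x) (T ((H n).starProjection x)) =
                inner ℂ (Y d n x) (Y d n x) :=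
              (inner_starProjection_of_mem (Submodule.starProjection_apply_mem _ _) _).symm
            rw [h2, inner_self_eq_norm_sq_to_K, norm_pow, RCLike.norm_ofReal, abs_norm] at h1
            rcases (norm_nonneg (Y d n x)).eq_or_lt with h3 | h3
            · rw [← h3, mul_zero]; positivity
            · have h4 : lam q n * ‖Y d n x‖ ≤ C * ‖(H n).starProjection x‖ :=
                le_of_mul_le_mul_right (by linarith) h3
              exact h4.trans (mul_le_mul_of_nonneg_right (le_max_left _ _) (norm_nonneg _)))
    refine ⟨b, hb, hb', fun z m n x hm => ?_⟩
    rw [hbz, map_smul]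
    simp only [Y, ContinuousLinearMap.comp_apply, hPP]
    split_ifs with h
    · have hmn : (n + d).toNat = m := by omega
      rw [hmn, hPP]
      rcases Nat.eq_zero_or_pos n with rfl | hn
      · rw [hP0, map_zero, map_zero, smul_zero, smul_zero]
      · rw [lam_cpow_ratio hm hn.ne']
        simp only [ε, hmn]
        rw [if_neg (by omega), show ((m : ℝ) - n) = d by
          have : (m : ℝ) = n + d := by exact_mod_cast h
          rw [this]; ring]
    · rcases Nat.eq_zero_or_pos (n + d).toNat with hi | hi
      · rw [hi, hP0, map_zero, smul_zero]
      · rw [hH.starProjection_of_mem_ne (i := m) (j := (n + d).toNat) (by omega)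
          (Submodule.starProjection_apply_mem _ _), smul_zero]
  choose b hb hb' hbz using key
  -- By `hJ` only shifts |d| ≤ J occur, and for given m, n at most the term d = m - n contributes.
  refine ⟨fun z => ∑ d ∈ Finset.Icc (-(J : ℤ)) J, b d z, ?_, LinearGrowth.sum _ fun d _ => hb' d,
    fun z m n x => ?_⟩
  · exact Differentiable.fun_sum fun d _ => hb d
  · rcases Nat.eq_zero_or_pos m with rfl | hm
    · rw [hP0, hP0, smul_zero]
    rw [_root_.sum_apply, map_sum, Finset.sum_congr rfl
      (fun d _ => hbz d z m n x hm.ne')]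
    have e : ∀ d : ℤ, ((m : ℤ) = n + d) = (d = (m : ℤ) - n) := fun d => propext (by omega)
    simp only [e, Finset.sum_ite_eq']
    split_ifs with h
    · rfl
    · have h1 : (H m).starProjection (T ((H n).starProjection x)) = 0 :=
        starProjection_eq_zero_iff'.2 fun u hu => hJ m n
          (by rw [Finset.mem_Icc, ← abs_le] at h; omega) u hu _
          (Submodule.starProjection_apply_mem _ _)
      rw [h1, smul_zero]

end Family

/-! ### Complex powers in terms of an orthogonal decomposition -/

lemma inner_eq_zero_of_mem_closure {K : Type*} [NormedAddCommGroup K] [InnerProductSpace ℂ K]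
    {U : Submodule ℂ K} {x : K} (h : ∀ v ∈ U, inner ℂ v x = 0) {v : K}
    (hv : v ∈ U.topologicalClosure) : inner ℂ v x = 0 :=
  closure_minimal (t := {v | inner ℂ v x = 0}) (fun v hv => h v hv)
    (isClosed_eq (by fun_prop) continuous_const) hv

section AbsPow

variable {K : Type*} [NormedAddCommGroup K] [InnerProductSpace ℂ K]

/-- The orthogonal decomposition `H` consists of eigenspaces of the absolute value of `T`, for
the eigenvalues `l n`, where `n ≠ 0`. -/
structure IsAbsDecomp (T : K →ₗ.[ℂ] K) (H : ℕ → Submodule ℂ K) (l : ℕ → ℝ) : Prop where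
  decomp : IsOrthoDecomp H
  zero : H 0 = ⊥
  pos : ∀ n, n ≠ 0 → 0 < l n
  inj : Function.Injective l
  ortho : ∀ μ ν, μ ≠ ν → ∀ v ∈ eigenspace T μ, ∀ w ∈ eigenspace T ν, inner ℂ v w = 0
  le : ∀ n, n ≠ 0 → H n ≤ (eigenspace T (l n) ⊔ eigenspace T (-l n)).topologicalClosure

namespace IsAbsDecomp

variable {T : K →ₗ.[ℂ] K} {H : ℕ → Submodule ℂ K} {l : ℕ → ℝ}

/-- H n lies in the closed span of eigenvectors of T for ±l n, so orthogonality to H n may be tested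
on those. -/
lemma inner_eq_zero (h : IsAbsDecomp T H l) {n : ℕ} {x : K}
    (hx : n ≠ 0 → ∀ ν, |ν| = l n → ∀ v ∈ eigenspace T ν, inner ℂ v x = 0) {v : K}
    (hv : v ∈ H n) : inner ℂ v x = 0 := by
  rcases eq_or_ne n 0 with rfl | hn
  · rw [h.zero, Submodule.mem_bot] at hv
    rw [hv, inner_zero_left]
  · refine inner_eq_zero_of_mem_closure (fun u hu => ?_) (h.le n hn hv)
    obtain ⟨a, ha, b, hb, rfl⟩ := Submodule.mem_sup.1 hu
    have hp := h.pos n hn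
    rw [inner_add_left, hx hn _ (abs_of_pos hp) a ha,
      hx hn _ (by rw [abs_neg, abs_of_pos hp]) b hb, add_zero]

lemma ortho_closure (h : IsAbsDecomp T H l) {μ ν : ℝ} (hμν : μ ≠ ν) {v w : K}
    (hv : v ∈ (eigenspace T μ).topologicalClosure) (hw : w ∈ (eigenspace T ν).topologicalClosure) :
    inner ℂ v w = 0 := by
  refine inner_eq_zero_of_mem_closure (fun u hu => ?_) hv
  rw [← inner_conj_symm, map_eq_zero]
  refine inner_eq_zero_of_mem_closure (fun u' hu' => ?_) hw
  exact h.ortho ν μ hμν.symm u' hu' u hu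

lemma eigen_decomp (h : IsAbsDecomp T H l) :
    IsOrthoDecomp fun μ : ℝ => (eigenspace T μ).topologicalClosure where
  ortho _ _ hμν _ hv _ hw := h.ortho_closure hμν hv hw
  total x hx := h.decomp.total x fun _ _ hv => h.inner_eq_zero
    (fun _ ν _ u hu => hx ν u (Submodule.le_topologicalClosure _ hu)) hv

variable [∀ i, (H i).HasOrthogonalProjection]

lemma starProjection_eigen (h : IsAbsDecomp T H l) {μ : ℝ} {v : K}
    (hv : v ∈ (eigenspace T μ).topologicalClosure) {n : ℕ} (hn : n ≠ 0 → |μ| ≠ l n) :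
    (H n).starProjection v = 0 := by
  refine starProjection_eq_zero_iff'.2 fun u hu => h.inner_eq_zero (fun hn' ν hν w hw => ?_) hu
  exact h.ortho_closure (by rintro rfl; exact hn hn' hν) (Submodule.le_topologicalClosure _ hw) hv

/-- An eigenvector for μ is orthogonal to every H n with l n ≠ |μ|, and l is injective, so at most
one component survives. This identifies the decomposition by real eigenvalues used in `absPow` as a
refinement of H. -/
lemma eigen_mem (h : IsAbsDecomp T H l) {μ : ℝ} {v : K}
    (hv : v ∈ (eigenspace T μ).topologicalClosure) : v = 0 ∨ ∃ n, |μ| = l n ∧ v ∈ H n := by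
  by_cases hμ : ∃ n, n ≠ 0 ∧ |μ| = l n
  · obtain ⟨n, hn, hμ⟩ := hμ
    refine Or.inr ⟨n, hμ, ?_⟩
    rw [← Submodule.starProjection_eq_self_iff]
    refine h.decomp.ext_proj fun m => ?_
    rcases eq_or_ne m n with rfl | hmn
    · exact Submodule.starProjection_eq_self_iff.2 (Submodule.starProjection_apply_mem _ _)
    · rw [h.decomp.starProjection_of_mem_ne hmn (Submodule.starProjection_apply_mem _ _),
        h.starProjection_eigen hv fun _ hm => hmn (h.inj (hm.symm.trans hμ))]
  · refine Or.inl (h.decomp.ext_proj fun m => ?_)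
    rw [map_zero]
    exact h.starProjection_eigen hv fun hm hm' => hμ ⟨m, hm, hm'⟩

/-- The graph of `|T|^w` in terms of the decomposition. -/
lemma absPow_iff [CompleteSpace K] (h : IsAbsDecomp T H l) (w : ℂ) (x y : K) :
    (∃ hx : x ∈ (absPow T w).domain, absPow T w ⟨x, hx⟩ = y) ↔
      ∀ n, (H n).starProjection y = (l n : ℂ) ^ w • (H n).starProjection x := by
  constructor
  · rintro ⟨hx, rfl⟩ n
    have hs : HasSum (fun μ : ℝ => ((|μ| : ℝ) : ℂ) ^ w •
        (eigenspace T μ).topologicalClosure.starProjection x) (absPow T w ⟨x, hx⟩) :=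
      Summable.hasSum hx
    rw [← map_smul, ← sub_eq_zero, ← map_sub]
    refine starProjection_eq_zero_iff'.2 fun u hu => h.inner_eq_zero (fun hn ν hν v hv => ?_) hu
    have hv' := Submodule.le_topologicalClosure _ hv
    have h1 := (innerSL ℂ v).hasSum hs
    have h2 : HasSum (fun μ : ℝ => innerSL ℂ v (((|μ| : ℝ) : ℂ) ^ w •
        (eigenspace T μ).topologicalClosure.starProjection x))
        (innerSL ℂ v (((|ν| : ℝ) : ℂ) ^ w •
          (eigenspace T ν).topologicalClosure.starProjection x)) := by
      refine hasSum_single ν fun μ hμ => ?_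
      rw [innerSL_apply_apply, inner_smul_right,
        h.ortho_closure hμ.symm hv' (Submodule.starProjection_apply_mem _ _), mul_zero]
    have h3 := h1.unique h2
    rw [innerSL_apply_apply, innerSL_apply_apply, inner_smul_right,
      inner_starProjection_of_mem hv', hν] at h3
    rw [inner_sub_right, inner_smul_right, h3, sub_self]
  · intro hn
    -- Each eigenspace sits inside one H n with l n = |μ|, so the defining series of |T|^w x is the
    -- expansion of y in eigenspaces, which converges to y.
    have key : ∀ μ : ℝ, ((|μ| : ℝ) : ℂ) ^ w •
        (eigenspace T μ).topologicalClosure.starProjection x =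
          (eigenspace T μ).topologicalClosure.starProjection y := by
      intro μ
      rw [← map_smul, eq_comm, ← sub_eq_zero, ← map_sub]
      refine starProjection_eq_zero_iff'.2 fun v hv => ?_
      rcases h.eigen_mem hv with rfl | ⟨n, hμ, hvn⟩
      · exact inner_zero_left _
      · rw [← inner_starProjection_of_mem hvn, map_sub, map_smul, hn, hμ, sub_self,
          inner_zero_right]
    have hs : HasSum (fun μ : ℝ => ((|μ| : ℝ) : ℂ) ^ w •
        (eigenspace T μ).topologicalClosure.starProjection x) y := by
      simp only [key]
      exact h.eigen_decomp.hasSum y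
    exact ⟨hs.summable, hs.tsum_eq⟩

end IsAbsDecomp

/-- Commutation of an operator `T₁ + T₂` with complex powers of `|D|`, where `T₁` and `T₂`
asymptotically shift the decomposition by `-1` and `1`. -/
theorem IsAbsDecomp.absPow_comp [CompleteSpace K] {q : Param} {D : K →ₗ.[ℂ] K} {H : ℕ → Submodule ℂ K}
    [∀ i, (H i).HasOrthogonalProjection] (h : IsAbsDecomp D H (lam q)) (T₁ T₂ : K →L[ℂ] K)
    {b₁ b₂ : ℂ → K →L[ℂ] K}
    (hb₁ : ∀ z m n x, (H m).starProjection (b₁ z ((H n).starProjection x)) =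
        (((lam q m : ℂ) ^ (-2 * z) * (lam q n : ℂ) ^ (2 * z) -
          Complex.exp (z * (2 * (-1 : ℤ) * Real.log q : ℝ))) * lam q n) •
            (H m).starProjection (T₁ ((H n).starProjection x)))
    (hb₂ : ∀ z m n x, (H m).starProjection (b₂ z ((H n).starProjection x)) =
        (((lam q m : ℂ) ^ (-2 * z) * (lam q n : ℂ) ^ (2 * z) -
          Complex.exp (z * (2 * (1 : ℤ) * Real.log q : ℝ))) * lam q n) •
            (H m).starProjection (T₂ ((H n).starProjection x)))
    (z : ℂ) (ξ : (absPow D (-2 * z)).domain) :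
    ∃ (h₁ : (T₁ + T₂) ξ ∈ (absPow D (-2 * z)).domain)
      (h₂ : (ξ : K) ∈ (absPow D (-2 * z - 1)).domain),
      absPow D (-2 * z) ⟨(T₁ + T₂) ξ, h₁⟩ =
        (Complex.exp (z * (2 * (-1 : ℤ) * Real.log q : ℝ)) • T₁ (absPow D (-2 * z) ξ) +
          Complex.exp (z * (2 * (1 : ℤ) * Real.log q : ℝ)) • T₂ (absPow D (-2 * z) ξ)) +
        (b₁ z + b₂ z) (absPow D (-2 * z - 1) ⟨ξ, h₂⟩) := by
  set η := absPow D (-2 * z) ξ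
  have hη := (h.absPow_iff (-2 * z) ξ η).1 ⟨ξ.2, rfl⟩
  have hP0 : ∀ x, (H 0).starProjection x = 0 := fun x =>
    starProjection_eq_zero_iff'.2 fun v hv => by
      rw [h.zero, Submodule.mem_bot] at hv
      rw [hv, inner_zero_left]
  have hPP : ∀ m x, (H m).starProjection ((H m).starProjection x) = (H m).starProjection x :=
    fun m x => Submodule.starProjection_eq_self_iff.2 (Submodule.starProjection_apply_mem _ x)
  -- S is |D|^{-1}, bounded because lam n ≥ 1 for n ≠ 0. Applied to |D|^{-2z} ξ it produces
  -- |D|^{-2z-1} ξ, which proves the inclusion of domains.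
  obtain ⟨S, hS⟩ := h.decomp.exists_strong_sum
    (X := fun n => (lam q n : ℂ)⁻¹ • (H n).starProjection) (M := 1)
    (fun i j hij x y => h.decomp.ortho i j hij _
      (Submodule.smul_mem _ _ (Submodule.starProjection_apply_mem _ _)) _
      (Submodule.smul_mem _ _ (Submodule.starProjection_apply_mem _ _)))
    (fun i x => by
      rcases eq_or_ne i 0 with rfl | hi
      · simp [hP0]
      · rw [_root_.smul_apply, norm_smul, norm_inv, Complex.norm_real, Real.norm_eq_abs,
          abs_of_pos (lam_pos hi)]
        exact mul_le_mul_of_nonneg_right (inv_le_one_of_one_le₀ (one_le_lam hi)) (norm_nonneg _))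
  have hPS : ∀ m x, (H m).starProjection (S x) = (lam q m : ℂ)⁻¹ • (H m).starProjection x := by
    intro m x
    refine (((H m).starProjection ∘L S).hasSum (h.decomp.hasSum x)).unique ?_
    convert hasSum_single m fun n hn => ?_ using 1
    · rw [ContinuousLinearMap.comp_apply, hS, _root_.smul_apply, map_smul, hPP]
    · rw [ContinuousLinearMap.comp_apply, hS, _root_.smul_apply, map_smul,
        h.decomp.starProjection_of_mem_ne hn.symm (Submodule.starProjection_apply_mem _ _),
        smul_zero]
  have hζ : ∀ n, (H n).starProjection (S η) =
      (lam q n : ℂ) ^ (-2 * z - 1) • (H n).starProjection (ξ : K) := by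
    intro n
    rw [hPS, hη, smul_smul]
    rcases eq_or_ne n 0 with rfl | hn
    · rw [hP0, smul_zero, smul_zero]
    · have hl : (lam q n : ℂ) ≠ 0 := by exact_mod_cast (lam_pos hn).ne'
      rw [Complex.cpow_sub _ _ hl, Complex.cpow_one, div_eq_inv_mul]
  obtain ⟨h₂, hζ'⟩ := (h.absPow_iff _ _ _).2 hζ
  -- The componentwise criterion `absPow_iff` shows at once that (T₁ + T₂) ξ is in the domain and
  -- what its image is.
  have hmain : ∀ m, (H m).starProjection
      ((Complex.exp (z * (2 * (-1 : ℤ) * Real.log q : ℝ)) • T₁ η +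
          Complex.exp (z * (2 * (1 : ℤ) * Real.log q : ℝ)) • T₂ η) + (b₁ z + b₂ z) (S η)) =
      (lam q m : ℂ) ^ (-2 * z) • (H m).starProjection ((T₁ + T₂) (ξ : K)) := by
    intro m
    replace hb₁ := hb₁ z
    replace hb₂ := hb₂ z
    generalize hc₁ : Complex.exp (z * (2 * (-1 : ℤ) * Real.log q : ℝ)) = c₁ at hb₁ ⊢
    generalize hc₂ : Complex.exp (z * (2 * (1 : ℤ) * Real.log q : ℝ)) = c₂ at hb₂ ⊢
    have s1 := ((H m).starProjection ∘L (c₁ • T₁ + c₂ • T₂)).hasSum (h.decomp.hasSum η)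
    have s2 := ((H m).starProjection ∘L (b₁ z + b₂ z)).hasSum (h.decomp.hasSum (S η))
    have s3 := ((lam q m : ℂ) ^ (-2 * z) • ((H m).starProjection ∘L (T₁ + T₂))).hasSum
      (h.decomp.hasSum (ξ : K))
    have s4 := s1.add s2
    -- After expanding ξ, η and S η over n, each term is a scalar identity: the subtracted constants
    -- c₁, c₂ in b₁, b₂ cancel the explicit terms, and lam n^{2z}·lam n^{-2z} = 1 leaves lam
    -- m^{-2z}.
    have e : ∀ n, ((H m).starProjection ∘L (c₁ • T₁ + c₂ • T₂)) ((H n).starProjection η) +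
        ((H m).starProjection ∘L (b₁ z + b₂ z)) ((H n).starProjection (S η)) =
        ((lam q m : ℂ) ^ (-2 * z) • ((H m).starProjection ∘L (T₁ + T₂)))
          ((H n).starProjection (ξ : K)) := by
      intro n
      simp only [ContinuousLinearMap.comp_apply, _root_.add_apply, _root_.smul_apply, map_add,
        map_smul]
      rcases eq_or_ne n 0 with rfl | hn
      · simp [hP0]
      have hl : (lam q n : ℂ) ≠ 0 := by exact_mod_cast (lam_pos hn).ne'
      have e1 : (lam q n : ℂ) * (lam q n : ℂ) ^ (-2 * z - 1) = (lam q n : ℂ) ^ (-2 * z) := by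
        rw [Complex.cpow_sub _ _ hl, Complex.cpow_one, mul_div_cancel₀ _ hl]
      have e2 : (lam q n : ℂ) ^ (2 * z) * (lam q n : ℂ) ^ (-2 * z) = 1 := by
        rw [← Complex.cpow_add _ _ hl, ← add_mul, add_neg_cancel, zero_mul, Complex.cpow_zero]
      rw [hb₁, hb₂, hζ, hη]
      simp only [map_smul]
      match_scalars
      · linear_combination ((lam q m : ℂ) ^ (-2 * z) * (lam q n : ℂ) ^ (2 * z) - c₁) * e1 +
          (lam q m : ℂ) ^ (-2 * z) * e2
      · linear_combination ((lam q m : ℂ) ^ (-2 * z) * (lam q n : ℂ) ^ (2 * z) - c₂) * e1 +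
          (lam q m : ℂ) ^ (-2 * z) * e2
    simp only [e] at s4
    have h5 := s4.unique s3
    simpa only [ContinuousLinearMap.comp_apply, _root_.add_apply, _root_.smul_apply, map_add]
      using h5
  obtain ⟨h₁, h⟩ := (h.absPow_iff (-2 * z) ((T₁ + T₂) (ξ : K)) _).2 hmain
  exact ⟨h₁, h₂, by rw [h, hζ']⟩

end AbsPow

/-! ### Multiplication operators between spaces of sections -/

/-- An element of `homog q n` as an element of `Sec q n`. -/
def Sec.of {n : ℤ} (x : Pol q) (hx : x ∈ homog q n) : Sec q n := ⟨x, hx⟩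

@[simp] lemma Sec.val_of {n : ℤ} (x : Pol q) (hx : x ∈ homog q n) : (Sec.of x hx).val = x := rfl

lemma Sec.val_mem {n : ℤ} (a : Sec q n) : a.val ∈ homog q n := a.2

lemma Sec.val_injective {n : ℤ} : Function.Injective (Sec.val (q := q) (n := n)) :=
  Subtype.val_injective

/-- Left multiplication by a homogeneous element. -/
def mulSec {ω : Pol q} {r m n : ℤ} (hω : ω ∈ homog q r) (h : r + m = n) : Sec q m →ₗ[ℂ] Sec q n :=
  (LinearMap.mulLeft ℂ ω).restrict (p := homog q m) (q := homog q n) fun _ hx =>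
    h ▸ mul_mem_homog hω hx

section MulSec

variable {ω : Pol q} {r m n : ℤ} (hω : ω ∈ homog q r) (h : r + m = n)

@[simp] lemma mulSec_val (x : Sec q m) : (mulSec hω h x).val = ω * x.val := rfl

lemma mulSec_bound : ∃ C : ℝ, 0 ≤ C ∧ ∀ x, ‖mulSec hω h x‖ ≤ C * ‖x‖ := by
  obtain ⟨C, hC, hb⟩ := exists_bound ω
  refine ⟨Real.sqrt C, Real.sqrt_nonneg _, fun x => ?_⟩
  refine le_of_sq_le_sq ?_ (by positivity)
  rw [mul_pow, Real.sq_sqrt hC, Sec.norm_sq, Sec.norm_sq]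
  exact hb x.val

/-- Left multiplication by a homogeneous element, on the completions. -/
def mulOp : L2 q m →L[ℂ] L2 q n :=
  ContinuousLinearMap.completion ((mulSec hω h).mkContinuousOfExistsBound
    ((mulSec_bound hω h).imp fun _ hC => hC.2))

lemma mulOp_coe (x : Sec q m) : mulOp hω h (x : L2 q m) = (mulSec hω h x : Sec q n) :=
  ContinuousLinearMap.completion_apply_coe _ _

lemma leftMul_coe (b : homog q 0) (x : Sec q m) :
    leftMul b m (x : L2 q m) = (leftMulLin b m x : Sec q m) :=
  ContinuousLinearMap.completion_apply_coe _ _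

lemma star_mem_homog (hω : ω ∈ homog q r) : star ω ∈ homog q (-r) := by
  rw [mem_homog, ← star_dkinv, dkinv_of_mem hω, star_smul, Complex.star_def, map_zpow₀, conj_sq]

/-- In the inner product h(a* b) the adjoint of left multiplication by ω is left multiplication by
ω*. -/
lemma inner_mulSec (h' : -r + n = m) (a : Sec q n) (x : Sec q m) :
    inner ℂ a (mulSec hω h x) = inner ℂ (mulSec (star_mem_homog hω) h' a) x := by
  rw [Sec.inner_def, Sec.inner_def, mulSec_val, mulSec_val, star_mul, star_star, mul_assoc]

end MulSec

/-! ### Spectral decomposition of the sections -/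

lemma qInt_natCast (n : ℕ) : qInt q n = lam q n := by
  rw [qInt, lam]
  push_cast
  change _ = (q.c⁻¹ ^ n - q.c ^ n) / (q.c⁻¹ - q.c)
  rw [zpow_neg, zpow_natCast, inv_pow, ← neg_sub, ← neg_sub q.c⁻¹ q.c, neg_div_neg_eq]

/-- The component of `Sec q r` of spin `n - 1 / 2`. -/
def comp (q : Param) (r : ℤ) (n : ℕ) : Submodule ℂ (Sec q r) :=
  (Submodule.span ℂ {x : Pol q | ∃ t i k : ℕ, i + k + 1 = 2 * n ∧
    -((i + k : ℕ) : ℤ) + 2 * t = r ∧ x = (de q ^ t) (mon' q i 0 k)}).comap Sec.val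

lemma mem_comp {r : ℤ} {n : ℕ} {a : Sec q r} : a ∈ comp q r n ↔
    a.val ∈ Submodule.span ℂ {x : Pol q | ∃ t i k : ℕ, i + k + 1 = 2 * n ∧
      -((i + k : ℕ) : ℤ) + 2 * t = r ∧ x = (de q ^ t) (mon' q i 0 k)} := Iff.rfl

lemma comp_zero (r : ℤ) : comp q r 0 = ⊥ := by
  refine (Submodule.eq_bot_iff _).2 fun x hx => Sec.val_injective ?_
  rw [mem_comp] at hx
  have : {x : Pol q | ∃ t i k : ℕ, i + k + 1 = 2 * 0 ∧
      -((i + k : ℕ) : ℤ) + 2 * t = r ∧ x = (de q ^ t) (mon' q i 0 k)} = ∅ := by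
    refine Set.eq_empty_of_forall_notMem ?_
    rintro _ ⟨t, i, k, h, -⟩
    omega
  rw [this, Submodule.span_empty, Submodule.mem_bot] at hx
  rw [hx, map_zero]

lemma comp_le_degLE {r : ℤ} {n : ℕ} {a : Sec q r} (ha : a ∈ comp q r n) :
    a.val ∈ degLE q (2 * n) := by
  refine (Submodule.span_le.2 ?_ : Submodule.span ℂ _ ≤ degLE q (2 * n)) (mem_comp.1 ha)
  rintro _ ⟨t, i, k, h, -, rfl⟩
  exact de_pow_low_mem_degLE (by omega) t

lemma deSec_mem {n : ℕ} {c : Sec q (-1)} (hc : c ∈ comp q (-1) n) : deSec q c ∈ comp q 1 n := by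
  rw [mem_comp] at hc ⊢
  change de q c.val ∈ _
  generalize c.val = x at hc
  induction hc using Submodule.span_induction with
  | zero => simp
  | add x y _ _ h1 h2 => rw [map_add]; exact add_mem h1 h2
  | smul r x _ h1 => rw [map_smul]; exact Submodule.smul_mem _ r h1
  | mem x hx =>
    obtain ⟨t, i, k, h, ht, rfl⟩ := hx
    exact Submodule.subset_span ⟨t + 1, i, k, h, by push_cast at ht ⊢; omega,
      by rw [pow_succ', Module.End.mul_apply]⟩

/-- Weight -1 with i + k = 2n - 1 forces t = n - 1, so both q-integers in `df_de_pow_low` become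
[n]. -/
lemma df_de_of_mem_span {n : ℕ} {x : Pol q} (hx : x ∈ Submodule.span ℂ {x : Pol q |
    ∃ t i k : ℕ, i + k + 1 = 2 * n ∧ -((i + k : ℕ) : ℤ) + 2 * t = -1 ∧
      x = (de q ^ t) (mon' q i 0 k)}) : df q (de q x) = ((lam q n : ℂ) ^ 2) • x := by
  induction hx using Submodule.span_induction with
  | zero => simp
  | add x y _ _ h1 h2 => rw [map_add, map_add, h1, h2, smul_add]
  | smul r x _ h1 => rw [map_smul, map_smul, h1, smul_comm]
  | mem x hx =>
    obtain ⟨t, i, k, h, ht, rfl⟩ := hx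
    rw [← Module.End.mul_apply (de q), ← pow_succ', df_de_pow_low, ← qInt_natCast, pow_two]
    congr 3 <;> omega

lemma dfSec_deSec {n : ℕ} {c : Sec q (-1)} (hc : c ∈ comp q (-1) n) :
    dfSec q (deSec q c) = ((lam q n : ℂ) ^ 2) • c := by
  refine Sec.val_injective ?_
  rw [map_smul]
  exact df_de_of_mem_span (mem_comp.1 hc)

lemma deSec_dfSec {n : ℕ} {a : Sec q 1} (ha : a ∈ comp q 1 n) :
    deSec q (dfSec q a) = ((lam q n : ℂ) ^ 2) • a := by
  refine Sec.val_injective ?_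
  rw [map_smul]
  change de q (df q a.val) = _
  have h := mem_comp.1 ha
  generalize a.val = x at h
  induction h using Submodule.span_induction with
  | zero => simp
  | add x y _ _ h1 h2 => rw [map_add, map_add, h1, h2, smul_add]
  | smul r x _ h1 => rw [map_smul, map_smul, h1, smul_comm]
  | mem x hx =>
    obtain ⟨t, i, k, h, ht, rfl⟩ := hx
    -- Weight 1 forces t ≥ 1, so every spanning vector is ∂_e of one in weight -1.
    obtain ⟨t, rfl⟩ : ∃ s, t = s + 1 := ⟨t - 1, by omega⟩
    rw [pow_succ', Module.End.mul_apply, df_de_of_mem_span (n := n)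
      (Submodule.subset_span ⟨t, i, k, h, by push_cast at ht ⊢; omega, rfl⟩), map_smul]

/-- The operator ∂_e∂_f is symmetric with eigenvalues lam², which are distinct. -/
lemma inner_comp_pos {m n : ℕ} (hmn : m ≠ n) {a a' : Sec q 1} (ha : a ∈ comp q 1 m)
    (ha' : a' ∈ comp q 1 n) : inner ℂ a a' = 0 := by
  have h1 := inner_deSec (dfSec q a) a'
  rw [inner_dfSec, deSec_dfSec ha, deSec_dfSec ha', inner_smul_left, inner_smul_right, map_pow,
    Complex.conj_ofReal] at h1
  have h2 : (lam q m : ℂ) ^ 2 - (lam q n : ℂ) ^ 2 ≠ 0 := by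
    rw [sub_ne_zero]
    intro h
    have h3 : lam q m ^ 2 = lam q n ^ 2 := by exact_mod_cast h
    exact hmn (lam_strictMono.injective
      ((pow_left_inj₀ (lam_nonneg m) (lam_nonneg n) two_ne_zero).1 h3))
  refine (mul_eq_zero.1 (?_ : ((lam q m : ℂ) ^ 2 - (lam q n : ℂ) ^ 2) * _ = 0)).resolve_left h2
  rw [sub_mul, h1, sub_self]

/-- Transported from weight 1, since ⟨∂_e c, ∂_e c'⟩ = lam n²⟨c, c'⟩ and lam n ≠ 0 unless the
component is trivial. -/
lemma inner_comp_neg {m n : ℕ} (hmn : m ≠ n) {c c' : Sec q (-1)} (hc : c ∈ comp q (-1) m)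
    (hc' : c' ∈ comp q (-1) n) : inner ℂ c c' = 0 := by
  have h1 := inner_comp_pos hmn (deSec_mem hc) (deSec_mem hc')
  rw [inner_deSec, dfSec_deSec hc', inner_smul_right] at h1
  rcases eq_or_ne n 0 with rfl | hn
  · rw [comp_zero, Submodule.mem_bot] at hc'
    rw [hc', inner_zero_right]
  · have hl : (lam q n : ℂ) ^ 2 ≠ 0 := pow_ne_zero _ (by exact_mod_cast (lam_pos hn).ne')
    exact (mul_eq_zero.1 h1).resolve_left hl

lemma inner_comp {r : ℤ} (hr : r = 1 ∨ r = -1) {m n : ℕ} (hmn : m ≠ n) {a a' : Sec q r}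
    (ha : a ∈ comp q r m) (ha' : a' ∈ comp q r n) : inner ℂ a a' = 0 := by
  rcases hr with rfl | rfl
  · exact inner_comp_pos hmn ha ha'
  · exact inner_comp_neg hmn ha ha'

lemma mem_iSup_comp {r : ℤ} (hr : r = 1 ∨ r = -1) {N : ℕ} {a : Sec q r} (ha : a.val ∈ degLE q N) :
    a ∈ ⨆ (n : ℕ) (_ : 2 * n ≤ N + 1), comp q r n := by
  have h1 := mem_span_of_mem_degLE ha a.val_mem
  have h2 : Submodule.span ℂ {x : Pol q | ∃ t i k : ℕ, i + k ≤ N ∧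
      -((i + k : ℕ) : ℤ) + 2 * t = r ∧ x = (de q ^ t) (mon' q i 0 k)} ≤
      (⨆ (n : ℕ) (_ : 2 * n ≤ N + 1), comp q r n).map Sec.val := by
    refine Submodule.span_le.2 ?_
    rintro _ ⟨t, i, k, h, ht, rfl⟩
    refine ⟨Sec.of _ (ht ▸ de_pow_low_mem t i k), ?_, rfl⟩
    -- The weight r = ±1 is odd, so i + k is odd: only half-integral spins occur.
    obtain ⟨n, hn⟩ : ∃ n, i + k + 1 = 2 * n := ⟨(i + k + 1) / 2, by omega⟩
    refine Submodule.mem_iSup_of_mem n (Submodule.mem_iSup_of_mem (by omega) ?_)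
    exact Submodule.subset_span ⟨t, i, k, hn, ht, rfl⟩
  obtain ⟨a', ha', e⟩ := h2 h1
  rwa [← Sec.val_injective e]

/-- Multiplication operators have finite range. -/
lemma inner_mulSec_eq_zero {ω : Pol q} {r m n : ℤ} (hω : ω ∈ homog q r) (h : r + m = n)
    (hn : n = 1 ∨ n = -1) : ∃ J : ℕ, ∀ i j : ℕ, i + J < j → ∀ a ∈ comp q n j, ∀ c ∈ comp q m i,
      inner ℂ a (mulSec hω h c) = 0 := by
  obtain ⟨J, hJ⟩ := exists_mul_mem_degLE ω
  refine ⟨J, fun i j hij a ha c hc => ?_⟩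
  have h1 : mulSec hω h c ∈ _ := mem_iSup_comp hn (N := 2 * i + J) (hJ _ _ (comp_le_degLE hc))
  have h2 : (⨆ (k : ℕ) (_ : 2 * k ≤ 2 * i + J + 1), comp q n k) ≤
      LinearMap.ker (innerₛₗ ℂ a) := by
    refine iSup₂_le fun k hk x hx => ?_
    rw [LinearMap.mem_ker]
    exact inner_comp hn (by omega) ha hx
  exact LinearMap.mem_ker.1 (h2 h1)

/-- The degree filtration only limits how far the spin can rise; the bound on how far it can fall is
the same statement for the adjoint ω*. -/
lemma exists_inner_mulSec_eq_zero {ω : Pol q} {r m n : ℤ} (hω : ω ∈ homog q r) (h : r + m = n)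
    (hm : m = 1 ∨ m = -1) (hn : n = 1 ∨ n = -1) : ∃ J : ℕ, ∀ i j : ℕ, (J : ℤ) < |(i : ℤ) - j| →
      ∀ a ∈ comp q n i, ∀ c ∈ comp q m j, inner ℂ a (mulSec hω h c) = 0 := by
  have h' : -r + n = m := by omega
  obtain ⟨J, hJ⟩ := inner_mulSec_eq_zero hω h hn
  obtain ⟨J', hJ'⟩ := inner_mulSec_eq_zero (star_mem_homog hω) h' hm
  refine ⟨max J J', fun i j hij a ha c hc => ?_⟩
  rw [lt_abs] at hij
  rcases hij with hij | hij
  · exact hJ j i (by omega) a ha c hc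
  · rw [inner_mulSec hω h h', ← inner_conj_symm, hJ' i j (by omega) c hc a ha, map_zero]

/-! ### Estimates for multiplication operators -/

lemma star_df (a : Pol q) : star (df q a) = -q.c • de q (star a) := by
  have h := congrArg star (star_de (star a))
  rw [star_star, star_star, star_smul, Complex.star_def, map_neg, map_inv₀, conj_c] at h
  rw [h, smul_smul, neg_mul_neg, mul_inv_cancel₀ q.c_ne, one_smul]

lemma haar_de (a : Pol q) : haar q (de q a) = 0 := by
  have h := haar_star (de q a)
  rw [star_de, map_smul, haar_df, smul_zero] at h
  exact (map_eq_zero _).1 h.symm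

lemma de_df_of_comp {n : ℕ} {c : Sec q (-1)} (hc : c ∈ comp q (-1) n) :
    de q (df q c.val) = ((lam q n : ℂ) ^ 2 - 1) • c.val := by
  have h := df_de_of_mem c.val_mem
  have h1 : qInt q (-1) = -1 := by
    rw [qInt, neg_neg, zpow_neg, zpow_one, ← neg_sub, neg_div, div_self c_sub_inv_ne]
  rw [df_de_of_mem_span (mem_comp.1 hc), h1, neg_smul, one_smul, sub_neg_eq_add] at h
  rw [sub_smul, one_smul, h, add_sub_cancel_right]

lemma norm_deSec_le {n : ℕ} {c : Sec q (-1)} (hc : c ∈ comp q (-1) n) :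
    ‖deSec q c‖ ≤ lam q n * ‖c‖ := by
  have h := inner_deSec c (deSec q c)
  rw [dfSec_deSec hc, inner_smul_right, inner_self_eq_norm_sq_to_K, inner_self_eq_norm_sq_to_K]
    at h
  have h2 : ‖deSec q c‖ ^ 2 = lam q n ^ 2 * ‖c‖ ^ 2 :=
    Complex.ofReal_injective (by push_cast; exact h)
  refine le_of_sq_le_sq ?_ (mul_nonneg (lam_nonneg n) (norm_nonneg _))
  rw [h2, mul_pow]

/-- Here ∂_f c has weight -3 and leaves the spinor space, so D gives no information. Invariance of
the Haar state applied to ∂_e(c* ∂_f c) yields ‖∂_f c‖² = (lam n² - 1)‖c‖². -/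
lemma norm_df_le {n : ℕ} {c : Sec q (-1)} (hc : c ∈ comp q (-1) n)
    (hdf : df q c.val ∈ homog q (-3)) : ‖Sec.of (df q c.val) hdf‖ ≤ lam q n * ‖c‖ := by
  have hs := q.sq_ne
  have h := haar_de (star c.val * df q c.val)
  have hk : dk q (star c.val) = q.sq • star c.val := by
    have := mem_homog.1 (star_mem_homog c.val_mem)
    rwa [neg_neg, zpow_one] at this
  have hk' : dkinv q (df q c.val) = q.sq ^ 3 • df q c.val := by
    rw [dkinv_of_mem hdf]; norm_cast
  rw [de_mul, hk, hk', de_df_of_comp hc, map_add, mul_smul_comm, map_smul, smul_mul_assoc,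
    map_smul, mul_smul_comm, map_smul, smul_eq_mul, smul_eq_mul, smul_eq_mul] at h
  have h2 : haar q (star (df q c.val) * df q c.val) =
      ((lam q n : ℂ) ^ 2 - 1) * haar q (star c.val * c.val) := by
    rw [star_df, smul_mul_assoc, map_smul, smul_eq_mul, ← q.sq_mul]
    apply mul_left_cancel₀ hs
    linear_combination -h
  have h3 : ‖Sec.of (df q c.val) hdf‖ ^ 2 = (lam q n ^ 2 - 1) * ‖c‖ ^ 2 := by
    rw [Sec.norm_sq, Sec.norm_sq, Sec.val_of, h2, ← Complex.re_ofReal_mul]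
    push_cast
    rfl
  refine le_of_sq_le_sq ?_ (mul_nonneg (lam_nonneg n) (norm_nonneg _))
  rw [h3, mul_pow]
  nlinarith [sq_nonneg ‖c‖]

/-- The second order twisted Leibniz rule. The q² in front of the leading term is what makes
multiplication by ω prefer the shift n → n-1; the other terms involve c only to first order. -/
lemma de_df_mul {ω c : Pol q} (hω : ω ∈ homog q 2) (hc : c ∈ homog q (-1)) :
    de q (df q (ω * c)) = q.c ^ 2 • (ω * de q (df q c)) + q.sq • (df q ω * de q c) +
      q.sq ^ 5 • (de q ω * df q c) + q.c • (de q (df q ω) * c) := by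
  have hs := q.sq_ne
  have h1 := dkinv_of_mem hc
  have h2 := dkinv_of_mem (df_mem hc)
  have h3 := mem_homog.1 hω
  have h4 := mem_homog.1 (df_mem hω)
  norm_num at h1 h2 h3 h4
  rw [df_mul, h1, h3, mul_smul_comm, smul_mul_assoc, map_add, map_smul, map_smul, de_mul, de_mul,
    h1, h2, h3, h4]
  simp only [mul_smul_comm, smul_mul_assoc, ← q.sq_mul]
  module

/-- Pair ∂_e∂_f(ωc) with a. Symmetry gives lam m²⟨a, ωc⟩, the Leibniz rule gives q² lam n²⟨a, ωc⟩
plus a remainder of size O(lam n); away from m = n-1 the gap of order lam n² can be divided out. -/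
lemma exists_inner_mulSec_le {ω : Pol q} (hω : ω ∈ homog q 2) (h : (2 : ℤ) + -1 = 1) :
    ∃ C : ℝ, 0 ≤ C ∧ ∀ m n : ℕ, m + 1 ≠ n → ∀ a ∈ comp q 1 m, ∀ c ∈ comp q (-1) n,
      lam q n * ‖inner ℂ a (mulSec hω h c)‖ ≤ C * ‖a‖ * ‖c‖ := by
  have hfω : df q ω ∈ homog q 0 := df_mem hω
  have heω : de q ω ∈ homog q 4 := de_mem hω
  have hefω : de q (df q ω) ∈ homog q 2 := de_mem hfω
  obtain ⟨C₁, h1, hC₁⟩ := mulSec_bound hfω (show (0 : ℤ) + 1 = 1 by norm_num)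
  obtain ⟨C₂, h2, hC₂⟩ := mulSec_bound heω (show (4 : ℤ) + -3 = 1 by norm_num)
  obtain ⟨C₃, h3, hC₃⟩ := mulSec_bound hefω h
  obtain ⟨C₄, h4, hC₄⟩ := mulSec_bound hω h
  set A : ℝ := ‖q.sq‖ * C₁ + ‖q.sq ^ 5‖ * C₂ + ‖q.c‖ * C₃ + ‖q.c ^ 2‖ * C₄ with hA
  have hq := q.pos
  have hq1 := q.lt_one
  have hκ : 0 < (q : ℝ) ^ 2 * (1 - q) := mul_pos (by positivity) (by linarith)
  refine ⟨A / ((q : ℝ) ^ 2 * (1 - q)), by positivity, fun m n hmn a ha c hc => ?_⟩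
  rcases eq_or_ne n 0 with rfl | hn
  · rw [comp_zero, Submodule.mem_bot] at hc
    rw [hc]
    simp
  have hdf : df q c.val ∈ homog q (-3) := df_mem c.val_mem
  have hl1 := one_le_lam (q := q) hn
  have hl0 := lam_pos (q := q) hn
  -- The first order remainder. Its last term arises because ∂_e∂_f c is (lam n² - 1)c rather than
  -- lam n² c.
  let R : Sec q 1 := q.sq • mulSec hfω (show (0 : ℤ) + 1 = 1 by norm_num) (deSec q c) +
    q.sq ^ 5 • mulSec heω (show (4 : ℤ) + -3 = 1 by norm_num) (Sec.of _ hdf) +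
    q.c • mulSec hefω h c - q.c ^ 2 • mulSec hω h c
  have hR : deSec q (dfSec q (mulSec hω h c)) =
      (q.c ^ 2 * (lam q n : ℂ) ^ 2) • mulSec hω h c + R := by
    refine Sec.val_injective ?_
    simp only [R, map_add, map_sub, map_smul, mulSec_val, Sec.val_of]
    refine (de_df_mul hω c.val_mem).trans ?_
    rw [de_df_of_comp hc, mul_smul_comm]
    change _ = _ + (q.sq • (df q ω * de q c.val) + _ + _ - _)
    module
  have hRn : ‖R‖ ≤ A * (lam q n * ‖c‖) := by
    have hc0 := norm_nonneg c
    have hcl : ‖c‖ ≤ lam q n * ‖c‖ := le_mul_of_one_le_left hc0 hl1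
    have t1 := (hC₁ (deSec q c)).trans (mul_le_mul_of_nonneg_left (norm_deSec_le hc) h1)
    have t2 := (hC₂ (Sec.of _ hdf)).trans (mul_le_mul_of_nonneg_left (norm_df_le hc hdf) h2)
    have t3 := (hC₃ c).trans (mul_le_mul_of_nonneg_left hcl h3)
    have t4 := (hC₄ c).trans (mul_le_mul_of_nonneg_left hcl h4)
    refine (norm_sub_le _ _).trans ((add_le_add_left ((norm_add_le _ _).trans
      (add_le_add_left (norm_add_le _ _) _)) _).trans ?_)
    simp only [norm_smul]
    calc _ ≤ ‖q.sq‖ * (C₁ * (lam q n * ‖c‖)) + ‖q.sq ^ 5‖ * (C₂ * (lam q n * ‖c‖)) +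
          ‖q.c‖ * (C₃ * (lam q n * ‖c‖)) + ‖q.c ^ 2‖ * (C₄ * (lam q n * ‖c‖)) := by
          gcongr
      _ = _ := by rw [hA]; ring
  have hi : ((lam q m : ℂ) ^ 2 - q.c ^ 2 * (lam q n : ℂ) ^ 2) * inner ℂ a (mulSec hω h c) =
      inner ℂ a R := by
    have e := inner_deSec (dfSec q a) (mulSec hω h c)
    rw [inner_dfSec, deSec_dfSec ha, hR, inner_add_right, inner_smul_left, inner_smul_right,
      map_pow, Complex.conj_ofReal] at e
    linear_combination e
  have hi2 : |lam q m ^ 2 - (q : ℝ) ^ 2 * lam q n ^ 2| * ‖inner ℂ a (mulSec hω h c)‖ ≤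
      ‖a‖ * (A * (lam q n * ‖c‖)) := by
    have e : ((lam q m : ℂ) ^ 2 - q.c ^ 2 * (lam q n : ℂ) ^ 2) =
        ((lam q m ^ 2 - (q : ℝ) ^ 2 * lam q n ^ 2 : ℝ) : ℂ) := by
      push_cast; rfl
    rw [e] at hi
    have h5 := congrArg norm hi
    rw [norm_mul, Complex.norm_real, Real.norm_eq_abs] at h5
    rw [h5]
    exact (norm_inner_le_norm _ _).trans (mul_le_mul_of_nonneg_left hRn (norm_nonneg _))
  -- The left side now carries q²(1-q) lam n² and the right side lam n, so one power of lam n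
  -- remains after cancelling.
  have hi3 := (mul_le_mul_of_nonneg_right (lam_gap hmn)
    (norm_nonneg (inner ℂ a (mulSec hω h c)))).trans hi2
  rw [div_mul_eq_mul_div, div_mul_eq_mul_div, le_div_iff₀ hκ]
  refine le_of_mul_le_mul_right ?_ hl0
  linarith

lemma lam_succ (n : ℕ) : lam q (n + 1) = (q : ℝ)⁻¹ * lam q n + (q : ℝ) ^ n := by
  have hq := q.pos.ne'
  have h := (inv_sub_pos (q := q)).ne'
  rw [lam, lam, mul_div_assoc', div_add' _ _ _ h]
  congr 1
  rw [pow_succ, pow_succ]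
  field_simp
  ring

/-- By `lam_succ` each step multiplies by q⁻¹ and adds at most 1, which is at most the current
value. It makes the eigenvalues at bounded distance comparable. -/
lemma lam_add_le {m : ℕ} (hm : m ≠ 0) (J : ℕ) :
    lam q (m + J) ≤ ((q : ℝ)⁻¹ + 1) ^ J * lam q m := by
  have hq := inv_pos.2 q.pos
  induction J with
  | zero => simp
  | succ J ih =>
    rw [← add_assoc, lam_succ, pow_succ', mul_assoc]
    have h1 : (q : ℝ) ^ (m + J) ≤ 1 := pow_le_one₀ q.pos.le q.lt_one.le
    have h2 := one_le_lam (q := q) (n := m + J) (by omega)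
    have h3 := mul_le_mul_of_nonneg_left ih (show (0 : ℝ) ≤ (q : ℝ)⁻¹ + 1 by positivity)
    linarith

/-- The adjoint of the previous estimate, applied to ω*, decays in lam m instead of lam n; since
nonzero blocks have |m - n| ≤ J, the two are comparable. -/
lemma exists_inner_mulSec_le' {ω : Pol q} (hω : ω ∈ homog q (-2)) (h : (-2 : ℤ) + 1 = -1) :
    ∃ C : ℝ, 0 ≤ C ∧ ∀ m n : ℕ, m ≠ n + 1 → ∀ c ∈ comp q (-1) m, ∀ a ∈ comp q 1 n,
      lam q n * ‖inner ℂ c (mulSec hω h a)‖ ≤ C * ‖c‖ * ‖a‖ := by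
  have hω' : star ω ∈ homog q 2 := star_mem_homog hω
  have h' : (2 : ℤ) + -1 = 1 := by norm_num
  obtain ⟨C, hC0, hC⟩ := exists_inner_mulSec_le hω' h'
  obtain ⟨J, hJ⟩ := exists_inner_mulSec_eq_zero hω h (Or.inl rfl) (Or.inr rfl)
  have hq := inv_pos.2 q.pos
  refine ⟨((q : ℝ)⁻¹ + 1) ^ J * C, by positivity, fun m n hmn c hc a ha => ?_⟩
  rcases eq_or_ne m 0 with rfl | hm
  · rw [comp_zero, Submodule.mem_bot] at hc
    rw [hc]
    simp
  by_cases hJmn : (J : ℤ) < |(m : ℤ) - n|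
  · rw [hJ m n hJmn c hc a ha, norm_zero, mul_zero]
    positivity
  · have h1 := (abs_le.1 (not_lt.1 hJmn)).1
    have h2 : lam q n ≤ ((q : ℝ)⁻¹ + 1) ^ J * lam q m :=
      (lam_strictMono.monotone (show n ≤ m + J by omega)).trans (lam_add_le hm J)
    have h3 := hC n m hmn.symm a ha c hc
    have e : ‖inner ℂ c (mulSec hω h a)‖ = ‖inner ℂ a (mulSec hω' h' c)‖ := by
      rw [inner_mulSec hω h h', ← inner_conj_symm, RCLike.norm_conj]
    rw [e]
    calc _ ≤ (((q : ℝ)⁻¹ + 1) ^ J * lam q m) * ‖inner ℂ a (mulSec hω' h' c)‖ :=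
          mul_le_mul_of_nonneg_right h2 (norm_nonneg _)
      _ = ((q : ℝ)⁻¹ + 1) ^ J * (lam q m * ‖inner ℂ a (mulSec hω' h' c)‖) := by ring
      _ ≤ ((q : ℝ)⁻¹ + 1) ^ J * (C * ‖a‖ * ‖c‖) := mul_le_mul_of_nonneg_left h3 (by positivity)
      _ = _ := by ring

/-! ### Off-diagonal operators on spinors -/

/-- The operator on spinors with upper right entry `S`. -/
def upper (S : L2 q (-1) →L[ℂ] L2 q 1) : Spinor q →L[ℂ] Spinor q :=
  (WithLp.prodContinuousLinearEquiv 2 ℂ (L2 q 1) (L2 q (-1))).symm.toContinuousLinearMap ∘L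
    (ContinuousLinearMap.inl ℂ _ _ ∘L S ∘L ContinuousLinearMap.snd ℂ _ _) ∘L
    (WithLp.prodContinuousLinearEquiv 2 ℂ (L2 q 1) (L2 q (-1))).toContinuousLinearMap

/-- The operator on spinors with lower left entry `S`. -/
def lower (S : L2 q 1 →L[ℂ] L2 q (-1)) : Spinor q →L[ℂ] Spinor q :=
  (WithLp.prodContinuousLinearEquiv 2 ℂ (L2 q 1) (L2 q (-1))).symm.toContinuousLinearMap ∘L
    (ContinuousLinearMap.inr ℂ _ _ ∘L S ∘L ContinuousLinearMap.fst ℂ _ _) ∘L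
    (WithLp.prodContinuousLinearEquiv 2 ℂ (L2 q 1) (L2 q (-1))).toContinuousLinearMap

lemma upper_apply (S : L2 q (-1) →L[ℂ] L2 q 1) (ξ : Spinor q) :
    upper S ξ = WithLp.toLp 2 (S ξ.snd, 0) := rfl

lemma lower_apply (S : L2 q 1 →L[ℂ] L2 q (-1)) (ξ : Spinor q) :
    lower S ξ = WithLp.toLp 2 (0, S ξ.fst) := rfl

lemma chiPow_apply (w : ℂ) (ξ : Spinor q) :
    chiPow q w ξ = WithLp.toLp 2 (q.c ^ w • ξ.fst, q.c⁻¹ ^ w • ξ.snd) := rfl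

lemma smoothSpinor_apply (x : Sec q 1 × Sec q (-1)) :
    smoothSpinor x = WithLp.toLp 2 ((x.1 : L2 q 1), (x.2 : L2 q (-1))) := rfl

lemma inner_smoothSpinor (x y : Sec q 1 × Sec q (-1)) :
    inner ℂ (smoothSpinor x) (smoothSpinor y) = inner ℂ x.1 y.1 + inner ℂ x.2 y.2 := by
  simp [smoothSpinor_apply, WithLp.prod_inner_apply, UniformSpace.Completion.inner_coe]

lemma norm_fst_le_smoothSpinor (x : Sec q 1 × Sec q (-1)) : ‖x.1‖ ≤ ‖smoothSpinor x‖ := by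
  rw [smoothSpinor_apply, ← UniformSpace.Completion.norm_coe x.1]
  exact WithLp.norm_fst_le _ (smoothSpinor x)

lemma norm_snd_le_smoothSpinor (x : Sec q 1 × Sec q (-1)) : ‖x.2‖ ≤ ‖smoothSpinor x‖ := by
  rw [smoothSpinor_apply, ← UniformSpace.Completion.norm_coe x.2]
  exact WithLp.norm_snd_le _ (smoothSpinor x)

lemma upper_smooth {ω : Pol q} {r : ℤ} (hω : ω ∈ homog q r) (h : r + -1 = 1)
    (x : Sec q 1 × Sec q (-1)) :
    upper (mulOp hω h) (smoothSpinor x) = smoothSpinor (mulSec hω h x.2, 0) := by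
  rw [upper_apply, smoothSpinor_apply, smoothSpinor_apply, UniformSpace.Completion.coe_zero,
    ← mulOp_coe hω h]
  rfl

lemma lower_smooth {ω : Pol q} {r : ℤ} (hω : ω ∈ homog q r) (h : r + 1 = -1)
    (x : Sec q 1 × Sec q (-1)) :
    lower (mulOp hω h) (smoothSpinor x) = smoothSpinor (0, mulSec hω h x.1) := by
  rw [lower_apply, smoothSpinor_apply, smoothSpinor_apply, UniformSpace.Completion.coe_zero,
    ← mulOp_coe hω h]
  rfl

lemma act_smooth (b : homog q 0) (x : Sec q 1 × Sec q (-1)) :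
    act b (smoothSpinor x) = smoothSpinor (leftMulLin b 1 x.1, leftMulLin b (-1) x.2) := by
  rw [smoothSpinor_apply, smoothSpinor_apply, ← leftMul_coe, ← leftMul_coe]
  rfl

/-! ### The spectral decomposition of the Dirac operator -/

/-- The polynomial spinors of spin `n - 1 / 2`. -/
def spinComp (q : Param) (n : ℕ) : Submodule ℂ (Spinor q) :=
  ((comp q 1 n).prod (comp q (-1) n)).map smoothSpinor

/-- The closed subspace of spinors of spin `n - 1 / 2`. -/
def spinSpace (q : Param) (n : ℕ) : Submodule ℂ (Spinor q) := (spinComp q n).topologicalClosure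

instance (n : ℕ) : CompleteSpace (spinSpace q n) :=
  (Submodule.isClosed_topologicalClosure _).completeSpace_coe

lemma smooth_mem_diracGraph (x : Sec q 1 × Sec q (-1)) :
    (smoothSpinor x, smoothSpinor (diracAlg q x)) ∈ diracGraph q :=
  Submodule.le_topologicalClosure _ ⟨x, rfl⟩

lemma mem_eigenspace_dirac {μ : ℝ} {v : Spinor q} :
    v ∈ eigenspace (dirac q) μ ↔ (v, (μ : ℂ) • v) ∈ diracGraph q := by
  rw [← graph_dirac]
  rfl

lemma diracGraph_inner {p p' : Spinor q × Spinor q} (hp : p ∈ diracGraph q)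
    (hp' : p' ∈ diracGraph q) : inner ℂ p.2 p'.1 = inner ℂ p.1 p'.2 := by
  refine closure_minimal (t := {p' : Spinor q × Spinor q | inner ℂ p.2 p'.1 = inner ℂ p.1 p'.2})
    ?_ (isClosed_eq (by fun_prop) (by fun_prop)) hp'
  rintro _ ⟨x, rfl⟩
  exact diracGraph_symm x hp

lemma inner_eigenspace_dirac {μ ν : ℝ} (h : μ ≠ ν) {v w : Spinor q}
    (hv : v ∈ eigenspace (dirac q) μ) (hw : w ∈ eigenspace (dirac q) ν) : inner ℂ v w = 0 := by
  have h1 := diracGraph_inner (mem_eigenspace_dirac.1 hv) (mem_eigenspace_dirac.1 hw)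
  simp only [inner_smul_left, inner_smul_right, Complex.conj_ofReal] at h1
  have h2 : (μ : ℂ) - ν ≠ 0 := sub_ne_zero.2 (by exact_mod_cast h)
  refine (mul_eq_zero.1 (?_ : ((μ : ℂ) - ν) * _ = 0)).resolve_left h2
  rw [sub_mul, h1, sub_self]

lemma smooth_mem_eigenspace {μ : ℝ} {x : Sec q 1 × Sec q (-1)}
    (h : diracAlg q x = (μ : ℂ) • x) : smoothSpinor x ∈ eigenspace (dirac q) μ := by
  rw [mem_eigenspace_dirac, ← map_smul, ← h]
  exact smooth_mem_diracGraph x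

lemma diracAlg_diracAlg {n : ℕ} {x : Sec q 1 × Sec q (-1)}
    (hx : x ∈ (comp q 1 n).prod (comp q (-1) n)) :
    diracAlg q (diracAlg q x) = ((lam q n : ℂ) ^ 2) • x :=
  Prod.ext (deSec_dfSec hx.1) (dfSec_deSec hx.2)

/-- As D² = lam n² here, x is the sum of ½(x ± lam n⁻¹ D x), which are eigenvectors for ±lam n. -/
lemma spinComp_le {n : ℕ} (hn : n ≠ 0) :
    spinComp q n ≤ eigenspace (dirac q) (lam q n) ⊔ eigenspace (dirac q) (-lam q n) := by
  rintro _ ⟨x, hx, rfl⟩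
  have hl : (lam q n : ℂ) ≠ 0 := by exact_mod_cast (lam_pos hn).ne'
  have hD := diracAlg_diracAlg hx
  have e : x = (2 : ℂ)⁻¹ • (x + (lam q n : ℂ)⁻¹ • diracAlg q x) +
      (2 : ℂ)⁻¹ • (x - (lam q n : ℂ)⁻¹ • diracAlg q x) := by module
  rw [e, map_add]
  refine Submodule.add_mem_sup (smooth_mem_eigenspace ?_) (smooth_mem_eigenspace ?_)
  · rw [map_smul, map_add, map_smul, hD]
    match_scalars <;> field_simp
  · rw [map_smul, map_sub, map_smul, hD]
    match_scalars <;> field_simp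

/-- Reduces closed relations on the completed spin spaces to polynomial spinors. -/
lemma spinSpace_induction {P : Spinor q → Spinor q → Prop}
    (hP : IsClosed {p : Spinor q × Spinor q | P p.1 p.2}) {m n : ℕ}
    (h : ∀ x ∈ (comp q 1 m).prod (comp q (-1) m), ∀ y ∈ (comp q 1 n).prod (comp q (-1) n),
      P (smoothSpinor x) (smoothSpinor y)) {u w : Spinor q} (hu : u ∈ spinSpace q m)
    (hw : w ∈ spinSpace q n) : P u w := by
  have h1 : (u, w) ∈ closure ((spinComp q m : Set (Spinor q)) ×ˢ (spinComp q n : Set _)) := by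
    rw [closure_prod_eq]
    exact ⟨hu, hw⟩
  refine closure_minimal ?_ hP h1
  rintro ⟨_, _⟩ ⟨⟨x, hx, rfl⟩, ⟨y, hy, rfl⟩⟩
  exact h x hx y hy

/-- Each polynomial has finite degree, hence finitely many spin components; with density of
polynomial spinors this gives totality. -/
lemma smooth_mem_iSup (x : Sec q 1 × Sec q (-1)) : smoothSpinor x ∈ ⨆ n, spinSpace q n := by
  have h1 : ∀ a : Sec q 1, smoothSpinor (a, 0) ∈ ⨆ n, spinSpace q n := by
    intro a
    obtain ⟨N, hN⟩ := exists_mem_degLE a.val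
    have h := mem_iSup_comp (Or.inl rfl) hN
    have h2 : (⨆ (n : ℕ) (_ : 2 * n ≤ N + 1), comp q 1 n) ≤
        (⨆ n, spinSpace q n).comap (smoothSpinor ∘ₗ LinearMap.inl ℂ _ _) :=
      iSup₂_le fun n _ y hy => Submodule.mem_iSup_of_mem n
        (Submodule.le_topologicalClosure _ ⟨(y, 0), ⟨hy, zero_mem _⟩, rfl⟩)
    exact h2 h
  have h1' : ∀ c : Sec q (-1), smoothSpinor (0, c) ∈ ⨆ n, spinSpace q n := by
    intro c
    obtain ⟨N, hN⟩ := exists_mem_degLE c.val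
    have h := mem_iSup_comp (Or.inr rfl) hN
    have h2 : (⨆ (n : ℕ) (_ : 2 * n ≤ N + 1), comp q (-1) n) ≤
        (⨆ n, spinSpace q n).comap (smoothSpinor ∘ₗ LinearMap.inr ℂ _ _) :=
      iSup₂_le fun n _ y hy => Submodule.mem_iSup_of_mem n
        (Submodule.le_topologicalClosure _ ⟨(0, y), ⟨zero_mem _, hy⟩, rfl⟩)
    exact h2 h
  have e : smoothSpinor x = smoothSpinor (x.1, 0) + smoothSpinor (0, x.2) := by
    rw [← map_add]; simp
  rw [e]
  exact add_mem (h1 _) (h1' _)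

/-- The subspaces of fixed spin decompose the Dirac operator. -/
lemma isAbsDecomp_dirac : IsAbsDecomp (dirac q) (spinSpace q) (lam q) where
  decomp :=
    { ortho := fun m n hmn u hu w hw => by
        refine spinSpace_induction (P := fun u w => inner ℂ u w = 0)
          (isClosed_eq (by fun_prop) continuous_const) (fun x hx y hy => ?_) hu hw
        rw [inner_smoothSpinor, inner_comp_pos hmn hx.1 hy.1, inner_comp_neg hmn hx.2 hy.2,
          add_zero]
      total := fun x hx => by
        have h1 : (⨆ n, spinSpace q n) ≤ (Submodule.span ℂ {x})ᗮ := by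
          refine iSup_le fun n v hv => ?_
          rw [Submodule.mem_orthogonal_singleton_iff_inner_left]
          exact hx n v hv
        refine denseRange_smoothSpinor.induction_on (p := fun v => inner ℂ v x = 0) x
          (isClosed_eq (by fun_prop) continuous_const) (fun y => ?_) |> inner_self_eq_zero.1
        exact Submodule.mem_orthogonal_singleton_iff_inner_left.1 (h1 (smooth_mem_iSup y)) }
  zero := by
    rw [spinSpace, spinComp, comp_zero, comp_zero, Submodule.prod_bot, Submodule.map_bot]
    exact isClosed_singleton.submodule_topologicalClosure_eq
  pos _ hn := lam_pos hn
  inj := lam_strictMono.injective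
  ortho _ _ h _ hv _ hw := inner_eigenspace_dirac h hv hw
  le n hn := Submodule.topologicalClosure_mono (spinComp_le hn)

/-! ### The commutators with elements of the algebra of the quantum sphere -/

/-- The factor q^{1/2} is the eigenvalue of ∂_{k⁻¹} on weight -1, which the Leibniz rule for ∂_e
puts in front of the derivative of b. On weight 1 it becomes q^{-1/2}, used for ∂_f. -/
lemma sq_smul_de_mem (b : homog q 0) : q.sq • de q (b : Pol q) ∈ homog q 2 :=
  Submodule.smul_mem _ _ (by simpa using de_mem b.2)

lemma sq_inv_smul_df_mem (b : homog q 0) : q.sq⁻¹ • df q (b : Pol q) ∈ homog q (-2) :=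
  Submodule.smul_mem _ _ (by simpa using df_mem b.2)

/-- The upper right entry of the commutator `[D, b]`. -/
def commUpper (b : homog q 0) : Spinor q →L[ℂ] Spinor q :=
  upper (mulOp (sq_smul_de_mem b) (show (2 : ℤ) + -1 = 1 by norm_num))

/-- The lower left entry of the commutator `[D, b]`. -/
def commLower (b : homog q 0) : Spinor q →L[ℂ] Spinor q :=
  lower (mulOp (sq_inv_smul_df_mem b) (show (-2 : ℤ) + 1 = -1 by norm_num))

lemma diracAlg_mul (b : homog q 0) (x : Sec q 1 × Sec q (-1)) :
    diracAlg q (leftMulLin b 1 x.1, leftMulLin b (-1) x.2) =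
      (mulSec (sq_smul_de_mem b) (show (2 : ℤ) + -1 = 1 by norm_num) x.2,
        mulSec (sq_inv_smul_df_mem b) (show (-2 : ℤ) + 1 = -1 by norm_num) x.1) +
      (leftMulLin b 1 (diracAlg q x).1, leftMulLin b (-1) (diracAlg q x).2) := by
  have hb : dk q (b : Pol q) = b := by simpa using mem_homog.1 b.2
  have h1 := dkinv_of_mem x.1.val_mem
  have h2 := dkinv_of_mem x.2.val_mem
  rw [zpow_neg, zpow_one] at h1
  rw [neg_neg, zpow_one] at h2
  refine Prod.ext (Sec.val_injective ?_) (Sec.val_injective ?_)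
  · change de q (b * x.2.val) = (q.sq • de q (b : Pol q)) * x.2.val + b * de q x.2.val
    rw [de_mul, hb, h2, mul_smul_comm, smul_mul_assoc]
  · change df q (b * x.1.val) = (q.sq⁻¹ • df q (b : Pol q)) * x.1.val + b * df q x.1.val
    rw [df_mul, hb, h1, mul_smul_comm, smul_mul_assoc]

/-- The Leibniz rule `diracAlg_mul` gives this on polynomial spinors, and all operators involved are
bounded, so it passes to the closed graph. That is why b preserves the domain of D. -/
lemma act_mem_diracGraph (b : homog q 0) {p : Spinor q × Spinor q} (hp : p ∈ diracGraph q) :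
    (act b p.1, (commUpper b + commLower b) p.1 + act b p.2) ∈ diracGraph q := by
  have hcl : IsClosed {p : Spinor q × Spinor q |
      (act b p.1, (commUpper b + commLower b) p.1 + act b p.2) ∈ diracGraph q} :=
    (Submodule.isClosed_topologicalClosure _).preimage
      (f := fun p : Spinor q × Spinor q =>
        (act b p.1, (commUpper b + commLower b) p.1 + act b p.2)) (by fun_prop)
  refine closure_minimal ?_ hcl hp
  rintro _ ⟨x, rfl⟩
  have h := smooth_mem_diracGraph (leftMulLin b 1 x.1, leftMulLin b (-1) x.2)
  rw [diracAlg_mul, map_add, ← act_smooth] at h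
  change (act b (smoothSpinor x), (commUpper b + commLower b) (smoothSpinor x) +
    act b (smoothSpinor (diracAlg q x))) ∈ diracGraph q
  rw [act_smooth b (diracAlg q x), _root_.add_apply, commUpper, commLower, upper_smooth,
    lower_smooth, ← map_add smoothSpinor (_, 0), Prod.mk_add_mk, add_zero, zero_add]
  exact h

lemma commutator_dirac (b : homog q 0) (ξ : (dirac q).domain) :
    ∃ h : act b ξ ∈ (dirac q).domain, (commUpper b + commLower b) ξ =
      dirac q ⟨act b ξ, h⟩ - act b (dirac q ξ) := by
  have h1 : ((ξ : Spinor q), dirac q ξ) ∈ diracGraph q := by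
    rw [← graph_dirac]
    exact (dirac q).mem_graph ξ
  have h2 := act_mem_diracGraph b h1
  rw [← graph_dirac, LinearPMap.mem_graph_iff] at h2
  obtain ⟨y, hy1, hy2⟩ := h2
  have hy : act b ξ ∈ (dirac q).domain := by
    have h3 := y.2
    rwa [hy1] at h3
  refine ⟨hy, ?_⟩
  have : (⟨act b ξ, hy⟩ : (dirac q).domain) = y := Subtype.ext hy1.symm
  rw [this, hy2, add_sub_cancel_right]

/-- The shift is -1: the resonance lam m ≈ q·lam n, excluded in `exists_inner_mulSec_le`, is m = n -
1. -/
lemma exists_family_commUpper (b : homog q 0) : ∃ B : ℂ → Spinor q →L[ℂ] Spinor q,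
    Differentiable ℂ B ∧ LinearGrowth B ∧ ∀ z m n x,
      (spinSpace q m).starProjection (B z ((spinSpace q n).starProjection x)) =
        (((lam q m : ℂ) ^ (-2 * z) * (lam q n : ℂ) ^ (2 * z) -
          Complex.exp (z * (2 * (-1 : ℤ) * Real.log q : ℝ))) * lam q n) •
            (spinSpace q m).starProjection (commUpper b ((spinSpace q n).starProjection x)) := by
  have hd := isAbsDecomp_dirac (q := q)
  obtain ⟨J, hJ⟩ := exists_inner_mulSec_eq_zero (sq_smul_de_mem b)
    (show (2 : ℤ) + -1 = 1 by norm_num) (Or.inr rfl) (Or.inl rfl)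
  obtain ⟨C, hC0, hC⟩ := exists_inner_mulSec_le (sq_smul_de_mem b) (by norm_num)
  refine hd.decomp.exists_twist q hd.zero (commUpper b) (-1) (J := J) (C := C) ?_ ?_
  · intro m n hmn u hu w hw
    refine spinSpace_induction (P := fun u w => inner ℂ u (commUpper b w) = 0)
      (isClosed_eq (by fun_prop) continuous_const) (fun x hx y hy => ?_) hu hw
    rw [commUpper, upper_smooth, inner_smoothSpinor, hJ m n hmn _ hx.1 _ hy.2, inner_zero_right,
      add_zero]
  · intro m n hmn u hu w hw
    refine spinSpace_induction
      (P := fun u w => lam q n * ‖inner ℂ u (commUpper b w)‖ ≤ C * ‖u‖ * ‖w‖)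
      (isClosed_le (by fun_prop) (by fun_prop)) (fun x hx y hy => ?_) hu hw
    rw [commUpper, upper_smooth, inner_smoothSpinor, inner_zero_right, add_zero]
    have h1 := norm_fst_le_smoothSpinor x
    have h2 := norm_snd_le_smoothSpinor y
    refine (hC m n (by omega) _ hx.1 _ hy.2).trans ?_
    gcongr

/-- The shift is +1, the adjoint of the situation for the upper entry. -/
lemma exists_family_commLower (b : homog q 0) : ∃ B : ℂ → Spinor q →L[ℂ] Spinor q,
    Differentiable ℂ B ∧ LinearGrowth B ∧ ∀ z m n x,
      (spinSpace q m).starProjection (B z ((spinSpace q n).starProjection x)) =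
        (((lam q m : ℂ) ^ (-2 * z) * (lam q n : ℂ) ^ (2 * z) -
          Complex.exp (z * (2 * (1 : ℤ) * Real.log q : ℝ))) * lam q n) •
            (spinSpace q m).starProjection (commLower b ((spinSpace q n).starProjection x)) := by
  have hd := isAbsDecomp_dirac (q := q)
  obtain ⟨J, hJ⟩ := exists_inner_mulSec_eq_zero (sq_inv_smul_df_mem b)
    (show (-2 : ℤ) + 1 = -1 by norm_num) (Or.inl rfl) (Or.inr rfl)
  obtain ⟨C, hC0, hC⟩ := exists_inner_mulSec_le' (sq_inv_smul_df_mem b) (by norm_num)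
  refine hd.decomp.exists_twist q hd.zero (commLower b) 1 (J := J) (C := C) ?_ ?_
  · intro m n hmn u hu w hw
    refine spinSpace_induction (P := fun u w => inner ℂ u (commLower b w) = 0)
      (isClosed_eq (by fun_prop) continuous_const) (fun x hx y hy => ?_) hu hw
    rw [commLower, lower_smooth, inner_smoothSpinor, hJ m n hmn _ hx.2 _ hy.1, inner_zero_right,
      zero_add]
  · intro m n hmn u hu w hw
    refine spinSpace_induction
      (P := fun u w => lam q n * ‖inner ℂ u (commLower b w)‖ ≤ C * ‖u‖ * ‖w‖)
      (isClosed_le (by fun_prop) (by fun_prop)) (fun x hx y hy => ?_) hu hw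
    rw [commLower, lower_smooth, inner_smoothSpinor, inner_zero_right, zero_add]
    have h1 := norm_snd_le_smoothSpinor x
    have h2 := norm_fst_le_smoothSpinor y
    refine (hC m n (by omega) _ hx.2 _ hy.1).trans ?_
    gcongr

/-! ### Complex powers of χ against the off-diagonal entries -/

lemma c_cpow (w : ℂ) : q.c ^ w = Complex.exp (w * Real.log q) := by
  rw [Complex.cpow_def_of_ne_zero q.c_ne, Param.c, ← Complex.ofReal_log q.pos.le, mul_comm]

lemma c_inv_cpow (w : ℂ) : q.c⁻¹ ^ w = Complex.exp (-w * Real.log q) := by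
  rw [Complex.cpow_def_of_ne_zero (inv_ne_zero q.c_ne), Param.c, ← Complex.ofReal_inv,
    ← Complex.ofReal_log (inv_nonneg.2 q.pos.le), Real.log_inv]
  congr 1
  push_cast
  ring

lemma upper_chiPow (S : L2 q (-1) →L[ℂ] L2 q 1) (w : ℂ) (ξ : Spinor q) :
    upper S (chiPow q w ξ) = q.c⁻¹ ^ w • upper S ξ := by
  rw [upper_apply, upper_apply, chiPow_apply, ← WithLp.toLp_smul, Prod.smul_mk, smul_zero,
    ← map_smul]
  rfl

lemma lower_chiPow (S : L2 q 1 →L[ℂ] L2 q (-1)) (w : ℂ) (ξ : Spinor q) :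
    lower S (chiPow q w ξ) = q.c ^ w • lower S ξ := by
  rw [lower_apply, lower_apply, chiPow_apply, ← WithLp.toLp_smul, Prod.smul_mk, smul_zero,
    ← map_smul]
  rfl

lemma chiPow_upper (S : L2 q (-1) →L[ℂ] L2 q 1) (w : ℂ) (ξ : Spinor q) :
    chiPow q w (upper S ξ) = q.c ^ w • upper S ξ := by
  rw [upper_apply, chiPow_apply, ← WithLp.toLp_smul, Prod.smul_mk]
  change WithLp.toLp 2 (_, q.c⁻¹ ^ w • (0 : L2 q (-1))) = _
  rw [smul_zero, smul_zero]
  rfl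

lemma chiPow_lower (S : L2 q 1 →L[ℂ] L2 q (-1)) (w : ℂ) (ξ : Spinor q) :
    chiPow q w (lower S ξ) = q.c⁻¹ ^ w • lower S ξ := by
  rw [lower_apply, chiPow_apply, ← WithLp.toLp_smul, Prod.smul_mk]
  change WithLp.toLp 2 (q.c ^ w • (0 : L2 q 1), _) = _
  rw [smul_zero, smul_zero]
  rfl

/-- The upper entry reads the second component, where χ is q⁻¹, and the lower entry reads the first.
On the left of the commutator the roles of q and q⁻¹ are exchanged, which is why χ^{2z} on the right
equals χ^{-2z} on the left. -/
lemma comm_chiPow (b : homog q 0) (w : ℂ) (ξ : Spinor q) :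
    (commUpper b + commLower b) (chiPow q w ξ) =
      Complex.exp (-w * Real.log q) • commUpper b ξ +
        Complex.exp (w * Real.log q) • commLower b ξ := by
  rw [_root_.add_apply, commUpper, commLower, upper_chiPow, lower_chiPow, c_cpow, c_inv_cpow]

lemma chiPow_comm (b : homog q 0) (w : ℂ) (ξ : Spinor q) :
    chiPow q w ((commUpper b + commLower b) ξ) =
      Complex.exp (w * Real.log q) • commUpper b ξ +
        Complex.exp (-w * Real.log q) • commLower b ξ := by
  rw [_root_.add_apply, map_add, commUpper, commLower, chiPow_upper, chiPow_lower, c_cpow,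
    c_inv_cpow]

end QSphere

end

theorem corollary3p3 (q : QSphere.Param) (b : QSphere.homog q 0) :
    ∃ db : QSphere.Spinor q →L[ℂ] QSphere.Spinor q,
      (∀ ξ : (QSphere.dirac q).domain, ∃ h : QSphere.act b ξ ∈ (QSphere.dirac q).domain,
        db ξ = QSphere.dirac q ⟨QSphere.act b ξ, h⟩ - QSphere.act b (QSphere.dirac q ξ)) ∧
      ∃ bz : ℂ → QSphere.Spinor q →L[ℂ] QSphere.Spinor q,
        AnalyticOnNhd ℂ bz Set.univ ∧
        (∀ x y : ℝ, ∃ C : ℝ, 0 < C ∧ ∀ z : ℂ, z.re ∈ Set.Icc x y → ‖bz z‖ ≤ C * ‖z‖) ∧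
        ∀ (z : ℂ) (ξ : (QSphere.absPow (QSphere.dirac q) (-2 * z)).domain),
          ∃ (h₁ : db ξ ∈ (QSphere.absPow (QSphere.dirac q) (-2 * z)).domain)
            (h₂ : (ξ : QSphere.Spinor q) ∈
              (QSphere.absPow (QSphere.dirac q) (-2 * z - 1)).domain),
            QSphere.absPow (QSphere.dirac q) (-2 * z) ⟨db ξ, h₁⟩ =
              db (QSphere.chiPow q (2 * z) (QSphere.absPow (QSphere.dirac q) (-2 * z) ξ)) +
                bz z (QSphere.absPow (QSphere.dirac q) (-2 * z - 1) ⟨ξ, h₂⟩) ∧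
            QSphere.absPow (QSphere.dirac q) (-2 * z) ⟨db ξ, h₁⟩ =
              QSphere.chiPow q (-2 * z) (db (QSphere.absPow (QSphere.dirac q) (-2 * z) ξ)) +
                bz z (QSphere.absPow (QSphere.dirac q) (-2 * z - 1) ⟨ξ, h₂⟩) := by
  obtain ⟨b₁, hd₁, hg₁, hb₁⟩ := QSphere.exists_family_commUpper b
  obtain ⟨b₂, hd₂, hg₂, hb₂⟩ := QSphere.exists_family_commLower b
  refine ⟨QSphere.commUpper b + QSphere.commLower b, QSphere.commutator_dirac b,
    fun z => b₁ z + b₂ z, (hd₁.add hd₂).differentiableOn.analyticOnNhd isOpen_univ,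
    hg₁.add hg₂, fun z ξ => ?_⟩
  obtain ⟨h₁, h₂, h⟩ := QSphere.isAbsDecomp_dirac.absPow_comp _ _ hb₁ hb₂ z ξ
  -- The limit scalars for the shifts -1 and +1 are q^{-2z} and q^{2z}, written in the form in which
  -- the powers of χ produce them.
  have e₁ : z * ((2 * ((-1 : ℤ) : ℝ) * Real.log q : ℝ) : ℂ) = -(2 * z) * Real.log q := by
    push_cast; ring
  have e₂ : z * ((2 * ((1 : ℤ) : ℝ) * Real.log q : ℝ) : ℂ) = 2 * z * Real.log q := by
    push_cast; ring
  rw [e₁, e₂] at h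
  refine ⟨h₁, h₂, ?_, ?_⟩
  · rw [QSphere.comm_chiPow]
    exact h
  · have e₃ : -2 * z * (Real.log q : ℂ) = -(2 * z) * Real.log q := by ring
    have e₄ : -(-2 * z) * (Real.log q : ℂ) = 2 * z * Real.log q := by ring
    rw [QSphere.chiPow_comm, e₃, e₄]
    exact h
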